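/- Let $K$ be an algebraically closed field, and let $\Gamma$ be the quiver with vertices $e_0,e_1,e_2,e_3$ (indices modulo $4$) and two arrows $a_{0,m},a_{1,m}$ from $e_m$ to $e_{m+1}$ for each $m$ modulo $4$. In the path algebra $K\Gamma$ (paths written from left to right) put $x_l=\sum_{m=0}^{3}a_{l,m}$, with $l$ modulo $2$. Let $T\ge 0$ be an integer and $q_0,q_1,q_2,q_3\in K^\times$ (indices modulo $4$), and let $$A=A_T(q_0,q_1,q_2,q_3)=K\Gamma\big/\big\langle x_lx_{l+1},\ e_i(q_ix_i^{4T+2}+x_{i+1}^{4T+2})\ \big|\ l=0,1;\ 0\le i\le 3\big\rangle .$$ Put $S_{u,v}=\prod_{t=0}^{u-1}q_{t+v}$ for $u\ge0$ and $v$ modulo $4$ (so $S_{0,v}=1$). Define $g^n_{i,j}\in K\Gamma$ for $n\ge0$, $i$ modulo $4$ and $0\le j\le n$ by $g^0_{i,0}=e_i$, $$g_{i,j}^{2m+1}=\begin{cases} g_{i,0}^{2m}x_{i} & j=0\\ S_{2m-j+1,i+j-1}\,g_{i,j-1}^{2m}x_{i+1}^{4T+1}+g_{i,j}^{2m}x_{i}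 & 1\le j\le m\\ S_{2m-j+1,i+j-1}\,g_{i,j-1}^{2m}x_{i+1}+g_{i,j}^{2m}x_{i}^{4T+1} & m+1\le j\le 2m\\ g_{i,2m}^{2m}x_{i+1} & j=2m+1 \end{cases}\qquad(m\ge0),$$ $$g_{i,j}^{2m}=\begin{cases} g_{i,0}^{2m-1}x_{i+1} & j=0\\ S_{2m-j,i+j-1}\,g_{i,j-1}^{2m-1}x_{i}^{4T+1}+g_{i,j}^{2m-1}x_{i+1} & 1\le j\le m-1\\ S_{m,i+m-1}\,g_{i,m-1}^{2m-1}x_{i}^{4T+1}+g_{i,m}^{2m-1}x_{i+1}^{4T+1} & j=m\\ S_{2m-j,i+j-1}\,g_{i,j-1}^{2m-1}x_{i}+g_{i,j}^{2m-1}x_{i+1}^{4T+1} & m+1\le j\le 2m-1\\ g_{i,2m-1}^{2m-1}x_{i} & j=2m \end{cases}\qquad(m\ge1),$$ and let $\mathcal G^n=\{g^n_{i,j}\mid 0\le i\le3,\ 0\le j\le n\}$. Then, for each $n$, the elements $g^n_{i,j}$ are nonzero and pairwise distinct, and $g^n_{i,j}=e_i\,g^n_{i,j}\,e_{i+n}$,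 that is, $g^n_{i,j}$ is uniform with origin $\mathfrak o(g^n_{i,j})=e_i$ and terminus $\mathfrak t(g^n_{i,j})=e_{i+n}$. Let $R^n=\bigoplus_{g\in\mathcal G^n}A\,\mathfrak o(g)\otimes_K\mathfrak t(g)A=\bigoplus_{i=0}^{3}\bigoplus_{j=0}^{n}Ae_i\otimes_K e_{i+n}A$, with generators $\mathfrak p^n_{i,j}=e_i\otimes e_{i+n}$ in the summand of $g^n_{i,j}$ ($i$ modulo $4$). Let $\partial^0:R^0\to A$ be the multiplication map, and for $n\ge1$ let $\partial^n:R^n\to R^{n-1}$ be the $A$-$A$-bimodule homomorphism given, for $m\ge0$, by $$\partial^{2m+1}(\mathfrak p_{i,j}^{2m+1})=\begin{cases} \mathfrak p_{i,0}^{2m}x_i-x_i\mathfrak p_{i+1,0}^{2m} & j=0\\ S_{2m-j+1,i+j-1}\mathfrak p_{i,j-1}^{2m}x_{i+1}^{4T+1}+\mathfrak p_{i,j}^{2m}x_i-S_{j,i}x_i\mathfrak p_{i+1,j}^{2m}-x_{i+1}^{4T+1}\mathfrak p_{i+1,j-1}^{2m} & 1\le j<m+1\\ S_{2m-j+1,i+j-1}\mathfrak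 p_{i,j-1}^{2m}x_{i+1}+\mathfrak p_{i,j}^{2m}x_i^{4T+1}-S_{j,i}x_i^{4T+1}\mathfrak p_{i+1,j}^{2m}-x_{i+1}\mathfrak p_{i+1,j-1}^{2m} & m+1\le j<2m+1\\ \mathfrak p_{i,2m}^{2m}x_{i+1}-x_{i+1}\mathfrak p_{i+1,2m}^{2m} & j=2m+1 \end{cases}$$ and, for $m\ge1$, by $\partial^{2m}(\mathfrak p_{i,j}^{2m})=$ $$\begin{cases} \mathfrak p_{i,0}^{2m-1}x_{i+1}+x_i\mathfrak p_{i+1,0}^{2m-1} & j=0\\ S_{2m-j,i+j-1}\mathfrak p_{i,j-1}^{2m-1}x_i^{4T+1}+\mathfrak p_{i,j}^{2m-1}x_{i+1}+S_{j,i}x_i\mathfrak p_{i+1,j}^{2m-1}+x_{i+1}^{4T+1}\mathfrak p_{i+1,j-1}^{2m-1} & 1\le j<m\\ \begin{aligned} &\textstyle\sum_{k=0}^{T}\big[x_i^{4k}\big(S_{m,i+m-1}\mathfrak p_{i,m-1}^{2m-1}x_i+S_{m,i}x_i\mathfrak p_{i+1,m}^{2m-1}\big)x_i^{4T-4k}\\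 &\quad+x_{i+1}^{4k}\big(\mathfrak p_{i,m}^{2m-1}x_{i+1}+x_{i+1}\mathfrak p_{i+1,m-1}^{2m-1}\big)x_{i+1}^{4T-4k}\big]\\ &\textstyle+\sum_{k=0}^{T-1}\big[x_i^{4k+2}\big(S_{m,i}\mathfrak p_{i+2,m-1}^{2m-1}x_i+S_{m,i+m-1}x_i\mathfrak p_{i+3,m}^{2m-1}\big)x_i^{4T-4k-2}\\ &\quad+S_{m,i+3}^{-1}S_{m,i+m+2}\,x_{i+1}^{4k+2}\big(\mathfrak p_{i+2,m}^{2m-1}x_{i+1}+x_{i+1}\mathfrak p_{i+3,m-1}^{2m-1}\big)x_{i+1}^{4T-4k-2}\big] \end{aligned} & j=m\\ S_{2m-j,i+j-1}\mathfrak p_{i,j-1}^{2m-1}x_i+\mathfrak p_{i,j}^{2m-1}x_{i+1}^{4T+1}+S_{j,i}x_i^{4T+1}\mathfrak p_{i+1,j}^{2m-1}+x_{i+1}\mathfrak p_{i+1,j-1}^{2m-1} & m+1\le j<2m\\ \mathfrak p_{i,2m-1}^{2m-1}x_i+x_{i+1}\mathfrak p_{i+1,2m-1}^{2m-1} & j=2m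 . \end{cases}$$ Then $\cdots\to R^2\xrightarrow{\partial^2}R^1\xrightarrow{\partial^1}R^0\xrightarrow{\partial^0}A\to0$ is a minimal projective bimodule resolution of $A$: the sequence is exact, every $R^n$ is a projective $A$-$A$-bimodule, and every $R^n$ ($n\ge0$) is a projective cover of the image of $\partial^n$, that is, $\operatorname{Ker}\partial^n$ is a superfluous sub-bimodule of $R^n$. -/

import Mathlib

open scoped TensorProduct
open MulOpposite

noncomputable section

universe u v w

/-! ### Path algebras of finite quivers -/

/-- The path algebra of a quiver with finitely many vertices: the free `K`-module on all paths,
written as the family of its components "paths from `a` to `b`". -/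
def PathAlgebra (K : Type u) (V : Type v) [Field K] [Quiver.{w} V] : Type (max u v w) :=
  (a b : V) → Quiver.Path a b →₀ K

namespace PathAlgebra

variable {K : Type u} {V : Type v} [Field K] [Quiver.{w} V]

instance : AddCommGroup (PathAlgebra K V) :=
  inferInstanceAs (AddCommGroup ((a b : V) → Quiver.Path a b →₀ K))

instance : Module K (PathAlgebra K V) :=
  inferInstanceAs (Module K ((a b : V) → Quiver.Path a b →₀ K))

/-- The bilinear extension of the concatenation of paths. -/
def comp (a b c : V) :
    (Quiver.Path a b →₀ K) →ₗ[K] (Quiver.Path b c →₀ K) →ₗ[K] (Quiver.Path a c →₀ K) :=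
  Finsupp.lift _ K _ fun p => Finsupp.lmapDomain K K fun r => p.comp r

theorem comp_single (a b c : V) (p : Quiver.Path a b) (r : Quiver.Path b c) (s t : K) :
    comp a b c (Finsupp.single p s) (Finsupp.single r t) = Finsupp.single (p.comp r) (s * t) := by
  simp [comp]

theorem comp_assoc {a b c d : V} (f : Quiver.Path a b →₀ K) (g : Quiver.Path b c →₀ K)
    (h : Quiver.Path c d →₀ K) :
    comp a c d (comp a b c f g) h = comp a b d f (comp b c d g h) := by
  induction f using Finsupp.induction_linear with
  | zero => simp
  | add f₁ f₂ h₁ h₂ => simp [h₁, h₂]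
  | single p s =>
    induction g using Finsupp.induction_linear with
    | zero => simp
    | add f₁ f₂ h₁ h₂ => simp [h₁, h₂]
    | single r t =>
      induction h using Finsupp.induction_linear with
      | zero => simp
      | add f₁ f₂ h₁ h₂ => simp [h₁, h₂]
      | single w u => simp only [comp_single, mul_assoc, Quiver.Path.comp_assoc]

theorem nil_comp {a b : V} (f : Quiver.Path a b →₀ K) :
    comp a a b (Finsupp.single Quiver.Path.nil 1) f = f := by
  induction f using Finsupp.induction_linear with
  | zero => simp
  | add f₁ f₂ h₁ h₂ => simp [h₁, h₂]
  | single p s => simp [comp_single]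

theorem comp_nil {a b : V} (f : Quiver.Path a b →₀ K) :
    comp a b b f (Finsupp.single Quiver.Path.nil 1) = f := by
  induction f using Finsupp.induction_linear with
  | zero => simp
  | add f₁ f₂ h₁ h₂ => simp [h₁, h₂]
  | single p s => simp [comp_single]

theorem add_apply (f g : PathAlgebra K V) (a c : V) : (f + g) a c = f a c + g a c := rfl

theorem zero_apply (a c : V) : (0 : PathAlgebra K V) a c = 0 := rfl

theorem smul_apply (s : K) (f : PathAlgebra K V) (a c : V) : (s • f) a c = s • f a c := rfl

protected theorem ext {f g : PathAlgebra K V} (h : ∀ a c, f a c = g a c) : f = g :=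
  funext fun a => funext fun c => h a c

/-- Paths are multiplied from left to right; the product of two paths that cannot be concatenated
is zero. -/
instance [Fintype V] : Mul (PathAlgebra K V) :=
  ⟨fun f g a c => ∑ b, comp a b c (f a b) (g b c)⟩

/-- The unit is the sum of the trivial paths. -/
instance [DecidableEq V] : One (PathAlgebra K V) :=
  ⟨fun a => Pi.single a (Finsupp.single Quiver.Path.nil 1)⟩

theorem mul_apply [Fintype V] (f g : PathAlgebra K V) (a c : V) :
    (f * g) a c = ∑ b, comp a b c (f a b) (g b c) := rfl

theorem one_apply [DecidableEq V] (a : V) :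
    (1 : PathAlgebra K V) a = Pi.single a (Finsupp.single Quiver.Path.nil 1) := rfl

variable [Fintype V] [DecidableEq V]

instance : Ring (PathAlgebra K V) :=
  { (inferInstance : AddCommGroup (PathAlgebra K V)),
    (inferInstance : Mul (PathAlgebra K V)),
    (inferInstance : One (PathAlgebra K V)) with
    left_distrib := fun f g h => PathAlgebra.ext fun a c => by
      simp [mul_apply, add_apply, Finset.sum_add_distrib]
    right_distrib := fun f g h => PathAlgebra.ext fun a c => by
      simp [mul_apply, add_apply, Finset.sum_add_distrib]
    zero_mul := fun f => PathAlgebra.ext fun a c => by simp [mul_apply, zero_apply]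
    mul_zero := fun f => PathAlgebra.ext fun a c => by simp [mul_apply, zero_apply]
    mul_assoc := fun f g h => PathAlgebra.ext fun a d => by
      simp only [mul_apply, map_sum, LinearMap.sum_apply, comp_assoc]
      exact Finset.sum_comm
    one_mul := fun f => PathAlgebra.ext fun a c => by
      rw [mul_apply, Finset.sum_eq_single a]
      · simp [one_apply, nil_comp]
      · intro b _ hb
        simp [one_apply, Pi.single_eq_of_ne hb]
      · simp
    mul_one := fun f => PathAlgebra.ext fun a c => by
      rw [mul_apply, Finset.sum_eq_single c]
      · simp [one_apply, comp_nil]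
      · intro b _ hb
        simp [one_apply, Pi.single_eq_of_ne hb.symm]
      · simp }

instance : Algebra K (PathAlgebra K V) :=
  Algebra.ofModule
    (fun s f g => PathAlgebra.ext fun a c => by
      simp [mul_apply, smul_apply, Finset.smul_sum])
    (fun s f g => PathAlgebra.ext fun a c => by
      simp [mul_apply, smul_apply, Finset.smul_sum])

/-- A path as an element of the path algebra. -/
def ofPath {a b : V} (p : Quiver.Path a b) : PathAlgebra K V :=
  Pi.single a (Pi.single b (Finsupp.single p 1))

theorem ofPath_mul_ofPath {a b c : V} (p : Quiver.Path a b) (r : Quiver.Path b c) :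
    (ofPath p * ofPath r : PathAlgebra K V) = ofPath (p.comp r) := by
  refine PathAlgebra.ext fun u w => ?_
  rw [mul_apply, Finset.sum_eq_single b]
  · by_cases hu : u = a
    · subst hu
      by_cases hw : w = c
      · subst hw
        simp [ofPath, comp_single]
      · simp [ofPath, Pi.single_eq_of_ne hw]
    · simp [ofPath, Pi.single_eq_of_ne hu]
  · intro v _ hv
    simp [ofPath, Pi.single_eq_of_ne hv]
  · simp

theorem ofPath_mul_ofPath_of_ne {a b c d : V} (p : Quiver.Path a b) (r : Quiver.Path c d)
    (h : b ≠ c) : (ofPath p * ofPath r : PathAlgebra K V) = 0 := by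
  refine PathAlgebra.ext fun u w => ?_
  rw [mul_apply, zero_apply]
  refine Finset.sum_eq_zero fun v _ => ?_
  by_cases hv : v = c
  · subst hv
    by_cases hu : u = a
    · subst hu
      simp [ofPath, Pi.single_eq_of_ne h.symm]
    · simp [ofPath, Pi.single_eq_of_ne hu]
  · simp [ofPath, Pi.single_eq_of_ne hv]

end PathAlgebra

/-! ### The quiver and the algebra -/

namespace CyclicAlg

/-- The arrows of the quiver with vertices `e₀, …, e₃` (indexed modulo `4`): the arrow `a l m`,
with `l` modulo `2` and `m` modulo `4`, starts at `e_m` and ends at `e_{m+1}`. -/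
inductive Arrow : ZMod 4 → ZMod 4 → Type
  | a (l : ZMod 2) (m : ZMod 4) : Arrow m (m + 1)

instance : Quiver (ZMod 4) := ⟨Arrow⟩

variable (K : Type u) [Field K]

/-- The path algebra `KΓ`. -/
abbrev KΓ : Type u := PathAlgebra K (ZMod 4)

/-- The vertex `e_i` of `KΓ`. -/
def vertex (i : ZMod 4) : KΓ K := PathAlgebra.ofPath (Quiver.Path.nil : Quiver.Path i i)

/-- The arrow `a_{l,m}` of `KΓ`. -/
def arrow (l : ZMod 2) (m : ZMod 4) : KΓ K :=
  PathAlgebra.ofPath (Quiver.Hom.toPath (Arrow.a l m : m ⟶ m + 1))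

/-- `x_l = ∑_m a_{l,m}`. -/
def xPath (l : ZMod 2) : KΓ K := ∑ m, arrow K l m

/-- Reduction modulo `2` of an index modulo `4`, as in `x_i` for a vertex index `i`. -/
def par (i : ZMod 4) : ZMod 2 := ZMod.castHom (by decide : 2 ∣ 4) (ZMod 2) i

variable {K}

/-- The relations `x_l x_{l+1}` and `e_i (q_i x_i^{4T+2} + x_{i+1}^{4T+2})`. -/
def relations (T : ℕ) (q : ZMod 4 → K) : Set (KΓ K) :=
  (Set.range fun l : ZMod 2 => xPath K l * xPath K (l + 1)) ∪
    Set.range fun i : ZMod 4 =>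
      vertex K i * (q i • xPath K (par i) ^ (4 * T + 2) + xPath K (par (i + 1)) ^ (4 * T + 2))

/-- The two-sided ideal `I_T(q₀,q₁,q₂,q₃)` of `KΓ`. -/
def relIdeal (T : ℕ) (q : ZMod 4 → K) : TwoSidedIdeal (KΓ K) :=
  TwoSidedIdeal.span (relations T q)

/-- The algebra `A = A_T(q₀,q₁,q₂,q₃) = KΓ / I_T(q₀,q₁,q₂,q₃)`. -/
def Alg (T : ℕ) (q : ZMod 4 → K) : Type u := KΓ K ⧸ (relIdeal T q).asIdeal

variable (T : ℕ) (q : ZMod 4 → K)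

instance : Ring (Alg T q) := inferInstanceAs (Ring (KΓ K ⧸ (relIdeal T q).asIdeal))

instance : Algebra K (Alg T q) := inferInstanceAs (Algebra K (KΓ K ⧸ (relIdeal T q).asIdeal))

/-- The quotient map `KΓ → A`. -/
def proj : KΓ K →ₐ[K] Alg T q := Ideal.Quotient.mkₐ K (relIdeal T q).asIdeal

/-- The image of `e_i` in `A`. -/
def e (i : ZMod 4) : Alg T q := proj T q (vertex K i)

/-- The image of `x_l` in `A`. -/
def x (l : ZMod 2) : Alg T q := proj T q (xPath K l)

/-! ### The elements `g^n_{i,j}` -/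

/-- `S_{u,v} = ∏_{t=0}^{u-1} q_{t+v}`. -/
def S (u : ℕ) (v : ZMod 4) : K := ∏ t ∈ Finset.range u, q (t + v)

/-- The elements `g^n_{i,j}` of `KΓ`, for `0 ≤ j ≤ n`. -/
def g : ℕ → ZMod 4 → ℕ → KΓ K
  | 0, i, _ => vertex K i
  | n + 1, i, j =>
    if n % 2 = 0 then
      -- degree `n + 1 = 2m + 1`
      let m := n / 2
      if j = 0 then g n i 0 * xPath K (par i)
      else if j ≤ m then
        S q (2 * m + 1 - j) (i + j - 1) • (g n i (j - 1) * xPath K (par (i + 1)) ^ (4 * T + 1))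
          + g n i j * xPath K (par i)
      else if j ≤ 2 * m then
        S q (2 * m + 1 - j) (i + j - 1) • (g n i (j - 1) * xPath K (par (i + 1)))
          + g n i j * xPath K (par i) ^ (4 * T + 1)
      else g n i (2 * m) * xPath K (par (i + 1))
    else
      -- degree `n + 1 = 2m` with `m ≥ 1`
      let m := (n + 1) / 2
      if j = 0 then g n i 0 * xPath K (par (i + 1))
      else if j ≤ m - 1 then
        S q (2 * m - j) (i + j - 1) • (g n i (j - 1) * xPath K (par i) ^ (4 * T + 1))
          + g n i j * xPath K (par (i + 1))
      else if j = m then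
        S q m (i + m - 1) • (g n i (m - 1) * xPath K (par i) ^ (4 * T + 1))
          + g n i m * xPath K (par (i + 1)) ^ (4 * T + 1)
      else if j ≤ 2 * m - 1 then
        S q (2 * m - j) (i + j - 1) • (g n i (j - 1) * xPath K (par i))
          + g n i j * xPath K (par (i + 1)) ^ (4 * T + 1)
      else g n i (2 * m - 1) * xPath K (par i)

/-! ### Bimodules -/

/-- The enveloping algebra; its left modules are the `A`-`A`-bimodules with central action of `K`,
`(a ⊗ op b) • m = a m b`. -/
abbrev Env : Type u := Alg T q ⊗[K] (Alg T q)ᵐᵒᵖ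

/-- `A` as a bimodule over itself. -/
instance : Module (Env T q) (Alg T q) := TensorProduct.Algebra.module

theorem env_smul_def (a b c : Alg T q) :
    ((a ⊗ₜ[K] op b : Env T q) • c : Alg T q) = a * (c * b) := rfl

/-- The left ideal `A e_i`. -/
abbrev Ae (i : ZMod 4) : Submodule (Alg T q) (Alg T q) := Submodule.span (Alg T q) {e T q i}

/-- The right ideal `e_k A`. -/
abbrev eA (k : ZMod 4) : Submodule (Alg T q)ᵐᵒᵖ (Alg T q) :=
  Submodule.span (Alg T q)ᵐᵒᵖ {e T q k}

/-- The bimodule `A e_i ⊗_K e_k A`. -/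
def Bim (i k : ZMod 4) : Type u := Ae T q i ⊗[K] eA T q k

instance (i k : ZMod 4) : AddCommGroup (Bim T q i k) :=
  inferInstanceAs (AddCommGroup (Ae T q i ⊗[K] eA T q k))

/-- The action of `A ⊗ Aᵒᵖ` on `A e_i ⊗ e_k A`: `(a ⊗ op b) • (u ⊗ v) = a u ⊗ v b`. -/
def bimAction (i k : ZMod 4) : Env T q →ₐ[K] Module.End K (Ae T q i ⊗[K] eA T q k) :=
  Module.endTensorEndAlgHom.comp
    (Algebra.TensorProduct.map (Algebra.lsmul K K (Ae T q i)) (Algebra.lsmul K K (eA T q k)))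

instance (i k : ZMod 4) : Module (Env T q) (Bim T q i k) :=
  Module.compHom (Ae T q i ⊗[K] eA T q k) (bimAction T q i k).toRingHom

/-- The pure tensor `u ⊗ v` in `A e_i ⊗ e_k A`. -/
def Bim.tmul {i k : ZMod 4} (u : Ae T q i) (v : eA T q k) : Bim T q i k := u ⊗ₜ[K] v

theorem Bim.smul_tmul {i k : ZMod 4} (a b : Alg T q) (u : Ae T q i) (v : eA T q k) :
    (a ⊗ₜ[K] op b : Env T q) • Bim.tmul T q u v = Bim.tmul T q (a • u) (op b • v) := rfl

/-- The `K`-linear map `A e_i ⊗ e_k A → A ⊗ Aᵒᵖ` given by the inclusions, `u ⊗ v ↦ u ⊗ op v`. -/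
def inclLinear (i k : ZMod 4) : Ae T q i ⊗[K] eA T q k →ₗ[K] Env T q :=
  TensorProduct.map ((Ae T q i).subtype.restrictScalars K)
    ((opLinearEquiv K).toLinearMap ∘ₗ (eA T q k).subtype.restrictScalars K)

theorem inclLinear_action (i k : ZMod 4) (r : Env T q) (z : Ae T q i ⊗[K] eA T q k) :
    inclLinear T q i k (bimAction T q i k r z) = r * inclLinear T q i k z := by
  induction r using TensorProduct.induction_on with
  | zero => simp
  | add r s hr hs => rw [map_add, LinearMap.add_apply, map_add, hr, hs, add_mul]
  | tmul a b =>
    induction z using TensorProduct.induction_on with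
    | zero => simp
    | add z w hz hw => rw [map_add, map_add, map_add, hz, hw, mul_add]
    | tmul u v =>
      have h : bimAction T q i k (a ⊗ₜ[K] b) (u ⊗ₜ[K] v) = (a • u) ⊗ₜ[K] (b • v) := rfl
      rw [h, inclLinear, TensorProduct.map_tmul, TensorProduct.map_tmul,
        Algebra.TensorProduct.tmul_mul_tmul]
      rfl

/-- The inclusion `A e_i ⊗ e_k A → A ⊗ Aᵒᵖ` as a map of bimodules. -/
def Bim.incl (i k : ZMod 4) : Bim T q i k →ₗ[Env T q] Env T q where
  toFun := inclLinear T q i k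
  map_add' := map_add (inclLinear T q i k)
  map_smul' := inclLinear_action T q i k

/-- The bimodule map `A e_i ⊗ e_k A → M`, `u ⊗ v ↦ u m v`, for an element `m` of a bimodule `M`. -/
def Bim.lift {M : Type u} [AddCommGroup M] [Module (Env T q) M] (i k : ZMod 4) (m : M) :
    Bim T q i k →ₗ[Env T q] M :=
  (LinearMap.toSpanSingleton (Env T q) M m).comp (Bim.incl T q i k)

/-- The element `e_i ⊗ e_k` of `A e_i ⊗ e_k A`. -/
def Bim.gen (i k : ZMod 4) : Bim T q i k :=
  Bim.tmul T q ⟨e T q i, Submodule.mem_span_singleton_self _⟩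
    ⟨e T q k, Submodule.mem_span_singleton_self _⟩

/-- `R^n = ⨁_{i,j} A 𝔬(g^n_{i,j}) ⊗ 𝔱(g^n_{i,j}) A`, where `g^n_{i,j}` has origin `e_i` and
terminus `e_{i+n}`. -/
abbrev R (n : ℕ) : Type u :=
  DirectSum (ZMod 4 × Fin (n + 1)) fun ij => Bim T q ij.1 (ij.1 + n)

/-- The generator `𝔭^n_{i,j} = 𝔬(g^n_{i,j}) ⊗ 𝔱(g^n_{i,j})` of `R^n`, for `0 ≤ j ≤ n`. -/
def p (n : ℕ) (i : ZMod 4) (j : ℕ) : R T q n :=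
  if h : j < n + 1 then
    DirectSum.lof (Env T q) (ZMod 4 × Fin (n + 1)) (fun ij => Bim T q ij.1 (ij.1 + n)) (i, ⟨j, h⟩)
      (Bim.gen T q i (i + n))
  else 0

/-- The element `c a z b` of a bimodule, for `c ∈ K` and `a, b ∈ A`. -/
def act {M : Type u} [AddCommGroup M] [Module (Env T q) M] (c : K) (a : Alg T q) (z : M)
    (b : Alg T q) : M :=
  (c • (a ⊗ₜ[K] op b) : Env T q) • z

/-- The image of the generator `𝔭^{n+1}_{i,j}` under `∂^{n+1}`, for `0 ≤ j ≤ n + 1`. -/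
def dGen (n : ℕ) (i : ZMod 4) (j : ℕ) : R T q n :=
  -- `y` is `x_i` and `z` is `x_{i+1}`
  let y := x T q (par i)
  let z := x T q (par (i + 1))
  if n % 2 = 0 then
    -- degree `n + 1 = 2m + 1`
    let m := n / 2
    if j = 0 then
      act T q 1 1 (p T q n i 0) y - act T q 1 y (p T q n (i + 1) 0) 1
    else if j < m + 1 then
      act T q (S q (2 * m + 1 - j) (i + j - 1)) 1 (p T q n i (j - 1)) (z ^ (4 * T + 1))
        + act T q 1 1 (p T q n i j) y
        - act T q (S q j i) y (p T q n (i + 1) j) 1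
        - act T q 1 (z ^ (4 * T + 1)) (p T q n (i + 1) (j - 1)) 1
    else if j < 2 * m + 1 then
      act T q (S q (2 * m + 1 - j) (i + j - 1)) 1 (p T q n i (j - 1)) z
        + act T q 1 1 (p T q n i j) (y ^ (4 * T + 1))
        - act T q (S q j i) (y ^ (4 * T + 1)) (p T q n (i + 1) j) 1
        - act T q 1 z (p T q n (i + 1) (j - 1)) 1
    else
      act T q 1 1 (p T q n i (2 * m)) z - act T q 1 z (p T q n (i + 1) (2 * m)) 1
  else
    -- degree `n + 1 = 2m` with `m ≥ 1`
    let m := (n + 1) / 2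
    if j = 0 then
      act T q 1 1 (p T q n i 0) z + act T q 1 y (p T q n (i + 1) 0) 1
    else if j < m then
      act T q (S q (2 * m - j) (i + j - 1)) 1 (p T q n i (j - 1)) (y ^ (4 * T + 1))
        + act T q 1 1 (p T q n i j) z
        + act T q (S q j i) y (p T q n (i + 1) j) 1
        + act T q 1 (z ^ (4 * T + 1)) (p T q n (i + 1) (j - 1)) 1
    else if j = m then
      (∑ k ∈ Finset.range (T + 1),
        (act T q 1 (y ^ (4 * k))
            (act T q (S q m (i + m - 1)) 1 (p T q n i (m - 1)) y
              + act T q (S q m i) y (p T q n (i + 1) m) 1)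
            (y ^ (4 * T - 4 * k))
          + act T q 1 (z ^ (4 * k))
            (act T q 1 1 (p T q n i m) z + act T q 1 z (p T q n (i + 1) (m - 1)) 1)
            (z ^ (4 * T - 4 * k))))
      + (∑ k ∈ Finset.range T,
        (act T q 1 (y ^ (4 * k + 2))
            (act T q (S q m i) 1 (p T q n (i + 2) (m - 1)) y
              + act T q (S q m (i + m - 1)) y (p T q n (i + 3) m) 1)
            (y ^ (4 * T - 4 * k - 2))
          + act T q ((S q m (i + 3))⁻¹ * S q m (i + m + 2)) (z ^ (4 * k + 2))
            (act T q 1 1 (p T q n (i + 2) m) z + act T q 1 z (p T q n (i + 3) (m - 1)) 1)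
            (z ^ (4 * T - 4 * k - 2))))
    else if j < 2 * m then
      act T q (S q (2 * m - j) (i + j - 1)) 1 (p T q n i (j - 1)) y
        + act T q 1 1 (p T q n i j) (z ^ (4 * T + 1))
        + act T q (S q j i) (y ^ (4 * T + 1)) (p T q n (i + 1) j) 1
        + act T q 1 z (p T q n (i + 1) (j - 1)) 1
    else
      act T q 1 1 (p T q n i (2 * m - 1)) y + act T q 1 z (p T q n (i + 1) (2 * m - 1)) 1

/-- The differential `∂^{n+1} : R^{n+1} → R^n`, the bimodule homomorphism with
`𝔭^{n+1}_{i,j} ↦ dGen n i j` (see `d_p`). -/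
def d (n : ℕ) : R T q (n + 1) →ₗ[Env T q] R T q n :=
  DirectSum.toModule (Env T q) _ _ fun ij => Bim.lift T q _ _ (dGen T q n ij.1 ij.2)

/-- The multiplication map `∂^0 : R^0 → A`, `u ⊗ v ↦ u v`. -/
def aug : R T q 0 →ₗ[Env T q] Alg T q :=
  DirectSum.toModule (Env T q) _ _ fun _ => Bim.lift T q _ _ 1

theorem aug_tmul (ij : ZMod 4 × Fin 1) (u : Ae T q ij.1) (v : eA T q (ij.1 + (0 : ℕ))) :
    aug T q (DirectSum.lof (Env T q) _ (fun ij => Bim T q ij.1 (ij.1 + (0 : ℕ))) ij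
      (Bim.tmul T q u v)) = (u * v : Alg T q) := by
  rw [aug, DirectSum.toModule_lof]
  change (u : Alg T q) * (1 * (v : Alg T q)) = _
  rw [one_mul]

/-! ### The differential takes the prescribed values on the generators -/

theorem vertex_mul_xPath (i : ZMod 4) (l : ZMod 2) : vertex K i * xPath K l = arrow K l i := by
  rw [xPath, Finset.mul_sum, Finset.sum_eq_single i]
  · exact (PathAlgebra.ofPath_mul_ofPath _ _).trans (by rw [Quiver.Path.nil_comp]; rfl)
  · intro m _ hm
    exact PathAlgebra.ofPath_mul_ofPath_of_ne _ _ hm.symm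
  · simp

theorem xPath_mul_vertex (i : ZMod 4) (l : ZMod 2) :
    xPath K l * vertex K (i + 1) = arrow K l i := by
  rw [xPath, Finset.sum_mul, Finset.sum_eq_single i]
  · simp [vertex, arrow, PathAlgebra.ofPath_mul_ofPath]
  · intro m _ hm
    exact PathAlgebra.ofPath_mul_ofPath_of_ne _ _ fun h => hm (add_right_cancel h)
  · simp

theorem e_mul_x_pow (i : ZMod 4) (l : ZMod 2) (k : ℕ) :
    e T q i * x T q l ^ k = x T q l ^ k * e T q (i + k) := by
  induction k generalizing i with
  | zero => simp
  | succ k ih =>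
    have h : ∀ i, e T q i * x T q l = x T q l * e T q (i + 1) := fun i => by
      simp only [e, x, ← map_mul, vertex_mul_xPath, xPath_mul_vertex]
    rw [pow_succ, ← mul_assoc, ih, mul_assoc, h, ← mul_assoc]
    push_cast
    rw [add_assoc]

theorem e_mul_self (i : ZMod 4) : e T q i * e T q i = e T q i := by
  simp only [e, vertex, ← map_mul, PathAlgebra.ofPath_mul_ofPath, Quiver.Path.nil_comp]

/-- `e_i z e_k = z`. -/
def Fix {M : Type u} [AddCommGroup M] [Module (Env T q) M] (i k : ZMod 4) (z : M) : Prop :=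
  (e T q i ⊗ₜ[K] op (e T q k) : Env T q) • z = z

section
variable {T q} {M : Type u} [AddCommGroup M] [Module (Env T q) M] {i k : ZMod 4} {z w : M}

theorem Fix.add (hz : Fix T q i k z) (hw : Fix T q i k w) : Fix T q i k (z + w) := by
  rw [Fix, smul_add, hz, hw]

theorem Fix.sub (hz : Fix T q i k z) (hw : Fix T q i k w) : Fix T q i k (z - w) := by
  rw [Fix, smul_sub, hz, hw]

theorem Fix.sum {ι : Type} {s : Finset ι} {f : ι → M} (h : ∀ t ∈ s, Fix T q i k (f t)) :
    Fix T q i k (∑ t ∈ s, f t) := by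
  rw [Fix, Finset.smul_sum]
  exact Finset.sum_congr rfl h

theorem Fix.act {i' k' : ZMod 4} (c : K) (l l' : ZMod 2) (s t : ℕ) (hz : Fix T q i' k' z)
    (hi : i + s = i') (hk : k' + t = k) :
    Fix T q i k (act T q c (x T q l ^ s) z (x T q l' ^ t)) := by
  subst hi hk
  unfold Fix CyclicAlg.act at *
  conv_rhs => rw [← hz]
  simp only [smul_smul, mul_smul_comm, smul_mul_assoc, Algebra.TensorProduct.tmul_mul_tmul,
    ← op_mul, e_mul_x_pow]

theorem Fix.act_left {i' : ZMod 4} (c : K) (l : ZMod 2) (s : ℕ) (hz : Fix T q i' k z)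
    (hi : i + s = i') : Fix T q i k (CyclicAlg.act T q c (x T q l ^ s) z 1) := by
  simpa using Fix.act c l 0 s 0 hz hi (by simp)

theorem Fix.act_right {k' : ZMod 4} (c : K) (l : ZMod 2) (t : ℕ) (hz : Fix T q i k' z)
    (hk : k' + t = k) : Fix T q i k (CyclicAlg.act T q c 1 z (x T q l ^ t)) := by
  simpa using Fix.act c 0 l 0 t hz (by simp) hk

theorem Fix.act_left' {i' : ZMod 4} (c : K) (l : ZMod 2) (hz : Fix T q i' k z)
    (hi : i + 1 = i') : Fix T q i k (CyclicAlg.act T q c (x T q l) z 1) := by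
  simpa using Fix.act_left c l 1 hz (by simpa using hi)

theorem Fix.act_right' {k' : ZMod 4} (c : K) (l : ZMod 2) (hz : Fix T q i k' z)
    (hk : k' + 1 = k) : Fix T q i k (CyclicAlg.act T q c 1 z (x T q l)) := by
  simpa using Fix.act_right c l 1 hz (by simpa using hk)

end

theorem fix_p (n : ℕ) (i : ZMod 4) (j : ℕ) : Fix T q i (i + n) (p T q n i j) := by
  unfold Fix p
  split_ifs with h
  · rw [← map_smul, Bim.gen, Bim.smul_tmul]
    congr 2
    · exact Subtype.ext (e_mul_self T q i)
    · exact Subtype.ext (e_mul_self T q (i + n))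
  · exact smul_zero _

theorem fix_dGen (n : ℕ) (i : ZMod 4) (j : ℕ) :
    Fix T q i (i + (n + 1 : ℕ)) (dGen T q n i j) := by
  have h4 : (4 : ZMod 4) = 0 := by decide
  have hp : ∀ i' : ZMod 4, ∀ j' k', i' + n = k' → Fix T q i' k' (p T q n i' j') := by
    rintro i' j' k' rfl
    exact fix_p T q n i' j'
  have h0 : ∀ t : ℕ, ((4 * t : ℕ) : ZMod 4) = 0 := fun t => by
    push_cast
    rw [h4, zero_mul]
  have h1 : ((4 * T + 1 : ℕ) : ZMod 4) = 1 := by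
    rw [Nat.cast_add, h0, zero_add, Nat.cast_one]
  have hl : ∀ (i i' k : ZMod 4) (c : K) (l : ZMod 2) (j' : ℕ), i + 1 = i' → i' + n = k →
      Fix T q i k (act T q c (x T q l) (p T q n i' j') 1) := fun i i' k c l j' h h' =>
    Fix.act_left' c l (hp i' j' k h') h
  have hr : ∀ (i k : ZMod 4) (c : K) (l : ZMod 2) (j' : ℕ), i + n + 1 = k →
      Fix T q i k (act T q c 1 (p T q n i j') (x T q l)) := fun i k c l j' h =>
    Fix.act_right' c l (hp i j' _ rfl) h
  have hl' : ∀ (i i' k : ZMod 4) (c : K) (l : ZMod 2) (j' : ℕ), i + 1 = i' → i' + n = k →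
      Fix T q i k (act T q c (x T q l ^ (4 * T + 1)) (p T q n i' j') 1) :=
    fun i i' k c l j' h h' => Fix.act_left c l _ (hp i' j' k h') (by rw [h1, h])
  have hr' : ∀ (i k : ZMod 4) (c : K) (l : ZMod 2) (j' : ℕ), i + n + 1 = k →
      Fix T q i k (act T q c 1 (p T q n i j') (x T q l ^ (4 * T + 1))) := fun i k c l j' h =>
    Fix.act_right c l _ (hp i j' _ rfl) (by rw [h1, h])
  have hA : ∀ (c : K) (l : ZMod 2) (k : ℕ) (z : R T q n), k ∈ Finset.range (T + 1) →
      Fix T q i (i + (n + 1 : ℕ)) z →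
      Fix T q i (i + (n + 1 : ℕ))
        (act T q c (x T q l ^ (4 * k)) z (x T q l ^ (4 * T - 4 * k))) :=
    fun c l k z _ hz => Fix.act c l l _ _ hz (by rw [h0, add_zero])
      (by rw [← Nat.mul_sub, h0, add_zero])
  have hB : ∀ (c : K) (l : ZMod 2) (k : ℕ) (z : R T q n), k ∈ Finset.range T →
      Fix T q (i + 2) (i + 2 + (n + 1 : ℕ)) z →
      Fix T q i (i + (n + 1 : ℕ))
        (act T q c (x T q l ^ (4 * k + 2)) z (x T q l ^ (4 * T - 4 * k - 2))) :=
    fun c l k z hk hz => Fix.act c l l _ _ hz (by rw [Nat.cast_add, h0]; push_cast; ring) (by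
      have hk' := Finset.mem_range.mp hk
      have : 4 * T - 4 * k - 2 = 4 * (T - k - 1) + 2 := by omega
      rw [this, Nat.cast_add (4 * (T - k - 1)) 2, h0]
      push_cast
      linear_combination h4)
  unfold dGen
  dsimp only
  split_ifs
  all_goals
    repeat' first
      | (with_reducible refine hl _ _ _ _ _ _ ?_ ?_)
      | (with_reducible refine hr _ _ _ _ _ ?_)
      | (with_reducible refine hl' _ _ _ _ _ _ ?_ ?_)
      | (with_reducible refine hr' _ _ _ _ _ ?_)
      | (with_reducible refine Fix.add ?_ ?_)
      | (with_reducible refine Fix.sub ?_ ?_)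
      | (with_reducible refine Fix.sum fun k hk => ?_)
      | (with_reducible refine hA _ _ _ _ (by assumption) ?_)
      | (with_reducible refine hB _ _ _ _ (by assumption) ?_)
  all_goals
    push_cast
    ring

/-- The value of `∂^{n+1}` on the generator `𝔭^{n+1}_{i,j}`. -/
theorem d_p (n : ℕ) (i : ZMod 4) (j : ℕ) (hj : j ≤ n + 1) :
    d T q n (p T q (n + 1) i j) = dGen T q n i j := by
  rw [p, dif_pos (Nat.lt_succ_of_le hj), d, DirectSum.toModule_lof]
  exact fix_dGen T q n i j

end CyclicAlg

/-! ### Minimal projective resolutions -/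

/-- A submodule `N` of `M` is superfluous (small) if `L + N = M` implies `L = M`. -/
def Submodule.IsSuperfluous {S M : Type*} [Ring S] [AddCommGroup M] [Module S M]
    (N : Submodule S M) : Prop :=
  ∀ L : Submodule S M, L ⊔ N = ⊤ → L = ⊤

/-- The sequence `⋯ → P 2 → P 1 → P 0 → M → 0`, with maps `d n : P (n + 1) → P n` and
`ε : P 0 → M`, is a minimal projective resolution of `M`: it is exact, every `P n` is projective,
and every `P n` is a projective cover of its image, that is, the kernels of `ε` and of all `d n`
are superfluous. -/
structure IsMinimalProjectiveResolution {S M : Type*} [Ring S] [AddCommGroup M] [Module S M]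
    (P : ℕ → Type*) [∀ n, AddCommGroup (P n)] [∀ n, Module S (P n)]
    (ε : P 0 →ₗ[S] M) (d : ∀ n, P (n + 1) →ₗ[S] P n) : Prop where
  projective : ∀ n, Module.Projective S (P n)
  surjective : Function.Surjective ε
  exact_zero : Function.Exact (d 0) ε
  exact_succ : ∀ n, Function.Exact (d (n + 1)) (d n)
  minimal_zero : (LinearMap.ker ε).IsSuperfluous
  minimal_succ : ∀ n, (LinearMap.ker (d n)).IsSuperfluous

end

/-!
Modulo the terms in which a positive power of `x_l` stands to the left of a generator, `∂^{n+1}`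
multiplies the generators of `R^n` on the right by powers of `x`. Since `A` has a basis of
monomials `e_k x_l^t`, the map that strips these powers again contracts the complex modulo this
left filtration. The filtration is finite because the `x_l` are nilpotent, so a contraction up to
it already forces exactness. Minimality is Nakayama's lemma: `∂^n` takes its values in the
sub-bimodule of elements of positive degree, and this filtration by degree is finite as well.
The `g^n_{i,j}` are told apart by the arrows in which their paths end.
-/

noncomputable section

universe u v w

theorem exact_of_filtered_homotopy {X Y Z : Type*} [AddCommGroup X] [AddCommGroup Y]
    [AddCommGroup Z] (f : X →+ Y) (g : Y →+ Z) (s : Y →+ X) (t : Z →+ Y) (hgf : ∀ x, g (f x) = 0)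
    (F : ℕ → AddSubgroup Y) (h0 : F 0 = ⊤) (N : ℕ) (hN : F N = ⊥)
    (hF : ∀ k, ∀ y ∈ F k, y - f (s y) - t (g y) ∈ F (k + 1)) : Function.Exact f g := by
  intro y
  refine ⟨fun hy => ?_, ?_⟩
  · have approx : ∀ k, ∃ x, y - f x ∈ F k := by
      intro k
      induction k with
      | zero => exact ⟨0, by rw [h0]; trivial⟩
      | succ k ih =>
        obtain ⟨x, hx⟩ := ih
        refine ⟨x + s (y - f x), ?_⟩
        have h := hF k _ hx
        rw [map_sub g, hy, hgf, sub_zero, map_zero, sub_zero] at h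
        rwa [map_add, ← sub_sub]
    obtain ⟨x, hx⟩ := approx N
    rw [hN, AddSubgroup.mem_bot, sub_eq_zero] at hx
    exact ⟨x, hx.symm⟩
  · rintro ⟨x, rfl⟩
    exact hgf x

namespace PathAlgebra

/-! ### Linear maps and representations of path algebras -/

section Components

variable {K : Type u} {V : Type v} [Field K] [Quiver.{w} V] [DecidableEq V]

/-- The inclusion of the span of the paths from `a` to `b` into the path algebra. -/
def component (a b : V) : (Quiver.Path a b →₀ K) →ₗ[K] PathAlgebra K V :=
  LinearMap.single K (fun a => (b : V) → Quiver.Path a b →₀ K) a ∘ₗ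
    LinearMap.single K (fun b => Quiver.Path a b →₀ K) b

variable [Fintype V]

theorem component_single {a b : V} (r : Quiver.Path a b) (c : K) :
    component a b (Finsupp.single r c) = c • ofPath r := by
  rw [← mul_one c, ← smul_eq_mul, ← Finsupp.smul_single, map_smul, smul_eq_mul, mul_one]
  rfl

theorem sum_component (f : PathAlgebra K V) : ∑ a, ∑ b, component a b (f a b) = f := by
  refine (Finset.sum_congr rfl fun a _ => ?_).trans (Finset.univ_sum_single f)
  exact (map_sum (LinearMap.single K (fun a => (b : V) → Quiver.Path a b →₀ K) a) _ _).symm.trans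
    (congrArg (Pi.single a) (Finset.univ_sum_single (f a)))

theorem sum_ofPath_nil : ∑ a : V, ofPath (K := K) (Quiver.Path.nil : Quiver.Path a a) = 1 :=
  Finset.univ_sum_single (1 : PathAlgebra K V)

theorem induction_ofPath {motive : PathAlgebra K V → Prop} (f : PathAlgebra K V)
    (zero : motive 0) (add : ∀ f g, motive f → motive g → motive (f + g))
    (path : ∀ (c : K) (a b : V) (r : Quiver.Path a b), motive (c • ofPath r)) : motive f := by
  rw [← sum_component f]
  refine Finset.sum_induction _ motive add zero fun a _ =>
    Finset.sum_induction _ motive add zero fun b _ => ?_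
  induction f a b using Finsupp.induction_linear with
  | zero => rwa [map_zero]
  | add h₁ h₂ ih₁ ih₂ => rw [map_add]; exact add _ _ ih₁ ih₂
  | single r c => rw [component_single]; exact path c a b r

end Components

section Representation

variable {K : Type u} {V : Type v} [Field K] [Quiver.{w} V] {B : Type*} [CommRing B] [Algebra K B]

/-- The linear map underlying `toMatrix`. -/
def toMatrixLinear (ω : ∀ {a b : V}, (a ⟶ b) → B) : PathAlgebra K V →ₗ[K] Matrix V V B where
  toFun f := Matrix.of fun a b => Finsupp.linearCombination K (Quiver.Path.weight ω) (f a b)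
  map_add' f g := Matrix.ext fun a b =>
    (Finsupp.linearCombination K (Quiver.Path.weight ω)).map_add (f a b) (g a b)
  map_smul' c f := Matrix.ext fun a b =>
    (Finsupp.linearCombination K (Quiver.Path.weight ω)).map_smul c (f a b)

variable [DecidableEq V]

theorem toMatrixLinear_ofPath (ω : ∀ {a b : V}, (a ⟶ b) → B) {a b : V} (r : Quiver.Path a b) :
    toMatrixLinear (K := K) ω (ofPath r) = Matrix.single a b (r.weight ω) := by
  ext u w
  change Finsupp.linearCombination K (Quiver.Path.weight ω) ((ofPath r : PathAlgebra K V) u w) = _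
  by_cases hu : a = u
  · subst hu
    by_cases hw : b = w
    · subst hw
      simp [ofPath]
    · simp [ofPath, Pi.single_eq_of_ne (Ne.symm hw), Matrix.single_apply_of_col_ne _ _ hw]
  · simp [ofPath, Pi.single_eq_of_ne (Ne.symm hu), Matrix.single_apply_of_row_ne hu]

variable [Fintype V]

omit [DecidableEq V] in
theorem toMatrixLinear_mul (ω : ∀ {a b : V}, (a ⟶ b) → B) (f g : PathAlgebra K V) :
    toMatrixLinear ω (f * g) = toMatrixLinear ω f * toMatrixLinear ω g := by
  classical
  induction f using induction_ofPath with
  | zero => simp only [zero_mul, map_zero]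
  | add f₁ f₂ h₁ h₂ => simp only [add_mul, map_add, h₁, h₂]
  | path c a b r =>
    induction g using induction_ofPath with
    | zero => simp only [mul_zero, map_zero]
    | add g₁ g₂ h₁ h₂ => simp only [mul_add, map_add, h₁, h₂]
    | path c' a' b' r' =>
      simp only [smul_mul_assoc, mul_smul_comm, map_smul, toMatrixLinear_ofPath]
      by_cases h : b = a'
      · subst h
        rw [ofPath_mul_ofPath, toMatrixLinear_ofPath, Quiver.Path.weight_comp,
          Matrix.single_mul_single_same]
      · rw [ofPath_mul_ofPath_of_ne _ _ h, map_zero, Matrix.single_mul_single_of_ne _ _ _ _ h]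

/-- The representation of the path algebra that assigns the free module of rank one to every vertex
and multiplication by `ω α` to every arrow `α`, written as block matrices. -/
def toMatrix (ω : ∀ {a b : V}, (a ⟶ b) → B) : PathAlgebra K V →ₐ[K] Matrix V V B :=
  AlgHom.ofLinearMap (toMatrixLinear ω)
    (by
      rw [← sum_ofPath_nil, map_sum, ← Matrix.sum_single_one]
      exact Finset.sum_congr rfl fun a _ =>
        (toMatrixLinear_ofPath ω .nil).trans (by rw [Quiver.Path.weight_nil]))
    (toMatrixLinear_mul ω)

theorem toMatrix_ofPath (ω : ∀ {a b : V}, (a ⟶ b) → B) {a b : V} (r : Quiver.Path a b) :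
    toMatrix (K := K) ω (ofPath r) = Matrix.single a b (r.weight ω) :=
  toMatrixLinear_ofPath ω r

end Representation

end PathAlgebra

namespace CyclicAlg

/-! ### Monomials of the algebra -/

section Monomials

theorem par_add (i j : ZMod 4) : par (i + j) = par i + par j := map_add _ i j

theorem par_add_one (i : ZMod 4) : par (i + 1) = par i + 1 := by
  rw [par_add]; rfl

theorem par_add_two (i : ZMod 4) : par (i + 2) = par i := by
  revert i; decide

theorem add_one_add_one (l : ZMod 2) : l + 1 + 1 = l := by
  revert l; decide

theorem eq_or_eq_add_one (l l' : ZMod 2) : l' = l ∨ l' = l + 1 := by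
  revert l l'; decide

theorem eq_add_one_of_ne {l l' : ZMod 2} (h : l ≠ l') : l' = l + 1 := by
  revert l l'; decide

theorem add_one_ne (l : ZMod 2) : l + 1 ≠ l := by
  revert l; decide

theorem cast_four_mul (t : ℕ) : ((4 * t : ℕ) : ZMod 4) = 0 := by
  rw [Nat.cast_mul, show ((4 : ℕ) : ZMod 4) = 0 from rfl, zero_mul]

variable {K : Type u} [Field K]

theorem vertex_mul_vertex (i k : ZMod 4) :
    vertex K i * vertex K k = if i = k then vertex K i else 0 := by
  split_ifs with h
  · subst h
    exact PathAlgebra.ofPath_mul_ofPath _ _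
  · exact PathAlgebra.ofPath_mul_ofPath_of_ne _ _ h

theorem ofPath_mul_xPath {a b : ZMod 4} (r : Quiver.Path a b) (l : ZMod 2) :
    (PathAlgebra.ofPath r * xPath K l : KΓ K) = PathAlgebra.ofPath (r.cons (Arrow.a l b)) := by
  have hr : (PathAlgebra.ofPath r : KΓ K) = PathAlgebra.ofPath r * vertex K b :=
    (PathAlgebra.ofPath_mul_ofPath r Quiver.Path.nil).symm
  rw [hr, mul_assoc, vertex_mul_xPath, arrow, PathAlgebra.ofPath_mul_ofPath]
  rfl

variable (T : ℕ) (q : ZMod 4 → K)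

theorem e_mul_e (i k : ZMod 4) : e T q i * e T q k = if i = k then e T q i else 0 := by
  rw [e, e, ← map_mul, vertex_mul_vertex, apply_ite (proj T q), map_zero]

theorem sum_e : ∑ i, e T q i = 1 := by
  rw [← map_one (proj T q), ← PathAlgebra.sum_ofPath_nil, map_sum]
  rfl

theorem proj_eq_zero_of_mem {f : KΓ K} (h : f ∈ relations T q) : proj T q f = 0 :=
  Ideal.Quotient.eq_zero_iff_mem.mpr
    (TwoSidedIdeal.mem_asIdeal.mpr (TwoSidedIdeal.subset_span h))

theorem proj_surjective : Function.Surjective (proj T q) := Ideal.Quotient.mk_surjective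

theorem x_mul_x (l : ZMod 2) : x T q l * x T q (l + 1) = 0 := by
  rw [x, x, ← map_mul]
  exact proj_eq_zero_of_mem T q (Or.inl ⟨l, rfl⟩)

theorem x_pow_mul_x_pow {l l' : ZMod 2} (h : l ≠ l') {s t : ℕ} (hs : s ≠ 0) (ht : t ≠ 0) :
    x T q l ^ s * x T q l' ^ t = 0 := by
  obtain ⟨s, rfl⟩ := Nat.exists_eq_succ_of_ne_zero hs
  obtain ⟨t, rfl⟩ := Nat.exists_eq_succ_of_ne_zero ht
  rw [eq_add_one_of_ne h, pow_succ, pow_succ', mul_assoc, ← mul_assoc (x T q l), x_mul_x,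
    zero_mul, mul_zero]

theorem e_mul_socle_add_e_mul_socle (i : ZMod 4) :
    q i • (e T q i * x T q (par i) ^ (4 * T + 2)) +
      e T q i * x T q (par i + 1) ^ (4 * T + 2) = 0 := by
  have h := proj_eq_zero_of_mem T q (Or.inr ⟨i, rfl⟩)
  rwa [map_mul, map_add, map_smul, map_pow, map_pow, mul_add, mul_smul_comm, par_add_one] at h

theorem e_mul_socle (i : ZMod 4) :
    e T q i * x T q (par i + 1) ^ (4 * T + 2) =
      -(q i • (e T q i * x T q (par i) ^ (4 * T + 2))) :=
  eq_neg_of_add_eq_zero_right (e_mul_socle_add_e_mul_socle T q i)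

theorem e_mul_socle' (hq : ∀ i, q i ≠ 0) (i : ZMod 4) :
    e T q i * x T q (par i) ^ (4 * T + 2) =
      -((q i)⁻¹ • (e T q i * x T q (par i + 1) ^ (4 * T + 2))) := by
  rw [e_mul_socle, smul_neg, neg_neg, smul_smul, inv_mul_cancel₀ (hq i), one_smul]

theorem exists_e_mul_socle_eq_smul (hq : ∀ i, q i ≠ 0) (i : ZMod 4) (l : ZMod 2) :
    ∃ c : K, e T q i * x T q l ^ (4 * T + 2) = c • (e T q i * x T q (l + 1) ^ (4 * T + 2)) := by
  rcases eq_or_eq_add_one (par i) l with rfl | rfl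
  · exact ⟨-(q i)⁻¹, by rw [e_mul_socle' T q hq, neg_smul]⟩
  · exact ⟨-q i, by rw [e_mul_socle, add_one_add_one, neg_smul]⟩

theorem x_pow_eq_zero (hq : ∀ i, q i ≠ 0) (l : ZMod 2) {t : ℕ} (ht : 4 * T + 3 ≤ t) :
    x T q l ^ t = 0 := by
  refine pow_eq_zero_of_le ht ?_
  rw [← one_mul (x T q l ^ (4 * T + 3)), ← sum_e T q, Finset.sum_mul]
  refine Finset.sum_eq_zero fun i _ => ?_
  obtain ⟨c, hc⟩ := exists_e_mul_socle_eq_smul T q hq i l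
  rw [pow_succ, ← mul_assoc, hc, smul_mul_assoc, mul_assoc, ← pow_one (x T q l),
    x_pow_mul_x_pow T q (add_one_ne l) (by omega) one_ne_zero, mul_zero, smul_zero]

theorem exists_proj_ofPath {a b : ZMod 4} (r : Quiver.Path a b) :
    ∃ (c : K) (l : ZMod 2) (t : ℕ),
      proj T q (PathAlgebra.ofPath r) = c • (e T q a * x T q l ^ t) := by
  induction r with
  | nil => exact ⟨1, 0, 0, by rw [pow_zero, mul_one, one_smul]; rfl⟩
  | cons r f ih =>
    obtain ⟨c, l, t, h⟩ := ih
    obtain ⟨l', m⟩ := f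
    rw [← ofPath_mul_xPath, map_mul, h, ← x, smul_mul_assoc, mul_assoc]
    rcases eq_or_ne t 0 with rfl | ht
    · exact ⟨c, l', 1, by rw [pow_zero, one_mul, pow_one]⟩
    rcases eq_or_ne l l' with rfl | hl
    · exact ⟨c, l, t + 1, by rw [pow_succ]⟩
    · refine ⟨0, 0, 0, ?_⟩
      rw [← pow_one (x T q l'), x_pow_mul_x_pow T q hl ht one_ne_zero, mul_zero, smul_zero,
        zero_smul]

theorem Alg.induction {motive : Alg T q → Prop} (a : Alg T q) (zero : motive 0)
    (add : ∀ a b, motive a → motive b → motive (a + b))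
    (mono : ∀ (c : K) (k : ZMod 4) (l : ZMod 2) (t : ℕ), motive (c • (e T q k * x T q l ^ t))) :
    motive a := by
  obtain ⟨f, rfl⟩ := proj_surjective T q a
  induction f using PathAlgebra.induction_ofPath with
  | zero => simpa only [map_zero] using zero
  | add f g hf hg => rw [map_add]; exact add _ _ hf hg
  | path c a b r =>
    obtain ⟨c', l, t, h⟩ := exists_proj_ofPath T q r
    rw [map_smul, h, smul_smul]
    exact mono _ _ _ _

end Monomials

/-! ### Coordinates on the algebra -/

section Stripping

section Coordinates

open Polynomial

theorem map_eq_zero_of_mem_span {A M : Type*} [Ring A] [AddCommGroup M] (F : A →+ M) {s : Set A}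
    (h : ∀ r ∈ s, ∀ u v, F (u * r * v) = 0) {f : A} (hf : f ∈ TwoSidedIdeal.span s) : F f = 0 := by
  rw [TwoSidedIdeal.mem_span_iff_mem_addSubgroup_closure] at hf
  refine (AddSubgroup.closure_le F.ker).mpr ?_ hf
  rintro _ ⟨_, ⟨u, -, r, hr, rfl⟩, v, -, rfl⟩
  exact h r hr u v

variable (K : Type u) [Field K]

/-- The weight `X` for the arrows `a_{l,m}` with the given `l`, and `0` for the other arrows. -/
def letterWeight (l : ZMod 2) {a b : ZMod 4} : (a ⟶ b) → K[X]
  | .a l' _ => if l' = l then X else 0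

/-- The representation of `KΓ` over `K[X]` in which `x_l` acts as `X` and `x_{l+1}` as `0`: it reads
off the coefficients of the paths in the letter `l` alone. -/
def letterRep (l : ZMod 2) : KΓ K →ₐ[K] Matrix (ZMod 4) (ZMod 4) K[X] :=
  PathAlgebra.toMatrix (letterWeight K l)

theorem letterRep_arrow (l l' : ZMod 2) (m : ZMod 4) :
    letterRep K l (arrow K l' m) = Matrix.single m (m + 1) (if l' = l then X else 0) := by
  rw [arrow, letterRep, PathAlgebra.toMatrix_ofPath, Quiver.Hom.toPath, Quiver.Path.weight_cons,
    Quiver.Path.weight_nil, one_mul]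
  rfl

theorem letterRep_xPath_of_ne {l l' : ZMod 2} (h : l' ≠ l) : letterRep K l (xPath K l') = 0 := by
  rw [xPath, map_sum]
  exact Finset.sum_eq_zero fun m _ => by rw [letterRep_arrow, if_neg h, Matrix.single_zero]

theorem letterRep_vertex_mul_pow_self (l : ZMod 2) (k : ZMod 4) (t : ℕ) :
    letterRep K l (vertex K k * xPath K l ^ t) = Matrix.single k (k + t) (X ^ t) := by
  induction t with
  | zero =>
    rw [pow_zero, mul_one, vertex, letterRep, PathAlgebra.toMatrix_ofPath, Nat.cast_zero, add_zero,
      Quiver.Path.weight_nil, pow_zero]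
  | succ t ih =>
    rw [pow_succ, ← mul_assoc, map_mul, ih, xPath, map_sum, Finset.mul_sum,
      Finset.sum_eq_single (k + (t : ZMod 4))]
    · rw [letterRep_arrow, Matrix.single_mul_single_same, if_pos rfl, pow_succ, Nat.cast_succ,
        add_assoc]
    · intro m _ hm
      rw [letterRep_arrow]
      exact Matrix.single_mul_single_of_ne _ _ _ _ hm.symm _
    · exact fun h => absurd (Finset.mem_univ _) h

theorem letterRep_vertex_mul_pow_of_ne {l l' : ZMod 2} (h : l' ≠ l) (k : ZMod 4) {t : ℕ}
    (ht : t ≠ 0) : letterRep K l (vertex K k * xPath K l' ^ t) = 0 := by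
  rw [map_mul, map_pow, letterRep_xPath_of_ne K h, zero_pow ht, mul_zero]

theorem coeff_zero_weight_letterWeight (l : ZMod 2) {a b : ZMod 4} (r : Quiver.Path a b) :
    (r.weight (letterWeight K l)).coeff 0 = if r.length = 0 then 1 else 0 := by
  cases r with
  | nil => simp
  | @cons m _ r f =>
    obtain ⟨l', _⟩ := f
    have hletter : (letterWeight K l (Arrow.a l' m)).coeff 0 = 0 := by
      rw [letterWeight]
      split_ifs
      · exact coeff_X_zero
      · exact coeff_zero 0
    rw [Quiver.Path.weight_cons, mul_coeff_zero, hletter, mul_zero, Quiver.Path.length_cons,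
      if_neg (Nat.succ_ne_zero _)]

theorem coeff_zero_letterRep (l l' : ZMod 2) (f : KΓ K) (a b : ZMod 4) :
    (letterRep K l f a b).coeff 0 = (letterRep K l' f a b).coeff 0 := by
  induction f using PathAlgebra.induction_ofPath with
  | zero => simp only [map_zero, Matrix.zero_apply, coeff_zero]
  | add f g hf hg => simp only [map_add, Matrix.add_apply, coeff_add, hf, hg]
  | path c u v r =>
    simp only [map_smul, Matrix.smul_apply, coeff_smul, letterRep, PathAlgebra.toMatrix_ofPath,
      Matrix.single_apply, apply_ite (fun p : K[X] => p.coeff 0), coeff_zero_weight_letterWeight]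

theorem coeff_zero_letterRep_of_ne (l : ZMod 2) (f : KΓ K) {a b : ZMod 4} (h : a ≠ b) :
    (letterRep K l f a b).coeff 0 = 0 := by
  induction f using PathAlgebra.induction_ofPath with
  | zero => simp only [map_zero, Matrix.zero_apply, coeff_zero]
  | add f g hf hg => simp only [map_add, Matrix.add_apply, coeff_add, hf, hg, add_zero]
  | path c u v r =>
    simp only [map_smul, Matrix.smul_apply, coeff_smul, letterRep, PathAlgebra.toMatrix_ofPath,
      Matrix.single_apply]
    split_ifs with huv
    · obtain ⟨rfl, rfl⟩ := huv
      rw [coeff_zero_weight_letterWeight, if_neg (fun h0 => h (r.eq_of_length_zero h0)), smul_zero]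
    · rw [coeff_zero, smul_zero]

theorem coeff_letterRep_mul_mul (l : ZMod 2) (f g : KΓ K) {r : KΓ K} {i k : ZMod 4} {c : K}
    {N : ℕ} (hr : letterRep K l r = c • Matrix.single i k (X ^ N)) (a b : ZMod 4) :
    (letterRep K l (f * r * g) a b).coeff N =
      c * ((letterRep K 0 f a i).coeff 0 * (letterRep K 0 g k b).coeff 0) := by
  have hentry : letterRep K l (f * r * g) a b =
      c • (letterRep K l f a i * letterRep K l g k b * X ^ N) := by
    rw [map_mul, map_mul, hr, mul_smul_comm, smul_mul_assoc, Matrix.smul_apply]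
    rw [Matrix.mul_apply, Finset.sum_eq_single k]
    · rw [Matrix.mul_single_apply_same, mul_right_comm]
    · intro b' _ hb'
      rw [Matrix.mul_single_apply_of_ne _ _ _ _ _ hb', zero_mul]
    · exact fun h => absurd (Finset.mem_univ _) h
  have hcoeff := coeff_mul_X_pow (letterRep K l f a i * letterRep K l g k b) N 0
  rw [zero_add] at hcoeff
  rw [hentry, coeff_smul, hcoeff, mul_coeff_zero, coeff_zero_letterRep K l 0,
    coeff_zero_letterRep K l 0, smul_eq_mul]

variable {K} (T : ℕ) (q : ZMod 4 → K)

/-- The scalar `c` with `e_k x_{l+1}^{4T+2} = c e_k x_l^{4T+2}`. -/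
def socleRatio (l : ZMod 2) (k : ZMod 4) : K := if par k = l then -q k else -(q k)⁻¹

/-- The coefficient of `e_k x_l^{4T+2}` in an element of `A`, computed on a representative in `KΓ`
after `e_k x_{l+1}^{4T+2}` has been rewritten as a multiple of `e_k x_l^{4T+2}`. -/
def pathSocleCoeff (l : ZMod 2) (k : ZMod 4) : KΓ K →ₗ[K] K :=
  let entry (l' : ZMod 2) : KΓ K →ₗ[K] K :=
    lcoeff K (4 * T + 2) ∘ₗ LinearMap.proj (k + (4 * T + 2 : ℕ)) ∘ₗ LinearMap.proj k ∘ₗ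
      (letterRep K l').toLinearMap
  entry l + socleRatio q l k • entry (l + 1)

theorem pathSocleCoeff_apply (l : ZMod 2) (k : ZMod 4) (f : KΓ K) :
    pathSocleCoeff T q l k f =
      (letterRep K l f k (k + (4 * T + 2 : ℕ))).coeff (4 * T + 2) +
        socleRatio q l k * (letterRep K (l + 1) f k (k + (4 * T + 2 : ℕ))).coeff (4 * T + 2) :=
  rfl

theorem letterRep_socle_relation (l : ZMod 2) (i : ZMod 4) :
    letterRep K l (vertex K i *
        (q i • xPath K (par i) ^ (4 * T + 2) + xPath K (par (i + 1)) ^ (4 * T + 2))) =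
      (if par i = l then q i else 1) •
        Matrix.single i (i + (4 * T + 2 : ℕ)) (X ^ (4 * T + 2)) := by
  rw [mul_add, mul_smul_comm, map_add, map_smul, par_add_one]
  split_ifs with h
  · subst h
    rw [letterRep_vertex_mul_pow_self, letterRep_vertex_mul_pow_of_ne K (add_one_ne _) _ (by omega),
      add_zero]
  · rw [letterRep_vertex_mul_pow_of_ne K h _ (by omega), ← eq_add_one_of_ne h,
      letterRep_vertex_mul_pow_self, smul_zero, zero_add, one_smul]

theorem pathSocleCoeff_mul_relation_mul (hq : ∀ i, q i ≠ 0) (l : ZMod 2) (k : ZMod 4) {r : KΓ K}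
    (hr : r ∈ relations T q) (f g : KΓ K) : pathSocleCoeff T q l k (f * r * g) = 0 := by
  rw [pathSocleCoeff_apply]
  rcases hr with ⟨l', rfl⟩ | ⟨i, rfl⟩
  · have hzero : ∀ l, letterRep K l (xPath K l' * xPath K (l' + 1)) = 0 := fun l => by
      rcases eq_or_eq_add_one l l' with rfl | rfl
      · rw [map_mul, letterRep_xPath_of_ne K (add_one_ne _), mul_zero]
      · rw [map_mul, letterRep_xPath_of_ne K (add_one_ne _), zero_mul]
    simp [hzero]
  · rw [coeff_letterRep_mul_mul K l f g (letterRep_socle_relation T q l i),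
      coeff_letterRep_mul_mul K (l + 1) f g (letterRep_socle_relation T q (l + 1) i), socleRatio]
    rcases eq_or_ne k i with rfl | hk
    · have := hq k
      rcases eq_or_eq_add_one l (par k) with h | h
      · simp only [h, (add_one_ne l).symm, if_true, if_false]
        ring
      · simp only [h, add_one_ne l, if_true, if_false]
        field_simp
        ring
    · rw [coeff_zero_letterRep_of_ne K 0 f hk]
      ring

/-- The coefficient of `e_k x_l^{4T+2}` in an element of `A`; it is a Frobenius form on `e_k A`. -/
def socleCoeff (hq : ∀ i, q i ≠ 0) (l : ZMod 2) (k : ZMod 4) : Alg T q →ₗ[K] K :=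
  ((relIdeal T q).asIdeal.restrictScalars K).liftQ (pathSocleCoeff T q l k)
      (fun _ hf => map_eq_zero_of_mem_span (pathSocleCoeff T q l k).toAddMonoidHom
        (fun _ hr => pathSocleCoeff_mul_relation_mul T q hq l k hr) hf) ∘ₗ
    (Submodule.Quotient.restrictScalarsEquiv K (relIdeal T q).asIdeal).symm.toLinearMap

theorem socleCoeff_proj (hq : ∀ i, q i ≠ 0) (l : ZMod 2) (k : ZMod 4) (f : KΓ K) :
    socleCoeff T q hq l k (proj T q f) = pathSocleCoeff T q l k f := rfl

theorem socleCoeff_mono (hq : ∀ i, q i ≠ 0) (l : ZMod 2) (k k' : ZMod 4) (t : ℕ) :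
    socleCoeff T q hq l k (e T q k' * x T q l ^ t) =
      if k = k' ∧ t = 4 * T + 2 then 1 else 0 := by
  rw [e, x, ← map_pow, ← map_mul, socleCoeff_proj, pathSocleCoeff_apply,
    letterRep_vertex_mul_pow_self]
  rcases eq_or_ne t 0 with rfl | ht
  · simp [Matrix.single_apply, vertex, letterRep, PathAlgebra.toMatrix_ofPath,
      apply_ite (fun p : K[X] => p.coeff (4 * T + 2)), coeff_one]
  · rw [letterRep_vertex_mul_pow_of_ne K (add_one_ne l).symm _ ht]
    by_cases h : k = k' ∧ t = 4 * T + 2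
    · obtain ⟨rfl, rfl⟩ := h
      simp
    · rw [if_neg h, Matrix.single_apply]
      split_ifs with h'
      · rw [coeff_X_pow, if_neg fun h0 => h ⟨h'.1.symm, h0.symm⟩]
        simp
      · simp

theorem socleCoeff_mono_of_ne (hq : ∀ i, q i ≠ 0) (l l' : ZMod 2) (k k' : ZMod 4) {t : ℕ}
    (ht : t ≠ 4 * T + 2) : socleCoeff T q hq l k (e T q k' * x T q l' ^ t) = 0 := by
  rcases eq_or_ne t 0 with rfl | ht0
  · simpa [ht] using socleCoeff_mono T q hq l k k' 0
  rcases eq_or_eq_add_one l l' with rfl | rfl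
  · rw [socleCoeff_mono, if_neg fun h => ht h.2]
  · rw [e, x, ← map_pow, ← map_mul, socleCoeff_proj, pathSocleCoeff_apply,
      letterRep_vertex_mul_pow_self, letterRep_vertex_mul_pow_of_ne K (add_one_ne l) _ ht0,
      Matrix.single_apply]
    split_ifs <;> simp [coeff_X_pow, ht.symm]

/-- The coefficient of `e_k x_l^t` in an element of `A`, for `1 ≤ t ≤ 4T+2`. -/
def coeff (hq : ∀ i, q i ≠ 0) (l : ZMod 2) (k : ZMod 4) (t : ℕ) : Alg T q →ₗ[K] K :=
  socleCoeff T q hq l k ∘ₗ LinearMap.mulRight K (x T q l ^ (4 * T + 2 - t))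

theorem coeff_mono (hq : ∀ i, q i ≠ 0) (l : ZMod 2) (k k' : ZMod 4) {s : ℕ} (hs : s ≤ 4 * T + 2)
    (t : ℕ) : coeff T q hq l k s (e T q k' * x T q l ^ t) = if k = k' ∧ s = t then 1 else 0 := by
  rw [coeff, LinearMap.comp_apply, LinearMap.mulRight_apply, mul_assoc, ← pow_add, socleCoeff_mono]
  exact if_congr (and_congr_right fun _ => by omega) rfl rfl

theorem coeff_mono_of_ne (hq : ∀ i, q i ≠ 0) {l l' : ZMod 2} (h : l' ≠ l) (k k' : ZMod 4)
    {s t : ℕ} (hs : s ≠ 0) (hs' : s < 4 * T + 2 ∨ t ≠ 4 * T + 2) :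
    coeff T q hq l k s (e T q k' * x T q l' ^ t) = 0 := by
  rw [coeff, LinearMap.comp_apply, LinearMap.mulRight_apply, mul_assoc]
  rcases eq_or_ne t 0 with rfl | ht
  · rw [pow_zero, one_mul, socleCoeff_mono_of_ne T q hq l l k k' (by omega)]
  rcases eq_or_ne (4 * T + 2 - s) 0 with hst | hst
  · rw [hst, pow_zero, mul_one, socleCoeff_mono_of_ne T q hq l l' k k' (by omega)]
  · rw [x_pow_mul_x_pow T q h ht hst, mul_zero, map_zero]

end Coordinates

/-! ### Stripping letters -/

variable {K : Type u} [Field K] (T : ℕ) (q : ZMod 4 → K) (hq : ∀ i, q i ≠ 0)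

/-- The linear map that strips the first letter `l`: it sends `e_k x_l^t` to `e_{k+1} x_l^{t-1}` for
`1 ≤ t ≤ N`, and the other monomials to `0`. If `N = 4T+2`, then `e_k x_{l+1}^{4T+2}` is not among
the other monomials, since it is a multiple of `e_k x_l^{4T+2}`. -/
def strip (l : ZMod 2) (N : ℕ) : Alg T q →ₗ[K] Alg T q :=
  ∑ k, ∑ t ∈ Finset.range N, (coeff T q hq l k (t + 1)).smulRight (e T q (k + 1) * x T q l ^ t)

theorem strip_apply (l : ZMod 2) (N : ℕ) (v : Alg T q) : strip T q hq l N v =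
    ∑ k, ∑ t ∈ Finset.range N, coeff T q hq l k (t + 1) v • (e T q (k + 1) * x T q l ^ t) := by
  simp only [strip, LinearMap.sum_apply, LinearMap.smulRight_apply]

theorem strip_mono {N : ℕ} (hN : N ≤ 4 * T + 2) (l : ZMod 2) (k : ZMod 4) {t : ℕ} (ht : t + 1 ≤ N) :
    strip T q hq l N (e T q k * x T q l ^ (t + 1)) = e T q (k + 1) * x T q l ^ t := by
  rw [strip_apply, Finset.sum_eq_single k, Finset.sum_eq_single t]
  · rw [coeff_mono T q hq l k k (by omega), if_pos ⟨rfl, rfl⟩, one_smul]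
  · intro s hs hst
    have := Finset.mem_range.mp hs
    rw [coeff_mono T q hq l k k (by omega), if_neg (by omega), zero_smul]
  · exact fun h => absurd (Finset.mem_range.mpr ht) h
  · intro a _ ha
    refine Finset.sum_eq_zero fun s hs => ?_
    have := Finset.mem_range.mp hs
    rw [coeff_mono T q hq l a k (by omega), if_neg fun h => ha h.1, zero_smul]
  · exact fun h => absurd (Finset.mem_univ _) h

theorem strip_mono_of_lt {N : ℕ} (hN : N ≤ 4 * T + 2) (l : ZMod 2) (k : ZMod 4) {t : ℕ}
    (ht : t = 0 ∨ N < t) : strip T q hq l N (e T q k * x T q l ^ t) = 0 := by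
  rw [strip_apply]
  refine Finset.sum_eq_zero fun a _ => Finset.sum_eq_zero fun s hs => ?_
  have := Finset.mem_range.mp hs
  rw [coeff_mono T q hq l a k (by omega), if_neg (by omega), zero_smul]

theorem strip_e {N : ℕ} (hN : N ≤ 4 * T + 2) (l : ZMod 2) (k : ZMod 4) :
    strip T q hq l N (e T q k) = 0 := by
  simpa using strip_mono_of_lt T q hq hN l k (Or.inl rfl)

theorem strip_mono_of_ne {l l' : ZMod 2} (h : l' ≠ l) (k : ZMod 4) {N t : ℕ}
    (hN : N < 4 * T + 2 ∨ t ≠ 4 * T + 2) :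
    strip T q hq l N (e T q k * x T q l' ^ t) = 0 := by
  rw [strip_apply]
  refine Finset.sum_eq_zero fun a _ => Finset.sum_eq_zero fun s hs => ?_
  have := Finset.mem_range.mp hs
  rw [coeff_mono_of_ne T q hq h a k (by omega) (by omega), zero_smul]

/-- The sum of the coefficients of the monomials `e_k x_l^{4T+1}`, as a multiple of `1`. -/
def lastCoeff (l : ZMod 2) : Alg T q →ₗ[K] Alg T q :=
  (∑ k, coeff T q hq l k (4 * T + 1)).smulRight 1

theorem lastCoeff_mono (l : ZMod 2) (k : ZMod 4) (t : ℕ) :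
    lastCoeff T q hq l (e T q k * x T q l ^ t) = if t = 4 * T + 1 then 1 else 0 := by
  rw [lastCoeff, LinearMap.smulRight_apply, LinearMap.sum_apply]
  simp only [coeff_mono T q hq l _ k (show 4 * T + 1 ≤ 4 * T + 2 by omega)]
  split_ifs with h
  · simp [h]
  · simp [Ne.symm h]

theorem lastCoeff_e (l : ZMod 2) (k : ZMod 4) : lastCoeff T q hq l (e T q k) = 0 := by
  simpa using lastCoeff_mono T q hq l k 0

theorem lastCoeff_mono_of_ne {l l' : ZMod 2} (h : l' ≠ l) (k : ZMod 4) (t : ℕ) :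
    lastCoeff T q hq l (e T q k * x T q l' ^ t) = 0 := by
  rw [lastCoeff, LinearMap.smulRight_apply, LinearMap.sum_apply]
  simp only [coeff_mono_of_ne T q hq h _ k (Nat.succ_ne_zero (4 * T)) (Or.inl (by omega)),
    Finset.sum_const_zero, zero_smul]

end Stripping

/-! ### Scalars, bimodule elements and the differential -/

section Differential

variable {K : Type u} [Field K]

section Scalars

variable (q : ZMod 4 → K)

theorem S_zero (v : ZMod 4) : S q 0 v = 1 := by simp [S]

theorem S_add (u w : ℕ) (v : ZMod 4) : S q (u + w) v = S q u v * S q w (v + u) := by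
  rw [S, Finset.prod_range_add, S, S]
  congr 1
  refine Finset.prod_congr rfl fun t _ => ?_
  congr 1
  push_cast
  ring

theorem S_one (v : ZMod 4) : S q 1 v = q v := by simp [S]

theorem S_succ (u : ℕ) (v : ZMod 4) : S q (u + 1) v = S q u v * q (v + u) := by
  rw [S_add, S_one]

theorem S_succ' (u : ℕ) (v : ZMod 4) : S q (u + 1) v = q v * S q u (v + 1) := by
  rw [add_comm, S_add, S_one, Nat.cast_one]

variable {q} in
theorem S_ne_zero (hq : ∀ i, q i ≠ 0) (u : ℕ) (v : ZMod 4) : S q u v ≠ 0 :=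
  Finset.prod_ne_zero_iff.mpr fun _ _ => hq _

theorem add_four (i : ZMod 4) : i + 4 = i := by revert i; decide

theorem periodic_S_mul_S (n : ℕ) :
    Function.Periodic (fun i => S q n i * S q n (i + 2)) (2 : ZMod 4) := fun i => by
  have htwo : i + 2 + 2 = i := by rw [add_assoc]; exact add_four i
  change S q n (i + 2) * S q n (i + 2 + 2) = _
  rw [htwo, mul_comm]

theorem S_mul_S_add_two_shift (n : ℕ) (i : ZMod 4) :
    (S q n i * S q n (i + 2)) * (q (i + n) * q (i + n + 2)) =
      (q i * q (i + 2)) * (S q n (i + 1) * S q n (i + 1 + 2)) := by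
  have h := S_succ q n i
  have h' := S_succ q n (i + 2)
  rw [S_succ'] at h h'
  rw [add_right_comm i 1 2, add_right_comm i (n : ZMod 4) 2]
  linear_combination (-(S q n (i + 2) * q (i + 2 + n))) * h - q i * S q n (i + 1) * h'

variable {q} in
theorem S_mul_S_add_two (hq : ∀ i, q i ≠ 0) (m : ℕ) (i : ZMod 4) :
    S q (m + 1) i * S q (m + 1) (i + 2) = S q (m + 1) (i + m) * S q (m + 1) (i + m + 2) := by
  rcases Nat.even_or_odd' m with ⟨s, rfl | rfl⟩
  · have h := (periodic_S_mul_S q (2 * s + 1)).nat_mul s i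
    rw [Nat.cast_mul, Nat.cast_two, mul_comm (2 : ZMod 4)]
    exact h.symm
  · have hq_periodic := (periodic_S_mul_S q 1).nat_mul (s + 1) i
    have hS_periodic := (periodic_S_mul_S q (2 * s + 1 + 1)).nat_mul s (i + 1)
    have hshift := S_mul_S_add_two_shift q (2 * s + 1 + 1) i
    have hcast : i + ((2 * s + 1 + 1 : ℕ) : ZMod 4) = i + ((s + 1 : ℕ) : ZMod 4) * 2 := by
      push_cast; ring
    have hcast' : i + ((2 * s + 1 : ℕ) : ZMod 4) = i + 1 + (s : ZMod 4) * 2 := by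
      push_cast; ring
    simp only [S_one] at hq_periodic
    rw [hcast, hq_periodic, mul_comm] at hshift
    rw [hcast', hS_periodic]
    exact mul_left_cancel₀ (mul_ne_zero (hq _) (hq _)) hshift

end Scalars

variable (T : ℕ) (q : ZMod 4 → K)

section Act

variable {T q} {M : Type u} [AddCommGroup M] [Module (Env T q) M]

theorem act_def (c : K) (a : Alg T q) (z : M) (b : Alg T q) :
    act T q c a z b = (c • (a ⊗ₜ[K] op b) : Env T q) • z := rfl

theorem act_add (c : K) (a : Alg T q) (z w : M) (b : Alg T q) :
    act T q c a (z + w) b = act T q c a z b + act T q c a w b := smul_add _ _ _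

theorem act_sub (c : K) (a : Alg T q) (z w : M) (b : Alg T q) :
    act T q c a (z - w) b = act T q c a z b - act T q c a w b := smul_sub _ _ _

theorem act_neg (c : K) (a : Alg T q) (z : M) (b : Alg T q) :
    act T q c a (-z) b = -act T q c a z b := smul_neg _ _

theorem act_zero (c : K) (a b : Alg T q) : act T q c a (0 : M) b = 0 := smul_zero _

theorem act_sum {ι : Type*} (s : Finset ι) (F : ι → M) (c : K) (a b : Alg T q) :
    act T q c a (∑ k ∈ s, F k) b = ∑ k ∈ s, act T q c a (F k) b := Finset.smul_sum

theorem act_act (c c' : K) (a a' : Alg T q) (z : M) (b b' : Alg T q) :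
    act T q c a (act T q c' a' z b') b = act T q (c * c') (a * a') z (b' * b) := by
  rw [act, act, act, smul_smul, smul_mul_smul_comm, Algebra.TensorProduct.tmul_mul_tmul, op_mul]

theorem act_one (z : M) : act T q 1 1 z 1 = z := by
  rw [act, one_smul, op_one, ← Algebra.TensorProduct.one_def, one_smul]

theorem act_zero_left (c : K) (z : M) (b : Alg T q) : act T q c 0 z b = 0 := by
  rw [act, TensorProduct.zero_tmul, smul_zero]
  exact zero_smul (Env T q) z

theorem act_zero_right (c : K) (a : Alg T q) (z : M) : act T q c a z 0 = 0 := by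
  rw [act, op_zero, TensorProduct.tmul_zero, smul_zero]
  exact zero_smul (Env T q) z

theorem act_zero_scalar (a : Alg T q) (z : M) (b : Alg T q) : act T q 0 a z b = 0 := by
  rw [act, zero_smul]
  exact zero_smul (Env T q) z

theorem act_add_left (c : K) (a a' : Alg T q) (z : M) (b : Alg T q) :
    act T q c (a + a') z b = act T q c a z b + act T q c a' z b := by
  rw [act, TensorProduct.add_tmul, smul_add, add_smul]; rfl

theorem act_add_right (c : K) (a : Alg T q) (z : M) (b b' : Alg T q) :
    act T q c a z (b + b') = act T q c a z b + act T q c a z b' := by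
  rw [act, op_add, TensorProduct.tmul_add, smul_add, add_smul]; rfl

theorem act_add_scalar (c c' : K) (a : Alg T q) (z : M) (b : Alg T q) :
    act T q (c + c') a z b = act T q c a z b + act T q c' a z b := by
  rw [act, add_smul, add_smul]; rfl

theorem act_neg_scalar (c : K) (a : Alg T q) (z : M) (b : Alg T q) :
    act T q (-c) a z b = -act T q c a z b := by
  refine eq_neg_of_add_eq_zero_left ?_
  rw [← act_add_scalar, neg_add_cancel, act_zero_scalar]

theorem act_smul_left (c k : K) (a : Alg T q) (z : M) (b : Alg T q) :
    act T q c (k • a) z b = act T q (c * k) a z b := by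
  rw [act, ← TensorProduct.smul_tmul', smul_smul]; rfl

theorem act_eq_smul_left (c : K) (a : Alg T q) (z : M) (b : Alg T q) :
    act T q c a z b = act T q 1 (c • a) z b := by
  rw [act_smul_left, one_mul]

theorem act_smul_right (c k : K) (a : Alg T q) (z : M) (b : Alg T q) :
    act T q c a z (k • b) = act T q (c * k) a z b := by
  rw [act, op_smul, TensorProduct.tmul_smul, smul_smul]; rfl

theorem map_act {M' : Type u} [AddCommGroup M'] [Module (Env T q) M'] (f : M →ₗ[Env T q] M')
    (c : K) (a : Alg T q) (z : M) (b : Alg T q) :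
    f (act T q c a z b) = act T q c a (f z) b := map_smul f _ _

theorem Fix.act_e {i k : ZMod 4} {z : M} (hz : Fix T q i k z) (c : K) (a b : Alg T q) :
    CyclicAlg.act T q c (a * e T q i) z (e T q k * b) = CyclicAlg.act T q c a z b := by
  conv_rhs => rw [← hz]
  have hact := act_act c 1 a (e T q i) z b (e T q k)
  rw [mul_one] at hact
  rw [← hact, act_def 1, one_smul]

theorem Fix.act_e_left {i k : ZMod 4} {z : M} (hz : Fix T q i k z) (c : K) (a b : Alg T q) :
    CyclicAlg.act T q c (a * e T q i) z b = CyclicAlg.act T q c a z b := by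
  rw [← hz.act_e c (a * e T q i), mul_assoc, e_mul_self, hz.act_e]

theorem Fix.act_e_right {i k : ZMod 4} {z : M} (hz : Fix T q i k z) (c : K) (a b : Alg T q) :
    CyclicAlg.act T q c a z (e T q k * b) = CyclicAlg.act T q c a z b := by
  rw [← hz.act_e c a (e T q k * b), ← mul_assoc, e_mul_self, hz.act_e]

theorem Fix.act_of_ne {i k k' : ZMod 4} {z : M} (hz : Fix T q i k z) (h : k ≠ k') (c : K)
    (a b : Alg T q) : CyclicAlg.act T q c a z (e T q k' * b) = 0 := by
  rw [← hz.act_e_right, ← mul_assoc, e_mul_e, if_neg h, zero_mul, act_zero_right]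

end Act

/-- The generators `𝔭^n_{i,j}` with the convention that they vanish unless `0 ≤ j ≤ n`. -/
def pz (n : ℕ) (i : ZMod 4) (j : ℤ) : R T q n := if 0 ≤ j then p T q n i j.toNat else 0

theorem pz_natCast (n : ℕ) (i : ZMod 4) (j : ℕ) : pz T q n i j = p T q n i j := by
  rw [pz, if_pos (Int.natCast_nonneg j), Int.toNat_natCast]

theorem p_eq_zero {n j : ℕ} (h : n < j) (i : ZMod 4) : p T q n i j = 0 := by
  rw [p, dif_neg (by omega)]

theorem pz_of_neg (n : ℕ) (i : ZMod 4) {j : ℤ} (h : j < 0) : pz T q n i j = 0 :=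
  if_neg (by omega)

theorem pz_of_gt {n : ℕ} (i : ZMod 4) {j : ℤ} (h : n < j) : pz T q n i j = 0 := by
  rw [pz, if_pos (by omega), p_eq_zero T q (by omega)]

theorem fix_pz (n : ℕ) (i : ZMod 4) (j : ℤ) : Fix T q i (i + n) (pz T q n i j) := by
  rw [pz]
  split_ifs
  · exact fix_p T q n i _
  · exact smul_zero _

/-- The sign of the left terms of `∂^{n+1}`. -/
def sign (K : Type u) [Field K] (n : ℕ) : K := (-1) ^ (n + 1)

theorem sign_succ (n : ℕ) : sign K (n + 1) = -sign K n := by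
  rw [sign, pow_succ, sign]; ring

theorem par_add_even (i : ZMod 4) (m : ℕ) : par (i + (2 * m : ℕ)) = par i := by
  rw [Nat.cast_mul, Nat.cast_two, mul_comm]
  exact Function.Periodic.nat_mul par_add_two m i

theorem par_add_odd (i : ZMod 4) (m : ℕ) : par (i + (2 * m + 1 : ℕ)) = par i + 1 := by
  rw [Nat.cast_succ, ← add_assoc, par_add_one, par_add_even]

theorem sign_even (m : ℕ) : sign K (2 * m) = -1 := Odd.neg_one_pow ⟨m, rfl⟩

theorem sign_odd (m : ℕ) : sign K (2 * m + 1) = 1 := Even.neg_one_pow ⟨m + 1, by ring⟩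

theorem sign_mul_sign (n : ℕ) : sign K n * sign K n = 1 := by
  rw [sign, ← mul_pow, neg_one_mul, neg_neg, one_pow]

theorem pz_natCast_sub_one {n j : ℕ} (hj : j ≠ 0) (i : ZMod 4) :
    pz T q n i ((j : ℤ) - 1) = p T q n i (j - 1) := by
  rw [← pz_natCast, Nat.cast_sub (Nat.one_le_iff_ne_zero.mpr hj), Nat.cast_one]

theorem dGen_two_mul {m j : ℕ} (hj : j ≤ 2 * m + 1) (i : ZMod 4) {a b : ℕ}
    (hab : (2 * j < 2 * m + 1 ∧ a = 4 * T + 1 ∧ b = 1) ∨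
      (2 * m + 1 < 2 * j ∧ a = 1 ∧ b = 4 * T + 1)) :
    dGen T q (2 * m) i j =
      act T q (S q (2 * m + 1 - j) (i + j - 1)) 1 (pz T q (2 * m) i (j - 1)) (x T q (par i + 1) ^ a)
        + act T q 1 1 (p T q (2 * m) i j) (x T q (par i) ^ b)
        - act T q (S q j i) (x T q (par i) ^ b) (p T q (2 * m) (i + 1) j) 1
        - act T q 1 (x T q (par i + 1) ^ a) (pz T q (2 * m) (i + 1) (j - 1)) 1 := by
  have hm : 2 * m / 2 = m := by omega
  simp only [dGen, par_add_one, hm, Nat.mul_mod_right, if_true]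
  rcases Nat.eq_zero_or_pos j with rfl | hpos
  · obtain ⟨-, -, rfl⟩ := hab.resolve_right (by omega)
    rw [pz_of_neg T q _ _ (by simp), pz_of_neg T q _ _ (by simp), if_pos rfl, act_zero, act_zero,
      S_zero, zero_add, sub_zero, pow_one]
  · rw [if_neg hpos.ne', pz_natCast_sub_one T q hpos.ne', pz_natCast_sub_one T q hpos.ne']
    rcases hab with ⟨h, rfl, rfl⟩ | ⟨h, rfl, rfl⟩
    · rw [if_pos (by omega), pow_one]
    rw [if_neg (by omega), pow_one]
    rcases hj.lt_or_eq with hlt | rfl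
    · rw [if_pos hlt]
    · rw [if_neg (lt_irrefl _), p_eq_zero T q (Nat.lt_succ_self _),
        p_eq_zero T q (Nat.lt_succ_self _), Nat.add_sub_cancel, Nat.sub_self, S_zero, act_zero,
        act_zero, add_zero, sub_zero]

theorem dGen_two_mul_add_one {m j : ℕ} (hj : j ≤ 2 * m + 2) (i : ZMod 4) {a b : ℕ}
    (hab : (2 * j < 2 * m + 2 ∧ a = 4 * T + 1 ∧ b = 1) ∨
      (2 * m + 2 < 2 * j ∧ a = 1 ∧ b = 4 * T + 1)) :
    dGen T q (2 * m + 1) i j =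
      act T q (S q (2 * m + 2 - j) (i + j - 1)) 1 (pz T q (2 * m + 1) i (j - 1))
          (x T q (par i) ^ a)
        + act T q 1 1 (p T q (2 * m + 1) i j) (x T q (par i + 1) ^ b)
        + act T q (S q j i) (x T q (par i) ^ b) (p T q (2 * m + 1) (i + 1) j) 1
        + act T q 1 (x T q (par i + 1) ^ a) (pz T q (2 * m + 1) (i + 1) (j - 1)) 1 := by
  have hm : (2 * m + 1 + 1) / 2 = m + 1 := by omega
  have hmod : ¬ (2 * m + 1) % 2 = 0 := by omega
  simp only [dGen, par_add_one, hm, if_neg hmod]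
  rcases Nat.eq_zero_or_pos j with rfl | hpos
  · obtain ⟨-, -, rfl⟩ := hab.resolve_right (by omega)
    rw [pz_of_neg T q _ _ (by simp), pz_of_neg T q _ _ (by simp), if_pos rfl, act_zero, act_zero,
      S_zero, zero_add, add_zero, pow_one, pow_one]
  · rw [if_neg hpos.ne', pz_natCast_sub_one T q hpos.ne', pz_natCast_sub_one T q hpos.ne']
    rcases hab with ⟨h, rfl, rfl⟩ | ⟨h, rfl, rfl⟩
    · rw [if_pos (by omega), pow_one, pow_one]
      rfl
    rw [if_neg (by omega), if_neg (by omega), pow_one, pow_one]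
    rcases hj.lt_or_eq with hlt | rfl
    · rw [if_pos (by omega)]
      rfl
    · rw [if_neg (by omega), p_eq_zero T q (Nat.lt_succ_self _),
        p_eq_zero T q (Nat.lt_succ_self _), Nat.sub_self, S_zero, act_zero, act_zero, add_zero,
        add_zero]
      rfl

theorem d_pz {n : ℕ} {i i' v : ZMod 4} {j j' u : ℤ} {a b : ℕ} {l k : ZMod 2}
    (hab : (2 * j < n + 1 ∧ a = 4 * T + 1 ∧ b = 1) ∨ (n + 1 < 2 * j ∧ a = 1 ∧ b = 4 * T + 1))
    (hl : par i = l) (hk : par (i + n) = k) (hi : i + 1 = i') (hv : i + j - 1 = v)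
    (hj : j - 1 = j') (hu : n + 1 - j = u) :
    d T q n (pz T q (n + 1) i j) =
      act T q (S q u.toNat v) 1 (pz T q n i j') (x T q (k + 1) ^ a)
        + act T q 1 1 (pz T q n i j) (x T q k ^ b)
        + act T q (sign K n * S q j.toNat i) (x T q l ^ b) (pz T q n i' j) 1
        + act T q (sign K n) (x T q (l + 1) ^ a) (pz T q n i' j') 1 := by
  rcases lt_or_ge j 0 with hneg | hnonneg
  · simp only [pz_of_neg T q _ _ hneg, pz_of_neg T q _ _ (show j' < 0 by omega), act_zero, map_zero,
      add_zero]
  rcases lt_or_ge (n + 1 : ℤ) j with hgt | hle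
  · have hgt' : ((n + 1 : ℕ) : ℤ) < j := by push_cast; omega
    simp only [pz_of_gt T q i hgt', pz_of_gt T q _ (show (n : ℤ) < j by omega),
      pz_of_gt T q _ (show (n : ℤ) < j' by omega), act_zero, map_zero, add_zero]
  lift j to ℕ using hnonneg
  subst hl hk hi hv hj hu
  have hu : ((n : ℤ) + 1 - j).toNat = n + 1 - j := by omega
  rw [pz_natCast, d_p T q n i j (by omega), hu, Int.toNat_natCast, pz_natCast, pz_natCast,
    Int.cast_natCast]
  rcases Nat.even_or_odd' n with ⟨m, rfl | rfl⟩
  · rw [dGen_two_mul T q (by omega) i (a := a) (b := b) (by omega), par_add_even, sign_even,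
      neg_one_mul, act_neg_scalar, act_neg_scalar, ← sub_eq_add_neg, ← sub_eq_add_neg]
  · rw [dGen_two_mul_add_one T q (by omega) i (a := a) (b := b) (by omega), sign_odd, one_mul,
      par_add_odd, add_one_add_one]

section Sandwich

variable {M : Type u} [AddCommGroup M] [Module (Env T q) M]

/-- The element `∑_k x_l^{4k} A x_l^{4T-4k} + ∑_k x_l^{4k+2} B x_l^{4T-4k-2}` of a bimodule. -/
def sandwich (l : ZMod 2) (A B : M) : M :=
  (∑ k ∈ Finset.range (T + 1), act T q 1 (x T q l ^ (4 * k)) A (x T q l ^ (4 * T - 4 * k)))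
    + ∑ k ∈ Finset.range T, act T q 1 (x T q l ^ (4 * k + 2)) B (x T q l ^ (4 * T - 4 * k - 2))

theorem sandwich_add (l : ZMod 2) (A A' B B' : M) :
    sandwich T q l (A + A') (B + B') = sandwich T q l A B + sandwich T q l A' B' := by
  simp only [sandwich, act_add, Finset.sum_add_distrib]
  abel

theorem sandwich_sub (l : ZMod 2) (A A' B B' : M) :
    sandwich T q l (A - A') (B - B') = sandwich T q l A B - sandwich T q l A' B' := by
  simp only [sandwich, act_sub, Finset.sum_sub_distrib]
  abel

theorem map_sandwich {M' : Type u} [AddCommGroup M'] [Module (Env T q) M']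
    (f : M →ₗ[Env T q] M') (l : ZMod 2) (A B : M) :
    f (sandwich T q l A B) = sandwich T q l (f A) (f B) := by
  simp only [sandwich, map_add, map_sum, map_act]

theorem act_sandwich_right (c : K) (l : ZMod 2) (A B : M) :
    act T q c 1 (sandwich T q l A B) (x T q l) =
      sandwich T q l (act T q c 1 A (x T q l)) (act T q c 1 B (x T q l)) := by
  simp only [sandwich, act_add, act_sum, act_act, one_mul, mul_one, ← pow_succ, ← pow_succ']

theorem act_sandwich_left (c : K) (l : ZMod 2) (A B : M) :
    act T q c (x T q l) (sandwich T q l A B) 1 =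
      sandwich T q l (act T q c (x T q l) A 1) (act T q c (x T q l) B 1) := by
  simp only [sandwich, act_add, act_sum, act_act, one_mul, mul_one, ← pow_succ, ← pow_succ']

theorem act_sandwich_right_of_ne (c : K) {l l' : ZMod 2} (h : l ≠ l') (A B : M) :
    act T q c 1 (sandwich T q l A B) (x T q l') =
      act T q c (x T q l ^ (4 * T)) A (x T q l') := by
  have h0 : ∀ t, t ≠ 0 → x T q l ^ t * x T q l' = 0 := fun t ht => by
    simpa using x_pow_mul_x_pow T q h ht one_ne_zero
  rw [sandwich, act_add, act_sum, act_sum, Finset.sum_range_succ, Finset.sum_eq_zero,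
    Finset.sum_eq_zero, zero_add, add_zero, act_act, Nat.sub_self, pow_zero, mul_one, one_mul,
    one_mul]
  · intro k hk
    have := Finset.mem_range.mp hk
    rw [act_act, h0 _ (by omega), act_zero_right]
  · intro k hk
    have := Finset.mem_range.mp hk
    rw [act_act, h0 _ (by omega), act_zero_right]

theorem act_sandwich_left_of_ne (c : K) {l l' : ZMod 2} (h : l' ≠ l) (A B : M) :
    act T q c (x T q l') (sandwich T q l A B) 1 =
      act T q c (x T q l') A (x T q l ^ (4 * T)) := by
  have h0 : ∀ t, t ≠ 0 → x T q l' * x T q l ^ t = 0 := fun t ht => by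
    simpa using x_pow_mul_x_pow T q h one_ne_zero ht
  rw [sandwich, act_add, act_sum, act_sum, Finset.sum_range_succ', Finset.sum_eq_zero,
    Finset.sum_eq_zero, zero_add, add_zero, act_act, mul_zero, pow_zero, mul_one, mul_one, mul_one,
    Nat.sub_zero]
  · intro k _
    rw [act_act, h0 _ (by omega), act_zero_left]
  · intro k _
    rw [act_act, h0 _ (by omega), act_zero_left]

theorem sandwich_telescope (l : ZMod 2) (c c' : K) (z z' : M) :
    sandwich T q l (act T q c 1 z (x T q l ^ 2) - act T q c' (x T q l ^ 2) z' 1)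
      (act T q c' 1 z' (x T q l ^ 2) - act T q c (x T q l ^ 2) z 1) =
    act T q c 1 z (x T q l ^ (4 * T + 2)) - act T q c' (x T q l ^ (4 * T + 2)) z' 1 := by
  set P : ℕ → M := fun k => act T q c (x T q l ^ (4 * k)) z (x T q l ^ (4 * T + 2 - 4 * k))
  set Q : ℕ → M := fun k => act T q c' (x T q l ^ (4 * k + 2)) z' (x T q l ^ (4 * T - 4 * k))
  have hP_sub : ∀ k ∈ Finset.range (T + 1), act T q 1 (x T q l ^ (4 * k))
      (act T q c 1 z (x T q l ^ 2) - act T q c' (x T q l ^ 2) z' 1) (x T q l ^ (4 * T - 4 * k)) =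
      P k - Q k := by
    intro k hk
    have := Finset.mem_range.mp hk
    simp only [act_sub, act_act, one_mul, mul_one, ← pow_add, P, Q]
    congr 3
    omega
  have hQ_sub : ∀ k ∈ Finset.range T, act T q 1 (x T q l ^ (4 * k + 2))
      (act T q c' 1 z' (x T q l ^ 2) - act T q c (x T q l ^ 2) z 1)
        (x T q l ^ (4 * T - 4 * k - 2)) = Q k - P (k + 1) := by
    intro k hk
    have := Finset.mem_range.mp hk
    have hexp : 2 + (4 * T - 4 * k - 2) = 4 * T - 4 * k := by omega
    have hexp' : 4 * T - 4 * k - 2 = 4 * T + 2 - 4 * (k + 1) := by omega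
    simp only [act_sub, act_act, one_mul, mul_one, ← pow_add, P, Q, hexp]
    rw [hexp', show 4 * k + 2 + 2 = 4 * (k + 1) by ring]
  rw [sandwich, Finset.sum_congr rfl hP_sub, Finset.sum_congr rfl hQ_sub, Finset.sum_sub_distrib,
    Finset.sum_sub_distrib, Finset.sum_range_succ', Finset.sum_range_succ]
  have hP_zero : P 0 = act T q c 1 z (x T q l ^ (4 * T + 2)) := by simp [P]
  have hQ_last : Q T = act T q c' (x T q l ^ (4 * T + 2)) z' 1 := by simp [Q]
  rw [hP_zero, hQ_last]
  abel

theorem sandwich_last {l l' : ZMod 2} (h : l' ≠ l) (c c' : K) (z z' : M) {t : ℕ} (ht : t ≠ 0) :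
    sandwich T q l (act T q c (x T q l) z (x T q l' ^ t))
      (act T q c' (x T q l) z' (x T q l' ^ t)) =
    act T q c (x T q l ^ (4 * T + 1)) z (x T q l' ^ t) := by
  rw [sandwich, Finset.sum_range_succ, Finset.sum_eq_zero, Finset.sum_eq_zero, zero_add, add_zero,
    act_act, Nat.sub_self, pow_zero, mul_one, one_mul, ← pow_succ]
  · intro k hk
    have := Finset.mem_range.mp hk
    rw [act_act, x_pow_mul_x_pow T q h ht (by omega), act_zero_right]
  · intro k hk
    have := Finset.mem_range.mp hk
    rw [act_act, x_pow_mul_x_pow T q h ht (by omega), act_zero_right]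

theorem sandwich_first {l l' : ZMod 2} (h : l ≠ l') (c c' : K) (z z' : M) {t : ℕ} (ht : t ≠ 0) :
    sandwich T q l (act T q c (x T q l' ^ t) z (x T q l))
      (act T q c' (x T q l' ^ t) z' (x T q l)) =
    act T q c (x T q l' ^ t) z (x T q l ^ (4 * T + 1)) := by
  rw [sandwich, Finset.sum_range_succ', Finset.sum_eq_zero, Finset.sum_eq_zero, zero_add, add_zero,
    act_act, mul_zero, pow_zero, one_mul, one_mul, Nat.sub_zero, ← pow_succ']
  · intro k _
    rw [act_act, x_pow_mul_x_pow T q h (by omega) ht, act_zero_left]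
  · intro k _
    rw [act_act, x_pow_mul_x_pow T q h (by omega) ht, act_zero_left]

theorem act_socle_right {i k v : ZMod 4} {z : M} (hz : Fix T q i k z) {l : ZMod 2} (hl : par k = l)
    {u : ℕ} (hu : v + u = k) (a : Alg T q) :
    act T q (S q (u + 1) v) a z (x T q l ^ (4 * T + 2)) =
      -act T q (S q u v) a z (x T q (l + 1) ^ (4 * T + 2)) := by
  refine eq_neg_of_add_eq_zero_left ?_
  rw [S_succ, hu, ← hz.act_e_right, ← hz.act_e_right (S q u v), ← act_smul_right, ← act_add_right,
    ← hl, e_mul_socle_add_e_mul_socle, act_zero_right]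

theorem act_socle_left {i k : ZMod 4} {z : M} (hz : Fix T q (i + 2) k z) {l : ZMod 2}
    (hl : par i = l) (u : ℕ) (b : Alg T q) :
    act T q (S q (u + 1) i) (x T q l ^ (4 * T + 2)) z b =
      -act T q (S q u (i + 1)) (x T q (l + 1) ^ (4 * T + 2)) z b := by
  refine eq_neg_of_add_eq_zero_left ?_
  have htwo : ((4 * T + 2 : ℕ) : ZMod 4) = 2 := by
    rw [Nat.cast_add, cast_four_mul, zero_add, Nat.cast_ofNat]
  have hsocle := e_mul_x_pow T q i
  rw [S_succ', mul_comm, ← hz.act_e_left, ← hz.act_e_left (S q u (i + 1)), ← act_smul_left,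
    ← act_add_left, ← hl, ← htwo, ← hsocle, ← hsocle, e_mul_socle_add_e_mul_socle, act_zero_left]

end Sandwich

theorem d_pz_middle {m : ℕ} {i i₁ i₂ i₃ v : ZMod 4} {l : ZMod 2}
    (hl : par i = l) (h₁ : i + 1 = i₁) (h₂ : i + 2 = i₂) (h₃ : i + 3 = i₃) (hv : i + m = v) :
    d T q (2 * m + 1) (pz T q (2 * m + 2) i (m + 1)) =
      sandwich T q l
        (act T q (S q (m + 1) v) 1 (pz T q (2 * m + 1) i m) (x T q l)
          + act T q (S q (m + 1) i) (x T q l) (pz T q (2 * m + 1) i₁ (m + 1)) 1)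
        (act T q (S q (m + 1) i) 1 (pz T q (2 * m + 1) i₂ m) (x T q l)
          + act T q (S q (m + 1) v) (x T q l) (pz T q (2 * m + 1) i₃ (m + 1)) 1)
      + sandwich T q (l + 1)
        (act T q 1 1 (pz T q (2 * m + 1) i (m + 1)) (x T q (l + 1))
          + act T q 1 (x T q (l + 1)) (pz T q (2 * m + 1) i₁ m) 1)
        (act T q ((S q (m + 1) i₃)⁻¹ * S q (m + 1) (v + 3)) 1
            (pz T q (2 * m + 1) i₂ (m + 1)) (x T q (l + 1))
          + act T q ((S q (m + 1) i₃)⁻¹ * S q (m + 1) (v + 3)) (x T q (l + 1))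
            (pz T q (2 * m + 1) i₃ m) 1) := by
  subst hl h₁ h₂ h₃ hv
  have hp : ∀ n i, pz T q n i ((m : ℤ) + 1) = p T q n i (m + 1) := fun n i => by
    rw [← pz_natCast]; push_cast; rfl
  simp only [hp, pz_natCast]
  rw [d_p T q (2 * m + 1) i (m + 1) (by omega)]
  have hm : (2 * m + 1 + 1) / 2 = m + 1 := by omega
  have hmod : ¬ (2 * m + 1) % 2 = 0 := by omega
  have hv_sub : i + ((m + 1 : ℕ) : ZMod 4) - 1 = i + m := by push_cast; ring
  have hv_add : i + ((m + 1 : ℕ) : ZMod 4) + 2 = i + m + 3 := by push_cast; ring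
  simp only [dGen, hm, if_neg hmod, if_neg (Nat.succ_ne_zero m), lt_irrefl, if_true, if_false,
    hv_sub, hv_add, par_add_one, Nat.add_sub_cancel, sandwich, Finset.sum_add_distrib, act_add,
    act_act, one_mul, mul_one]
  abel

end Differential

/-! ### The differential squares to zero -/

section Complex

variable {K : Type u} [Field K] (T : ℕ) (q : ZMod 4 → K)

theorem d_d_pz_eq {n : ℕ} {i : ZMod 4} {j : ℤ} {a b : ℕ} {l k : ZMod 2}
    (hab : (2 * j < n + 1 ∧ a = 4 * T + 1 ∧ b = 1) ∨ (n + 3 < 2 * j ∧ a = 1 ∧ b = 4 * T + 1))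
    (hl : par i = l) (hk : par (i + n) = k) :
    d T q n (d T q (n + 1) (pz T q (n + 2) i j)) =
      (act T q (S q (n + 2 - j).toNat (i + j - 1)) 1 (pz T q n i (j - 1)) (x T q k ^ (4 * T + 2))
        + act T q (S q (n + 1 - j).toNat (i + j - 1)) 1 (pz T q n i (j - 1))
          (x T q (k + 1) ^ (4 * T + 2)))
      + (act T q (sign K n * (S q (n + 2 - j).toNat (i + j - 1) * S q (j - 1).toNat i))
          (x T q l ^ b) (pz T q n (i + 1) (j - 1)) (x T q k ^ a)
        - act T q (sign K n * (S q j.toNat i * S q (n + 1 - j).toNat (i + j)))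
          (x T q l ^ b) (pz T q n (i + 1) (j - 1)) (x T q k ^ a))
      - (act T q (S q j.toNat i) (x T q l ^ (4 * T + 2)) (pz T q n (i + 2) (j - 1)) 1
        + act T q (S q (j - 1).toNat (i + 1)) (x T q (l + 1) ^ (4 * T + 2))
          (pz T q n (i + 2) (j - 1)) 1) := by
  have ha : a ≠ 0 := by omega
  have hb : b ≠ 0 := by omega
  have hsum : a + b = 4 * T + 2 := by omega
  have hsum' : b + a = 4 * T + 2 := by omega
  have hl1 : par (i + 1) = l + 1 := by rw [par_add_one, hl]
  have hk1 : par (i + (n + 1 : ℕ)) = k + 1 := by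
    rw [Nat.cast_succ, ← add_assoc, par_add_one, hk]
  have hk1' : par (i + 1 + n) = k + 1 := by
    rw [add_right_comm, par_add_one, hk]
  have hi2 : i + 1 + 1 = i + 2 := by ring
  have hv : i + 1 + ((j - 1 : ℤ) : ZMod 4) - 1 = i + (j : ZMod 4) - 1 := by push_cast; ring
  have hv' : i + 1 + (j : ZMod 4) - 1 = i + j := by ring
  have hu : (n : ℤ) + 1 - (j - 1) = n + 2 - j := by ring
  have hzero {s t : ℕ} (l : ZMod 2) (hs : s ≠ 0) (ht : t ≠ 0) :
      x T q l ^ s * x T q (l + 1) ^ t = 0 :=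
    x_pow_mul_x_pow T q (add_one_ne l).symm hs ht
  have hzero' {s t : ℕ} (l : ZMod 2) (hs : s ≠ 0) (ht : t ≠ 0) :
      x T q (l + 1) ^ s * x T q l ^ t = 0 :=
    x_pow_mul_x_pow T q (add_one_ne l) hs ht
  have hsign_comm (u : ℕ) (v : ZMod 4) : S q u v * sign K n = sign K n * S q u v := mul_comm _ _
  have hsign_left_comm (u : ℕ) (v : ZMod 4) (c : K) :
      S q u v * (sign K n * c) = sign K n * (S q u v * c) := mul_left_comm _ _ _
  have hsign_cancel (c : K) : sign K n * (sign K n * c) = c := by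
    rw [← mul_assoc, sign_mul_sign, one_mul]
  rw [d_pz T q (n := n + 1) (a := a) (b := b) (by push_cast; omega) hl hk1 rfl rfl rfl
    (show ((n + 1 : ℕ) : ℤ) + 1 - j = n + 2 - j by push_cast; ring)]
  simp only [map_add, map_act]
  rw [d_pz T q (n := n) (i := i) (j := j - 1) (a := a) (b := b) (by omega) hl hk rfl rfl rfl hu,
    d_pz T q (n := n) (i := i) (j := j) (a := a) (b := b) (by omega) hl hk rfl rfl rfl rfl,
    d_pz T q (n := n) (i := i + 1) (j := j - 1) (a := a) (b := b) (by omega) hl1 hk1' hi2 hv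
      rfl hu,
    d_pz T q (n := n) (i := i + 1) (j := j) (a := a) (b := b) (by omega) hl1 hk1' hi2 hv' rfl rfl]
  simp only [act_add, act_act, one_mul, mul_one, add_one_add_one, hzero _ hb hb, hzero' _ ha ha,
    act_zero_left, act_zero_right, zero_add, add_zero, ← pow_add, hsum, hsum', sign_succ, neg_mul,
    act_neg_scalar, mul_assoc (sign K n), hsign_comm, hsign_left_comm, hsign_cancel]
  abel

theorem d_d_pz_of_ne_middle {n : ℕ} {i : ZMod 4} {j : ℤ} {a b : ℕ}
    (hab : (2 * j < n + 1 ∧ a = 4 * T + 1 ∧ b = 1) ∨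
      (n + 3 < 2 * j ∧ a = 1 ∧ b = 4 * T + 1)) :
    d T q n (d T q (n + 1) (pz T q (n + 2) i j)) = 0 := by
  rw [d_d_pz_eq T q hab rfl rfl]
  by_cases hj : 1 ≤ j ∧ j ≤ n + 1
  · obtain ⟨s, rfl⟩ : ∃ s : ℕ, j = s + 1 := ⟨(j - 1).toNat, by omega⟩
    obtain ⟨r, rfl⟩ : ∃ r : ℕ, n = s + r := ⟨n - s, by omega⟩
    have ht₁ : (((s + r : ℕ) : ℤ) + 2 - (s + 1)).toNat = r + 1 := by omega
    have ht₂ : (((s + r : ℕ) : ℤ) + 1 - (s + 1)).toNat = r := by omega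
    have ht₃ : ((s : ℤ) + 1).toNat = s + 1 := by omega
    have hv : i + (((s : ℤ) + 1 : ℤ) : ZMod 4) - 1 = i + s := by push_cast; ring
    have hv' : i + (((s : ℤ) + 1 : ℤ) : ZMod 4) = i + (s + 1 : ℕ) := by push_cast; ring
    have hcross : S q (r + 1) (i + s) * S q s i = S q (s + 1) i * S q r (i + (s + 1 : ℕ)) := by
      rw [← S_add, mul_comm, ← S_add]
      congr 1
      ring
    rw [ht₁, ht₂, ht₃, hv, hv', add_sub_cancel_right, Int.toNat_natCast, hcross, sub_self, add_zero,
      act_socle_right T q (fix_pz T q (s + r) i s) rfl (by push_cast; ring),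
      act_socle_left T q (fix_pz T q (s + r) (i + 2) s) rfl, neg_add_cancel, neg_add_cancel,
      sub_zero]
  · have hzero (i : ZMod 4) : pz T q n i (j - 1) = 0 := by
      rcases lt_or_ge j 1 with h | h
      · exact pz_of_neg T q n i (by omega)
      · exact pz_of_gt T q i (by omega)
    simp only [hzero, act_zero, add_zero, sub_zero]

theorem x_mul_x_of_ne {l l' : ZMod 2} (h : l ≠ l') : x T q l * x T q l' = 0 := by
  simpa only [pow_one] using x_pow_mul_x_pow T q h one_ne_zero one_ne_zero

theorem x_mul_x_pow_of_ne {l l' : ZMod 2} (h : l ≠ l') {t : ℕ} (ht : t ≠ 0) :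
    x T q l * x T q l' ^ t = 0 := by
  simpa only [pow_one] using x_pow_mul_x_pow T q h one_ne_zero ht

theorem x_pow_mul_x_of_ne {l l' : ZMod 2} (h : l ≠ l') {t : ℕ} (ht : t ≠ 0) :
    x T q l ^ t * x T q l' = 0 := by
  simpa only [pow_one] using x_pow_mul_x_pow T q h ht one_ne_zero

theorem d_pz_odd_left {n m : ℕ} (hn : n = 2 * m) {i i₁ v : ZMod 4} {j j' : ℤ} {l : ZMod 2}
    (hl : par i = l) (h₁ : i + 1 = i₁) (hv : i + m - 1 = v) (hj : j = m) (hj' : j - 1 = j') :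
    d T q n (pz T q (n + 1) i j) =
      act T q (S q (m + 1) v) 1 (pz T q n i j') (x T q (l + 1) ^ (4 * T + 1))
        + act T q 1 1 (pz T q n i j) (x T q l)
        - act T q (S q m i) (x T q l) (pz T q n i₁ j) 1
        - act T q 1 (x T q (l + 1) ^ (4 * T + 1)) (pz T q n i₁ j') 1 := by
  subst hn hj
  have hu : (((2 * m : ℕ) : ℤ) + 1 - m).toNat = m + 1 := by omega
  rw [d_pz T q (n := 2 * m) (j := m) (a := 4 * T + 1) (b := 1)
    (Or.inl ⟨by push_cast; omega, rfl, rfl⟩) hl ((par_add_even i m).trans hl) h₁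
    (by rw [Int.cast_natCast, hv]) hj' rfl, hu, Int.toNat_natCast, sign_even, pow_one,
    neg_one_mul, act_neg_scalar, act_neg_scalar, ← sub_eq_add_neg, ← sub_eq_add_neg]

theorem d_pz_odd_right {n m : ℕ} (hn : n = 2 * m) {i i₁ v : ZMod 4} {j j' : ℤ} {l : ZMod 2}
    (hl : par i = l) (h₁ : i + 1 = i₁) (hv : i + m = v) (hj : j = m + 1) (hj' : j - 1 = j') :
    d T q n (pz T q (n + 1) i j) =
      act T q (S q m v) 1 (pz T q n i j') (x T q (l + 1))
        + act T q 1 1 (pz T q n i j) (x T q l ^ (4 * T + 1))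
        - act T q (S q (m + 1) i) (x T q l ^ (4 * T + 1)) (pz T q n i₁ j) 1
        - act T q 1 (x T q (l + 1)) (pz T q n i₁ j') 1 := by
  subst hn hj
  have hu : (((2 * m : ℕ) : ℤ) + 1 - (m + 1)).toNat = m := by omega
  have ht : ((m : ℤ) + 1).toNat = m + 1 := by omega
  rw [d_pz T q (n := 2 * m) (j := m + 1) (a := 1) (b := 4 * T + 1)
    (Or.inr ⟨by push_cast; omega, rfl, rfl⟩) hl ((par_add_even i m).trans hl) h₁
    (v := v) (by rw [← hv]; push_cast; ring) hj' rfl, hu, ht, sign_even, pow_one, neg_one_mul,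
    act_neg_scalar, act_neg_scalar, ← sub_eq_add_neg, ← sub_eq_add_neg]

theorem d_pz_even_left {m : ℕ} {i i₁ v : ZMod 4} {l : ZMod 2} (hl : par i = l) (h₁ : i + 1 = i₁)
    (hv : i + m - 1 = v) :
    d T q (2 * m + 1) (pz T q (2 * m + 2) i m) =
      act T q (S q (m + 2) v) 1 (pz T q (2 * m + 1) i (m - 1)) (x T q l ^ (4 * T + 1))
        + act T q 1 1 (pz T q (2 * m + 1) i m) (x T q (l + 1))
        + act T q (S q m i) (x T q l) (pz T q (2 * m + 1) i₁ m) 1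
        + act T q 1 (x T q (l + 1) ^ (4 * T + 1)) (pz T q (2 * m + 1) i₁ (m - 1)) 1 := by
  have hu : (((2 * m + 1 : ℕ) : ℤ) + 1 - m).toNat = m + 2 := by omega
  rw [d_pz T q (n := 2 * m + 1) (j := m) (a := 4 * T + 1) (b := 1)
    (Or.inl ⟨by push_cast; omega, rfl, rfl⟩) hl
    ((par_add_odd i m).trans (congrArg (· + 1) hl)) h₁ (by rw [Int.cast_natCast, hv]) rfl rfl, hu,
    Int.toNat_natCast, sign_odd, pow_one, pow_one, one_mul, add_one_add_one]

theorem d_pz_even_right {m : ℕ} {i i₁ v : ZMod 4} {l : ZMod 2} (hl : par i = l) (h₁ : i + 1 = i₁)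
    (hv : i + m + 1 = v) :
    d T q (2 * m + 1) (pz T q (2 * m + 2) i (m + 2)) =
      act T q (S q m v) 1 (pz T q (2 * m + 1) i (m + 1)) (x T q l)
        + act T q 1 1 (pz T q (2 * m + 1) i (m + 2)) (x T q (l + 1) ^ (4 * T + 1))
        + act T q (S q (m + 2) i) (x T q l ^ (4 * T + 1)) (pz T q (2 * m + 1) i₁ (m + 2)) 1
        + act T q 1 (x T q (l + 1)) (pz T q (2 * m + 1) i₁ (m + 1)) 1 := by
  have hu : (((2 * m + 1 : ℕ) : ℤ) + 1 - (m + 2)).toNat = m := by omega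
  have ht : ((m : ℤ) + 2).toNat = m + 2 := by omega
  rw [d_pz T q (n := 2 * m + 1) (j := m + 2) (a := 1) (b := 4 * T + 1)
    (Or.inr ⟨by push_cast; omega, rfl, rfl⟩) hl
    ((par_add_odd i m).trans (congrArg (· + 1) hl)) h₁
    (v := v) (by rw [← hv]; push_cast; ring) (show (m : ℤ) + 2 - 1 = m + 1 by ring) rfl,
    hu, ht, sign_odd, pow_one, pow_one, one_mul,
    add_one_add_one]

theorem d_middle_left {m : ℕ} {i i₁ i₂ : ZMod 4} {l : ZMod 2} (hl : par i = l) (h₁ : i + 1 = i₁)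
    (h₂ : i + 2 = i₂) {c c' : K} (hc : c * S q m i = c' * S q m (i₁ + m)) :
    d T q (2 * m) (act T q c 1 (pz T q (2 * m + 1) i m) (x T q l)
        + act T q c' (x T q l) (pz T q (2 * m + 1) i₁ (m + 1)) 1) =
      (act T q c 1 (pz T q (2 * m) i m) (x T q l ^ 2)
        - act T q c' (x T q l ^ 2) (pz T q (2 * m) i₂ m) 1)
      + (act T q c' (x T q l) (pz T q (2 * m) i₁ (m + 1)) (x T q (l + 1) ^ (4 * T + 1))
        - act T q c (x T q (l + 1) ^ (4 * T + 1)) (pz T q (2 * m) i₁ (m - 1)) (x T q l)) := by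
  have hN : 4 * T + 1 ≠ 0 := by omega
  have hl₁ : par i₁ = l + 1 := by rw [← h₁, par_add_one, hl]
  have h₁₂ : i₁ + 1 = i₂ := by rw [← h₁, ← h₂]; ring
  rw [map_add, map_act, map_act, d_pz_odd_left T q (m := m) rfl hl h₁ rfl rfl rfl,
    d_pz_odd_right T q (m := m) rfl hl₁ h₁₂ rfl rfl (add_sub_cancel_right _ _)]
  simp only [act_add, act_sub, act_act, one_mul, mul_one, add_one_add_one, ← pow_two, one_pow, hc,
    x_mul_x_pow_of_ne T q (add_one_ne l).symm hN,
    x_pow_mul_x_of_ne T q (add_one_ne l) hN, act_zero_left, act_zero_right]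
  abel

theorem d_middle_right {m : ℕ} {i i₁ i₂ : ZMod 4} {l : ZMod 2} (hl : par i = l) (h₁ : i + 1 = i₁)
    (h₂ : i + 2 = i₂) (c : K) :
    d T q (2 * m) (act T q c 1 (pz T q (2 * m + 1) i (m + 1)) (x T q (l + 1))
        + act T q c (x T q (l + 1)) (pz T q (2 * m + 1) i₁ m) 1) =
      (act T q (c * S q m (i + m)) 1 (pz T q (2 * m) i m) (x T q (l + 1) ^ 2)
        - act T q (c * S q m i₁) (x T q (l + 1) ^ 2) (pz T q (2 * m) i₂ m) 1)
      + (act T q (c * S q (m + 1) (i + m)) (x T q (l + 1)) (pz T q (2 * m) i₁ (m - 1))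
          (x T q l ^ (4 * T + 1))
        - act T q (c * S q (m + 1) i) (x T q l ^ (4 * T + 1)) (pz T q (2 * m) i₁ (m + 1))
          (x T q (l + 1))) := by
  have hN : 4 * T + 1 ≠ 0 := by omega
  have hl₁ : par i₁ = l + 1 := by rw [← h₁, par_add_one, hl]
  have h₁₂ : i₁ + 1 = i₂ := by rw [← h₁, ← h₂]; ring
  have hv : i₁ + (m : ZMod 4) - 1 = i + m := by rw [← h₁]; ring
  rw [map_add, map_act, map_act, d_pz_odd_right T q (m := m) rfl hl h₁ rfl rfl
      (add_sub_cancel_right _ _),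
    d_pz_odd_left T q (m := m) rfl hl₁ h₁₂ hv rfl rfl]
  simp only [act_add, act_sub, act_act, one_mul, mul_one, add_one_add_one, ← pow_two, one_pow,
    x_mul_x_pow_of_ne T q (add_one_ne l) hN,
    x_pow_mul_x_of_ne T q (add_one_ne l).symm hN, act_zero_left, act_zero_right]
  abel

theorem S_mul_S_comm (r s : ℕ) {i v w : ZMod 4} (hv : i + s = v) (hw : i + (s + 1 : ℕ) = w) :
    S q (r + 1) v * S q s i = S q (s + 1) i * S q r w := by
  subst hv hw
  rw [← S_add, mul_comm, ← S_add]
  congr 1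
  ring

variable {q} in
theorem S_mul_S_middle (hq : ∀ i, q i ≠ 0) (m : ℕ) (i : ZMod 4) :
    S q (m + 1) i * S q m (i + 2) = S q (m + 1) (i + m) * S q m (i + 3 + m) := by
  have h := S_mul_S_add_two hq m i
  have hleft : S q (m + 1) (i + 2) = S q m (i + 2) * q (i + m + 2) := by
    rw [S_succ, add_right_comm]
  have hright : S q (m + 1) (i + m + 2) = q (i + m + 2) * S q m (i + 3 + m) := by
    rw [S_succ']
    congr 2
    ring
  rw [hleft, hright] at h
  exact mul_right_cancel₀ (hq (i + m + 2)) (by linear_combination h)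

variable {q} in
theorem inv_S_mul_S_mul_S (hq : ∀ i, q i ≠ 0) (m : ℕ) (i : ZMod 4) :
    (S q (m + 1) (i + 3))⁻¹ * S q (m + 1) (i + m + 3) * S q m (i + 3) = S q m (i + m) := by
  have hleft : S q (m + 1) (i + 3) = S q m (i + 3) * q (i + m + 3) := by
    rw [S_succ, add_right_comm]
  have hright : S q (m + 1) (i + m + 3) = q (i + m + 3) * S q m (i + m) := by
    rw [S_succ', show i + (m : ZMod 4) + 3 + 1 = i + m + 4 by ring, add_four]
  rw [inv_mul_eq_div, div_mul_eq_mul_div, div_eq_iff (S_ne_zero hq _ _), hleft, hright]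
  ring

variable {q} in
theorem inv_S_mul_S_add (hq : ∀ i, q i ≠ 0) (m : ℕ) (i : ZMod 4) :
    (S q (m + 1) (i + 3))⁻¹ * S q (m + 1) (i + m + 3) =
      S q (m + 1) (i + 1) * (S q (m + 1) (i + (m + 1 : ℕ)))⁻¹ := by
  have h := S_mul_S_add_two hq m (i + 1)
  have hi : i + 1 + 2 = i + 3 := by ring
  have hv : i + 1 + (m : ZMod 4) = i + (m + 1 : ℕ) := by push_cast; ring
  have hv' : i + ((m + 1 : ℕ) : ZMod 4) + 2 = i + m + 3 := by push_cast; ring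
  rw [hi, hv, hv'] at h
  rw [inv_mul_eq_div, ← div_eq_mul_inv,
    div_eq_div_iff (S_ne_zero hq _ _) (S_ne_zero hq _ _), mul_comm, ← h]

variable {q} in
theorem inv_S_mul_S_mul_S' (hq : ∀ i, q i ≠ 0) (m : ℕ) (i : ZMod 4) :
    (S q (m + 1) (i + 3))⁻¹ * S q (m + 1) (i + m + 3) * S q m (i + 2 + m) = S q m (i + 1) := by
  have hleft : S q (m + 1) (i + (m + 1 : ℕ)) = q (i + (m + 1 : ℕ)) * S q m (i + 2 + m) := by
    rw [S_succ']
    congr 2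
    push_cast
    ring
  have hright : S q (m + 1) (i + 1) = S q m (i + 1) * q (i + (m + 1 : ℕ)) := by
    rw [S_succ]
    congr 2
    push_cast
    ring
  rw [inv_S_mul_S_add hq, mul_right_comm, ← div_eq_mul_inv, div_eq_iff (S_ne_zero hq _ _), hleft,
    hright]
  ring

theorem d_d_pz_middle (hq : ∀ i, q i ≠ 0) (m : ℕ) (i : ZMod 4) :
    d T q (2 * m) (d T q (2 * m + 1) (pz T q (2 * m + 2) i (m + 1))) = 0 := by
  obtain ⟨l, hl⟩ : ∃ l, par i = l := ⟨_, rfl⟩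
  have hN : 4 * T + 1 ≠ 0 := by omega
  have hl2 : par (i + 2) = l := by rw [par_add_two, hl]
  have h23 : i + 2 + 1 = i + 3 := by ring
  have h24 : i + 2 + 2 = i := by rw [add_assoc]; exact add_four i
  have hcross : S q (m + 1) (i + m) * S q m i = S q (m + 1) i * S q m (i + 1 + m) :=
    S_mul_S_comm q m m rfl (by push_cast; ring)
  rw [d_pz_middle T q hl rfl rfl rfl rfl, map_add, map_sandwich, map_sandwich,
    d_middle_left T q hl rfl rfl hcross, d_middle_left T q hl2 h23 h24 (S_mul_S_middle hq m i),
    d_middle_right T q hl rfl rfl, d_middle_right T q hl2 h23 h24, inv_S_mul_S_mul_S hq,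
    inv_S_mul_S_mul_S' hq, sandwich_add, sandwich_add, one_mul, one_mul, one_mul, one_mul,
    sandwich_telescope, sandwich_telescope, sandwich_sub, sandwich_sub,
    sandwich_last T q (add_one_ne l) _ _ _ _ hN,
    sandwich_last T q (add_one_ne l).symm _ _ _ _ hN,
    sandwich_first T q (add_one_ne l) _ _ _ _ hN,
    sandwich_first T q (add_one_ne l).symm _ _ _ _ hN,
    act_socle_right T q (fix_pz T q (2 * m) i m) ((par_add_even i m).trans hl)
      (by push_cast; ring),
    act_socle_left T q (fix_pz T q (2 * m) (i + 2) m) hl]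
  abel

theorem d_d_pz_below_middle (hq : ∀ i, q i ≠ 0) (m : ℕ) (i : ZMod 4) :
    d T q (2 * m + 1) (d T q (2 * m + 2) (pz T q (2 * m + 3) i (m + 1))) = 0 := by
  obtain ⟨l, hl⟩ : ∃ l, par i = l := ⟨_, rfl⟩
  have hN : 4 * T + 1 ≠ 0 := by omega
  have hl1 : par (i + 1) = l + 1 := by rw [par_add_one, hl]
  have h12 : i + 1 + 1 = i + 2 := by ring
  have h13 : i + 1 + 2 = i + 3 := by ring
  have h14 : i + 1 + 3 = i := by rw [add_assoc]; exact add_four i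
  have hv : i + ((m + 1 : ℕ) : ZMod 4) - 1 = i + m := by push_cast; ring
  have hv1 : i + 1 + (m : ZMod 4) = i + (m + 1 : ℕ) := by push_cast; ring
  have hv1' : i + 1 + (m : ZMod 4) - 1 = i + m := by ring
  have hv3 : i + ((m + 1 : ℕ) : ZMod 4) + 3 = i + m := by
    rw [show i + ((m + 1 : ℕ) : ZMod 4) + 3 = i + m + 4 by push_cast; ring, add_four]
  have hpar : par (i + (2 * m + 1 : ℕ)) = l + 1 := by rw [par_add_odd, hl]
  rw [d_pz_odd_left T q (m := m + 1) (by ring) hl rfl hv (by push_cast; rfl)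
    (add_sub_cancel_right _ _)]
  simp only [map_add, map_sub, map_act]
  rw [d_pz_middle T q hl rfl rfl rfl rfl, d_pz_middle T q hl1 h12 h13 h14 hv1,
    d_pz_even_left T q hl rfl rfl, d_pz_even_left T q hl1 h12 hv1', hv3]
  simp only [add_one_add_one, act_add (b := x T q l), act_add (a := x T q l) (b := 1)]
  rw [act_sandwich_right, act_sandwich_right_of_ne T q _ (add_one_ne l), act_sandwich_left,
    act_sandwich_left_of_ne T q _ (add_one_ne l).symm]
  simp only [act_add, act_act, one_mul, mul_one, ← pow_two, one_pow, ← pow_succ, ← pow_succ',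
    x_mul_x_of_ne T q (add_one_ne l), x_mul_x_of_ne T q (add_one_ne l).symm,
    x_pow_mul_x_pow T q (add_one_ne l) hN hN, x_pow_mul_x_pow T q (add_one_ne l).symm hN hN,
    act_zero_left, act_zero_right, zero_add, add_zero]
  have htelescope := sandwich_telescope T q l (S q (m + 1) (i + m)) (S q (m + 1) i)
    (pz T q (2 * m + 1) i m) (pz T q (2 * m + 1) (i + 2) m)
  rw [sandwich_sub, sub_eq_iff_eq_add] at htelescope
  rw [mul_inv_cancel_left₀ (S_ne_zero hq _ _), sandwich_add, sandwich_add, htelescope,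
    S_mul_S_comm q (m + 1) m rfl rfl,
    act_socle_right T q (u := m + 1) (fix_pz T q (2 * m + 1) i m) hpar (by push_cast; ring),
    act_socle_left T q (fix_pz T q (2 * m + 1) (i + 2) m) hl, add_one_add_one]
  abel

theorem d_d_pz_above_middle (hq : ∀ i, q i ≠ 0) (m : ℕ) (i : ZMod 4) :
    d T q (2 * m + 1) (d T q (2 * m + 2) (pz T q (2 * m + 3) i (m + 2))) = 0 := by
  obtain ⟨l, hl⟩ : ∃ l, par i = l := ⟨_, rfl⟩
  have hN : 4 * T + 1 ≠ 0 := by omega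
  have hl1 : par (i + 1) = l + 1 := by rw [par_add_one, hl]
  have h12 : i + 1 + 1 = i + 2 := by ring
  have h13 : i + 1 + 2 = i + 3 := by ring
  have h14 : i + 1 + 3 = i := by rw [add_assoc]; exact add_four i
  have hv : i + (m : ZMod 4) + 1 = i + (m + 1 : ℕ) := by push_cast; ring
  have hv1 : i + 1 + (m : ZMod 4) = i + (m + 1 : ℕ) := by push_cast; ring
  have hv1' : i + 1 + (m : ZMod 4) + 1 = i + (m + 2 : ℕ) := by push_cast; ring
  have hv3 : i + ((m + 1 : ℕ) : ZMod 4) + 3 = i + m := by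
    rw [show i + ((m + 1 : ℕ) : ZMod 4) + 3 = i + m + 4 by push_cast; ring, add_four]
  have hpar : par (i + (2 * m + 1 : ℕ)) = l + 1 := by rw [par_add_odd, hl]
  rw [d_pz_odd_right T q (m := m + 1) (by ring) hl rfl rfl (by push_cast; ring)
    (show (m : ℤ) + 2 - 1 = m + 1 by ring)]
  simp only [map_add, map_sub, map_act]
  rw [d_pz_middle T q hl rfl rfl rfl rfl, d_pz_middle T q hl1 h12 h13 h14 hv1,
    d_pz_even_right T q hl rfl hv, d_pz_even_right T q hl1 h12 hv1', hv3]
  simp only [add_one_add_one, act_add (b := x T q (l + 1)), act_add (a := x T q (l + 1)) (b := 1)]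
  rw [act_sandwich_right_of_ne T q _ (add_one_ne l).symm, act_sandwich_right,
    act_sandwich_left, act_sandwich_left_of_ne T q _ (add_one_ne l)]
  simp only [act_add, act_act, one_mul, mul_one, ← pow_two, one_pow, ← pow_succ, ← pow_succ',
    x_mul_x_of_ne T q (add_one_ne l), x_mul_x_of_ne T q (add_one_ne l).symm,
    x_pow_mul_x_pow T q (add_one_ne l) hN hN, x_pow_mul_x_pow T q (add_one_ne l).symm hN hN,
    act_zero_left, act_zero_right, zero_add, add_zero]
  have htelescope := sandwich_telescope T q (l + 1) (S q (m + 1) (i + (m + 1 : ℕ)))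
    (S q (m + 1) (i + 1)) (pz T q (2 * m + 1) i (m + 1)) (pz T q (2 * m + 1) (i + 2) (m + 1))
  rw [sandwich_sub, sub_eq_iff_eq_add] at htelescope
  rw [inv_S_mul_S_add hq, mul_comm (S q (m + 1) (i + 1)), mul_inv_cancel_left₀ (S_ne_zero hq _ _),
    sandwich_add, sandwich_add, htelescope, S_mul_S_comm q m (m + 1) rfl rfl]
  have hright := act_socle_right T q (u := m) (fix_pz T q (2 * m + 1) i (m + 1)) hpar
    (v := i + (m + 1 : ℕ)) (by push_cast; ring) 1
  rw [hright,
    act_socle_left T q (fix_pz T q (2 * m + 1) (i + 2) (m + 1)) hl, add_one_add_one]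
  abel

theorem d_d_pz (hq : ∀ i, q i ≠ 0) (n : ℕ) (i : ZMod 4) (j : ℤ) :
    d T q n (d T q (n + 1) (pz T q (n + 2) i j)) = 0 := by
  by_cases hbelow : 2 * j < n + 1
  · exact d_d_pz_of_ne_middle T q (Or.inl ⟨hbelow, rfl, rfl⟩)
  by_cases habove : n + 3 < 2 * j
  · exact d_d_pz_of_ne_middle T q (Or.inr ⟨habove, rfl, rfl⟩)
  rcases Nat.even_or_odd' n with ⟨m, rfl | rfl⟩
  · obtain rfl : j = m + 1 := by push_cast at hbelow habove; omega
    exact d_d_pz_middle T q hq m i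
  · have hj : j = m + 1 ∨ j = m + 2 := by push_cast at hbelow habove; omega
    rcases hj with rfl | rfl
    · exact d_d_pz_below_middle T q hq m i
    · exact d_d_pz_above_middle T q hq m i

variable {T q} in
theorem Bim.induction {i k : ZMod 4} {motive : Bim T q i k → Prop} (z : Bim T q i k)
    (zero : motive 0) (add : ∀ z w, motive z → motive w → motive (z + w))
    (gen : ∀ a b : Alg T q, motive (act T q 1 a (Bim.gen T q i k) b)) : motive z := by
  refine TensorProduct.induction_on (motive := motive) z zero ?_ add
  rintro ⟨u, hu⟩ ⟨v, hv⟩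
  obtain ⟨a, rfl⟩ := Submodule.mem_span_singleton.mp hu
  obtain ⟨b, rfl⟩ := Submodule.mem_span_singleton.mp hv
  have h := gen a (unop b)
  rw [act, one_smul, op_unop] at h
  exact h

variable {T q} in
theorem R.induction {n : ℕ} {motive : R T q n → Prop} (r : R T q n) (zero : motive 0)
    (add : ∀ r s, motive r → motive s → motive (r + s))
    (gen : ∀ (a b : Alg T q) (i : ZMod 4) (j : ℕ), j ≤ n → motive (act T q 1 a (p T q n i j) b)) :
    motive r := by
  induction r using DirectSum.induction_on with
  | zero => exact zero
  | add r s hr hs => exact add r s hr hs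
  | of ij z =>
    obtain ⟨i, j⟩ := ij
    induction z using Bim.induction with
    | zero => rw [map_zero]; exact zero
    | add z w hz hw => rw [map_add]; exact add _ _ hz hw
    | gen a b =>
      have h := gen a b i j (by omega)
      rw [p, dif_pos j.2, ← map_act] at h
      exact h

theorem d_d (hq : ∀ i, q i ≠ 0) (n : ℕ) (r : R T q (n + 2)) : d T q n (d T q (n + 1) r) = 0 := by
  induction r using R.induction with
  | zero => rw [map_zero, map_zero]
  | add r s hr hs => rw [map_add, map_add, hr, hs, add_zero]
  | gen a b i j _ =>
    rw [map_act, map_act, ← pz_natCast, d_d_pz T q hq, act_zero]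

end Complex

/-! ### Filtrations -/

section Filtrations

variable {K : Type u} [Field K] (T : ℕ) (q : ZMod 4 → K)

section LeftFiltration

variable (M : Type u) [AddCommGroup M] [Module (Env T q) M]

/-- The filtration of a bimodule by left multiples of powers `x_l^a` with `k ≤ a`. -/
def leftFiltration (k : ℕ) : AddSubgroup M :=
  AddSubgroup.closure {z | ∃ (l : ZMod 2) (a : ℕ) (r : M), k ≤ a ∧ z = act T q 1 (x T q l ^ a) r 1}

theorem leftFiltration_zero : leftFiltration T q M 0 = ⊤ := by
  refine eq_top_iff.mpr fun z _ => AddSubgroup.subset_closure ⟨0, 0, z, le_rfl, ?_⟩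
  rw [pow_zero, act_one]

variable {q} in
theorem leftFiltration_eq_bot (hq : ∀ i, q i ≠ 0) : leftFiltration T q M (4 * T + 3) = ⊥ := by
  rw [leftFiltration, AddSubgroup.closure_eq_bot_iff]
  rintro z ⟨l, a, r, ha, rfl⟩
  rw [x_pow_eq_zero T q hq l ha, act_zero_left]
  rfl

variable {M}

theorem act_mem_leftFiltration (c : K) (l : ZMod 2) {k a : ℕ} (h : k ≤ a) (r : M) (b : Alg T q) :
    act T q c (x T q l ^ a) r b ∈ leftFiltration T q M k := by
  refine AddSubgroup.subset_closure ⟨l, a, act T q c 1 r b, h, ?_⟩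
  rw [act_act, one_mul, mul_one, mul_one]

theorem act_mem_leftFiltration_one (c : K) (l : ZMod 2) (r : M) (b : Alg T q) :
    act T q c (x T q l) r b ∈ leftFiltration T q M 1 := by
  simpa using act_mem_leftFiltration T q c l (le_refl 1) r b

theorem act_right_mem {k : ℕ} {z : M} (hz : z ∈ leftFiltration T q M k) (c : K) (b : Alg T q) :
    act T q c 1 z b ∈ leftFiltration T q M k := by
  induction hz using AddSubgroup.closure_induction with
  | mem z hz =>
    obtain ⟨l, a, r, ha, rfl⟩ := hz
    rw [act_act, one_mul]
    exact act_mem_leftFiltration T q _ l ha r _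
  | zero => rw [act_zero]; exact zero_mem _
  | add z w _ _ hz hw => rw [act_add]; exact add_mem hz hw
  | neg z _ hz => rw [act_neg]; exact neg_mem hz

theorem act_left_mem {z : M} (hz : z ∈ leftFiltration T q M 1) (l : ZMod 2) (a : ℕ) :
    act T q 1 (x T q l ^ a) z 1 ∈ leftFiltration T q M (a + 1) := by
  induction hz using AddSubgroup.closure_induction with
  | mem z hz =>
    obtain ⟨l', b, r, hb, rfl⟩ := hz
    rw [act_act]
    simp only [mul_one]
    rcases Nat.eq_zero_or_pos a with rfl | ha
    · rw [pow_zero, one_mul]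
      exact act_mem_leftFiltration T q 1 l' (by omega) r 1
    by_cases h : l = l'
    · subst h
      rw [← pow_add]
      exact act_mem_leftFiltration T q 1 l (by omega) r 1
    · rw [x_pow_mul_x_pow T q h (by omega) (by omega), act_zero_left]
      exact zero_mem _
  | zero => rw [act_zero]; exact zero_mem _
  | add z w _ _ hz hw => rw [act_add]; exact add_mem hz hw
  | neg z _ hz => rw [act_neg]; exact neg_mem hz

theorem leftFiltration_anti {k k' : ℕ} (h : k ≤ k') :
    leftFiltration T q M k' ≤ leftFiltration T q M k := by
  refine AddSubgroup.closure_mono ?_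
  rintro z ⟨l, a, r, ha, rfl⟩
  exact ⟨l, a, r, h.trans ha, rfl⟩

theorem act_e_left_mem {s : ℕ} {z : M} (hz : z ∈ leftFiltration T q M s) (c : K) (k : ZMod 4) :
    act T q c (e T q k) z 1 ∈ leftFiltration T q M s := by
  induction hz using AddSubgroup.closure_induction with
  | mem z hz =>
    obtain ⟨l, a, r, ha, rfl⟩ := hz
    refine AddSubgroup.subset_closure ⟨l, a, act T q c (e T q (k + a)) r 1, ha, ?_⟩
    rw [act_act, act_act, e_mul_x_pow, mul_one, one_mul, one_mul]
  | zero => rw [act_zero]; exact zero_mem _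
  | add z w _ _ hz hw => rw [act_add]; exact add_mem hz hw
  | neg z _ hz => rw [act_neg]; exact neg_mem hz

theorem act_left_mem_one {z : M} (hz : z ∈ leftFiltration T q M 1) (a : Alg T q) :
    act T q 1 a z 1 ∈ leftFiltration T q M 1 := by
  induction a using Alg.induction with
  | zero => rw [act_zero_left]; exact zero_mem _
  | add a b ha hb => rw [act_add_left]; exact add_mem ha hb
  | mono c k l t =>
    have h := act_e_left_mem T q
      (leftFiltration_anti T q (Nat.succ_le_succ t.zero_le) (act_left_mem T q hz l t)) c k
    rwa [act_act, mul_one, mul_one, act_eq_smul_left] at h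

theorem sandwich_sub_mem (l : ZMod 2) (A B : M) :
    sandwich T q l A B - act T q 1 1 A (x T q l ^ (4 * T)) ∈ leftFiltration T q M 1 := by
  rw [sandwich, Finset.sum_range_succ', mul_zero, pow_zero, Nat.sub_zero, add_sub_right_comm,
    add_sub_cancel_right]
  refine add_mem (sum_mem fun k _ => ?_) (sum_mem fun k _ => ?_)
  · exact act_mem_leftFiltration T q 1 l (by omega) _ _
  · exact act_mem_leftFiltration T q 1 l (by omega) _ _

end LeftFiltration

theorem d_pz_middle_sub_mem {m : ℕ} {i : ZMod 4} {k : ZMod 2} (hk : par i = k + 1) :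
    d T q (2 * m + 1) (pz T q (2 * m + 2) i (m + 1))
      - (act T q (S q (m + 1) (i + m)) 1 (pz T q (2 * m + 1) i m) (x T q (k + 1) ^ (4 * T + 1))
        + act T q 1 1 (pz T q (2 * m + 1) i (m + 1)) (x T q k ^ (4 * T + 1)))
      ∈ leftFiltration T q (R T q (2 * m + 1)) 1 := by
  have sandwich_mem (l : ZMod 2) (c c' : K) (z z' B : R T q (2 * m + 1)) :
      sandwich T q l (act T q c 1 z (x T q l) + act T q c' (x T q l) z' 1) B
        - act T q c 1 z (x T q l ^ (4 * T + 1)) ∈ leftFiltration T q (R T q (2 * m + 1)) 1 := by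
    have hA := sandwich_sub_mem T q l (act T q c 1 z (x T q l) + act T q c' (x T q l) z' 1) B
    rw [act_add, act_act, act_act, one_mul, one_mul, one_mul, one_mul, one_mul, ← pow_succ',
      ← sub_sub] at hA
    have hsum := add_mem hA (act_mem_leftFiltration_one T q c' l z' (x T q l ^ (4 * T)))
    rwa [sub_add_cancel] at hsum
  rw [d_pz_middle T q hk rfl rfl rfl rfl, add_one_add_one, add_sub_add_comm]
  exact add_mem (sandwich_mem _ _ _ _ _ _) (sandwich_mem _ _ _ _ _ _)

/-- The exponents of `x` in the recursion for `g^{n+1}_{i,j}`: `a` goes with `g^n_{i,j-1}` and `b`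
with `g^n_{i,j}`, and only the middle column `2j = n + 1` has two long exponents. -/
abbrev IsExponentPair (T n : ℕ) (j : ℤ) (a b : ℕ) : Prop :=
  (2 * j < n + 1 ∧ a = 4 * T + 1 ∧ b = 1) ∨
    (2 * j = n + 1 ∧ a = 4 * T + 1 ∧ b = 4 * T + 1) ∨ (n + 1 < 2 * j ∧ a = 1 ∧ b = 4 * T + 1)

theorem exists_isExponentPair (T n : ℕ) (j : ℤ) : ∃ a b : ℕ, IsExponentPair T n j a b :=
  ⟨if 2 * j ≤ n + 1 then 4 * T + 1 else 1, if 2 * j < n + 1 then 1 else 4 * T + 1,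
    by split_ifs <;> omega⟩

theorem d_pz_sub_mem {n : ℕ} {i : ZMod 4} {j : ℤ} {a b : ℕ} {k : ZMod 2} (hk : par (i + n) = k)
    (hab : IsExponentPair T n j a b) :
    d T q n (pz T q (n + 1) i j)
      - (act T q (S q (n + 1 - j).toNat (i + j - 1)) 1 (pz T q n i (j - 1)) (x T q (k + 1) ^ a)
        + act T q 1 1 (pz T q n i j) (x T q k ^ b)) ∈ leftFiltration T q (R T q n) 1 := by
  by_cases hm : 2 * j = n + 1
  · obtain ⟨rfl, rfl⟩ : a = 4 * T + 1 ∧ b = 4 * T + 1 := by omega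
    obtain ⟨m, rfl⟩ : ∃ m : ℕ, n = 2 * m + 1 := ⟨(j - 1).toNat, by omega⟩
    obtain rfl : j = m + 1 := by push_cast at hm; omega
    have hu : (((2 * m + 1 : ℕ) : ℤ) + 1 - (m + 1)).toNat = m + 1 := by omega
    have hv : i + (((m : ℤ) + 1 : ℤ) : ZMod 4) - 1 = i + m := by push_cast; ring
    have hl : par i = k + 1 := by rw [← hk, par_add_odd, add_one_add_one]
    rw [hu, hv, add_sub_cancel_right]
    exact d_pz_middle_sub_mem T q hl
  · have hab' : (2 * j < n + 1 ∧ a = 4 * T + 1 ∧ b = 1) ∨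
        (n + 1 < 2 * j ∧ a = 1 ∧ b = 4 * T + 1) := by omega
    rw [d_pz T q hab' rfl hk rfl rfl rfl rfl, add_assoc, add_sub_cancel_left]
    exact add_mem (act_mem_leftFiltration T q _ _ (by omega) _ _)
      (act_mem_leftFiltration T q _ _ (by omega) _ _)

theorem d_act_pz_sub_mem {n : ℕ} {i : ZMod 4} {j : ℤ} {a b : ℕ} {k : ZMod 2}
    (hk : par (i + n) = k)
    (hab : IsExponentPair T n j a b) (c : K) (w : Alg T q) :
    d T q n (act T q c 1 (pz T q (n + 1) i j) w)
      - (act T q (c * S q (n + 1 - j).toNat (i + j - 1)) 1 (pz T q n i (j - 1))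
          (x T q (k + 1) ^ a * w)
        + act T q c 1 (pz T q n i j) (x T q k ^ b * w)) ∈ leftFiltration T q (R T q n) 1 := by
  have h := act_right_mem T q (d_pz_sub_mem T q hk hab) c w
  rw [act_sub, act_add, act_act, act_act, one_mul, mul_one] at h
  rwa [map_act]

end Filtrations

/-! ### The homotopy -/

section Homotopy

variable {K : Type u} [Field K] (T : ℕ) (q : ZMod 4 → K)

/-- The map `a ⊗ b ↦ a ⊗ D b` on the enveloping algebra. -/
def envMap (D : Alg T q →ₗ[K] Alg T q) : Env T q →ₗ[K] Env T q :=
  TensorProduct.map LinearMap.id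
    ((opLinearEquiv K).toLinearMap ∘ₗ D ∘ₗ (opLinearEquiv K).symm.toLinearMap)

theorem envMap_tmul (D : Alg T q →ₗ[K] Alg T q) (a b : Alg T q) :
    envMap T q D (a ⊗ₜ[K] op b) = a ⊗ₜ[K] op (D b) := rfl

section Component

variable {M : Type u} [AddCommGroup M] [Module (Env T q) M]

/-- The additive map `A e_i ⊗ e_k A → M`, `u ⊗ v ↦ u m D(v)`; the summands of the homotopy have this
form. -/
def stripComponent (D : Alg T q →ₗ[K] Alg T q) (m : M) (i k : ZMod 4) : Bim T q i k →+ M where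
  toFun z := envMap T q D (Bim.incl T q i k z) • m
  map_zero' := by
    rw [map_zero]
    exact (congrArg (· • m) (map_zero (envMap T q D))).trans (zero_smul (Env T q) m)
  map_add' z w := by
    rw [map_add]
    exact (congrArg (· • m) (map_add (envMap T q D) _ _)).trans (add_smul (R := Env T q) _ _ m)

theorem incl_act_gen (i k : ZMod 4) (a b : Alg T q) :
    Bim.incl T q i k (act T q 1 a (Bim.gen T q i k) b) =
      (a * e T q i) ⊗ₜ[K] op (e T q k * b) := by
  have h : Bim.incl T q i k (Bim.gen T q i k) = e T q i ⊗ₜ[K] op (e T q k) := rfl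
  rw [map_act, act, one_smul, h, smul_eq_mul, Algebra.TensorProduct.tmul_mul_tmul, op_mul]

theorem stripComponent_act (D : Alg T q →ₗ[K] Alg T q) (m : M) (i k : ZMod 4) (a b : Alg T q) :
    stripComponent T q D m i k (act T q 1 a (Bim.gen T q i k) b) =
      act T q 1 (a * e T q i) m (D (e T q k * b)) := by
  change envMap T q D (Bim.incl T q i k _) • m = _
  rw [incl_act_gen, envMap_tmul, act, one_smul]

end Component

variable {n : ℕ} {i : ZMod 4} {j : ℤ} {k : ZMod 2}

theorem act_e_mul_pz {k : ZMod 4} (hk : i + n = k) (c : K) (a b : Alg T q) :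
    act T q c a (pz T q n i j) (e T q k * b) = act T q c a (pz T q n i j) b := by
  subst hk
  exact (fix_pz T q n i j).act_e_right c a b

theorem act_pz_socle (hk : par (i + n) = k) (c : K) :
    act T q c 1 (pz T q n i j) (x T q (k + 1) ^ (4 * T + 2)) =
      act T q (-(c * q (i + n))) 1 (pz T q n i j) (x T q k ^ (4 * T + 2)) := by
  have hunit := act_socle_right T q (fix_pz T q n i j) hk (u := 0)
    (by rw [Nat.cast_zero, add_zero]) 1
  have h := congrArg (act T q c 1 · 1) hunit
  simp only [S_zero, S_one, zero_add, ← act_neg_scalar, act_act, mul_one, mul_neg] at h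
  rw [act_neg_scalar, h, act_neg_scalar, neg_neg]

theorem act_pz_socle' (hq : ∀ i, q i ≠ 0) (hk : par (i + n) = k) (c : K) :
    act T q c 1 (pz T q n i j) (x T q k ^ (4 * T + 2)) =
      act T q (-(c * (q (i + n))⁻¹)) 1 (pz T q n i j) (x T q (k + 1) ^ (4 * T + 2)) := by
  rw [act_pz_socle T q hk]
  congr 1
  rw [neg_mul, neg_neg, inv_mul_cancel_right₀ (hq _)]

variable (hq : ∀ i, q i ≠ 0)

/-- The contracting homotopy `R^n → R^{n+1}` up to the left filtration. It is left `A`-linear, and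
on the right of `𝔭^n_{i,j}` it strips the letter by which `∂^{n+1}` multiplies `𝔭^n_{i,j}` in the
images of `𝔭^{n+1}_{i,j}` and `𝔭^{n+1}_{i,j+1}`. When `2j = n` the element `x_l^{4T+2}` could be
stripped for both letters, and is stripped only for one of them; when `2j = n + 1` the map
`lastCoeff` accounts for the power `x_l^{4T+1}` in the image of `𝔭^{n+1}_{i,j}`. In the lemmas on
its values, the letter `x_{i+n}` is called near and `x_{i+n+1}` is called far. -/
def homotopy (n : ℕ) : R T q n →+ R T q (n + 1) :=
  DirectSum.toAddMonoid fun ij =>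
    (if 2 * (ij.2 : ℕ) ≤ n then
      stripComponent T q (strip T q hq (par (ij.1 + n)) (4 * T + 2)) (p T q (n + 1) ij.1 ij.2) _ _
      else 0)
    + (if n ≤ 2 * (ij.2 : ℕ) then
      stripComponent T q
        (strip T q hq (par (ij.1 + n) + 1) (if 2 * (ij.2 : ℕ) = n then 4 * T + 1 else 4 * T + 2))
        (act T q (S q (n - ij.2) (ij.1 + (ij.2 : ℕ)))⁻¹ 1 (p T q (n + 1) ij.1 (ij.2 + 1)) 1) _ _
      else 0)
    + (if 2 * (ij.2 : ℕ) = n + 1 then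
      stripComponent T q (lastCoeff T q hq (par (ij.1 + n))) (p T q (n + 1) ij.1 ij.2) _ _ else 0)

theorem homotopy_act_p {n j : ℕ} (hj : j ≤ n) (i : ZMod 4) (a b : Alg T q) :
    homotopy T q hq n (act T q 1 a (p T q n i j) b) =
      (if 2 * j ≤ n then
        act T q 1 a (p T q (n + 1) i j)
          (strip T q hq (par (i + n)) (4 * T + 2) (e T q (i + n) * b)) else 0)
      + (if n ≤ 2 * j then
        act T q (S q (n - j) (i + j))⁻¹ a (p T q (n + 1) i (j + 1))
          (strip T q hq (par (i + n) + 1) (if 2 * j = n then 4 * T + 1 else 4 * T + 2)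
            (e T q (i + n) * b)) else 0)
      + (if 2 * j = n + 1 then
        act T q 1 a (p T q (n + 1) i j) (lastCoeff T q hq (par (i + n)) (e T q (i + n) * b))
        else 0) := by
  rw [p, dif_pos (by omega), ← map_act]
  erw [DirectSum.toAddMonoid_of]
  have hite : ∀ (P : Prop) [Decidable P] (f : Bim T q i (i + n) →+ R T q (n + 1))
      (z : Bim T q i (i + n)), (if P then f else 0) z = if P then f z else 0 := by
    intro P _ f z
    split_ifs <;> rfl
  simp only [AddMonoidHom.add_apply, hite, stripComponent_act]
  simp only [(fix_p T q (n + 1) i _).act_e_left, act_act, one_mul, mul_one]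

theorem homotopy_act_pz (n : ℕ) (i : ZMod 4) (j : ℤ) (a b : Alg T q) :
    homotopy T q hq n (act T q 1 a (pz T q n i j) b) =
      (if 2 * j ≤ n then
        act T q 1 a (pz T q (n + 1) i j)
          (strip T q hq (par (i + n)) (4 * T + 2) (e T q (i + n) * b)) else 0)
      + (if n ≤ 2 * j then
        act T q (S q (n - j).toNat (i + j))⁻¹ a (pz T q (n + 1) i (j + 1))
          (strip T q hq (par (i + n) + 1) (if 2 * j = n then 4 * T + 1 else 4 * T + 2)
            (e T q (i + n) * b)) else 0)
      + (if 2 * j = n + 1 then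
        act T q 1 a (pz T q (n + 1) i j) (lastCoeff T q hq (par (i + n)) (e T q (i + n) * b))
        else 0) := by
  rcases lt_or_ge j 0 with hneg | hnonneg
  · rw [pz_of_neg T q n i hneg, pz_of_neg T q (n + 1) i hneg, act_zero, map_zero,
      if_neg (c := n ≤ 2 * j) (by omega)]
    simp only [act_zero, ite_self, add_zero]
  rcases lt_or_ge (n : ℤ) j with hgt | hle
  · rw [pz_of_gt T q i hgt, pz_of_gt T q (n := n + 1) i (j := j + 1) (by push_cast; omega),
      act_zero, map_zero, if_neg (by omega), if_neg (c := 2 * j = n + 1) (by omega)]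
    simp only [act_zero, ite_self, add_zero]
  lift j to ℕ using hnonneg
  have htoNat : ((n : ℤ) - j).toNat = n - j := by omega
  have hpz : pz T q (n + 1) i ((j : ℤ) + 1) = p T q (n + 1) i (j + 1) := by
    rw [← pz_natCast, Nat.cast_succ]
  rw [pz_natCast, pz_natCast, homotopy_act_p T q hq (by omega), htoNat, hpz, Int.cast_natCast]
  norm_cast

theorem homotopy_act_left (c : K) (a : Alg T q) (r : R T q n) :
    homotopy T q hq n (act T q c a r 1) = act T q c a (homotopy T q hq n r) 1 := by
  induction r using R.induction with
  | zero => rw [act_zero, map_zero, act_zero]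
  | add r s hr hs => rw [act_add, map_add, hr, hs, map_add, act_add]
  | gen a' b i j hj =>
    have hite : ∀ (P : Prop) [Decidable P] (z : R T q (n + 1)),
        act T q 1 (c • a) (if P then z else 0) 1 = if P then act T q 1 (c • a) z 1 else 0 := by
      intro P _ z
      split_ifs
      · rfl
      · exact act_zero _ _ _
    rw [act_eq_smul_left c, act_eq_smul_left c, act_act, homotopy_act_p T q hq hj,
      mul_one, mul_one, homotopy_act_p T q hq hj]
    simp only [act_add, hite, act_act, one_mul, mul_one]

theorem homotopy_mem {r : R T q n} (hr : r ∈ leftFiltration T q (R T q n) 1) :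
    homotopy T q hq n r ∈ leftFiltration T q (R T q (n + 1)) 1 := by
  induction hr using AddSubgroup.closure_induction with
  | mem z hz =>
    obtain ⟨l, a, r, ha, rfl⟩ := hz
    rw [homotopy_act_left]
    exact act_mem_leftFiltration T q _ _ ha _ _
  | zero => rw [map_zero]; exact zero_mem _
  | add z w _ _ hz hw => rw [map_add]; exact add_mem hz hw
  | neg z _ hz => rw [map_neg]; exact neg_mem hz

theorem homotopy_act_scalar (c : K) (b : Alg T q) :
    homotopy T q hq n (act T q c 1 (pz T q n i j) b) =
      act T q c 1 (homotopy T q hq n (act T q 1 1 (pz T q n i j) b)) 1 := by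
  rw [← homotopy_act_left, act_act, mul_one, one_mul, mul_one]

theorem homotopy_one (c : K) : homotopy T q hq n (act T q c 1 (pz T q n i j) 1) = 0 := by
  have hN : (if 2 * j = (n : ℤ) then 4 * T + 1 else 4 * T + 2) ≤ 4 * T + 2 := by split_ifs <;> omega
  rw [homotopy_act_scalar, homotopy_act_pz, mul_one, strip_e T q hq le_rfl, strip_e T q hq hN,
    lastCoeff_e]
  simp only [act_zero_right, ite_self, add_zero, act_zero]

theorem homotopy_near (hk : par (i + n) = k) (hj : 2 * j ≤ n) (c : K) {t : ℕ}
    (ht : t ≤ 4 * T + 1) :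
    homotopy T q hq n (act T q c 1 (pz T q n i j) (x T q k ^ (t + 1))) =
      act T q c 1 (pz T q (n + 1) i j) (x T q k ^ t) := by
  have hfar : (if (n : ℤ) ≤ 2 * j then act T q (S q (n - j).toNat (i + j))⁻¹ 1
      (pz T q (n + 1) i (j + 1)) (strip T q hq (k + 1)
        (if 2 * j = n then 4 * T + 1 else 4 * T + 2) (e T q (i + n) * x T q k ^ (t + 1))) else 0) =
      0 := by
    split_ifs with h h'
    · rw [strip_mono_of_ne T q hq (add_one_ne k).symm _ (by omega), act_zero_right]
    · omega
    · rfl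
  rw [homotopy_act_scalar, homotopy_act_pz, hk, if_pos hj, if_neg (c := 2 * j = n + 1) (by omega),
    hfar, strip_mono T q hq le_rfl _ _ (by omega), act_e_mul_pz T q (by push_cast; ring), add_zero,
    add_zero, act_act, mul_one, one_mul, mul_one]

theorem homotopy_near_of_lt (hk : par (i + n) = k) (hj : n < 2 * j) (c : K) {t : ℕ}
    (ht : t ≤ 4 * T) :
    homotopy T q hq n (act T q c 1 (pz T q n i j) (x T q k ^ (t + 1))) =
      if t = 4 * T ∧ 2 * j = n + 1 then act T q c 1 (pz T q (n + 1) i j) 1 else 0 := by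
  rw [homotopy_act_scalar, homotopy_act_pz, hk, if_neg (by omega), if_pos (by omega),
    strip_mono_of_ne T q hq (add_one_ne k).symm _ (by omega), act_zero_right, zero_add, zero_add,
    lastCoeff_mono]
  by_cases h : 2 * j = n + 1
  · by_cases h' : t = 4 * T
    · rw [if_pos h, if_pos (by omega), if_pos ⟨h', h⟩, act_act, mul_one, one_mul]
    · rw [if_pos h, if_neg (by omega), if_neg (by omega), act_zero_right, act_zero]
  · rw [if_neg h, if_neg (by omega), act_zero]

theorem homotopy_far_of_lt (hk : par (i + n) = k) (hj : 2 * j < n) (c : K) {t : ℕ}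
    (ht : t ≤ 4 * T) :
    homotopy T q hq n (act T q c 1 (pz T q n i j) (x T q (k + 1) ^ (t + 1))) = 0 := by
  rw [homotopy_act_scalar, homotopy_act_pz, hk, if_pos (by omega), if_neg (by omega),
    if_neg (by omega), strip_mono_of_ne T q hq (add_one_ne k) _ (by omega), act_zero_right,
    zero_add, zero_add, act_zero]

theorem homotopy_far (hk : par (i + n) = k) (hj : n ≤ 2 * j) (c : K) {t : ℕ}
    (ht : t ≤ 4 * T ∨ (t = 4 * T + 1 ∧ n < 2 * j)) :
    homotopy T q hq n (act T q c 1 (pz T q n i j) (x T q (k + 1) ^ (t + 1))) =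
      act T q (c * (S q (n - j).toNat (i + j))⁻¹) 1 (pz T q (n + 1) i (j + 1))
        (x T q (k + 1) ^ t) := by
  have hnear : (if 2 * j ≤ (n : ℤ) then act T q 1 1 (pz T q (n + 1) i j)
      (strip T q hq k (4 * T + 2) (e T q (i + n) * x T q (k + 1) ^ (t + 1))) else 0) = 0 := by
    split_ifs with h
    · rw [strip_mono_of_ne T q hq (add_one_ne k) _ (by omega), act_zero_right]
    · rfl
  rw [homotopy_act_scalar, homotopy_act_pz, hk, if_pos hj,
    lastCoeff_mono_of_ne T q hq (add_one_ne k), act_zero_right, ite_self, add_zero, hnear,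
    zero_add, strip_mono T q hq (by split_ifs <;> omega) _ _ (by split_ifs <;> omega),
    act_e_mul_pz T q (by push_cast; ring), act_act, mul_one, mul_one]

end Homotopy

/-! ### Exactness in positive degrees -/

section PositiveDegrees

variable {K : Type u} [Field K] (T : ℕ) (q : ZMod 4 → K)

theorem S_toNat_succ {u u' : ℤ} (hu : 0 ≤ u) (h : u + 1 = u') (v k : ZMod 4) (hk : v + u = k) :
    S q u'.toNat v = S q u.toNat v * q k := by
  lift u to ℕ using hu
  subst h hk
  rw [show ((u : ℤ) + 1).toNat = u + 1 by omega, Int.toNat_natCast, S_succ, Int.cast_natCast]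

theorem par_add_succ {n : ℕ} {i : ZMod 4} {k : ZMod 2} (hk : par (i + n) = k) :
    par (i + (n + 1 : ℕ)) = k + 1 := by
  rw [Nat.cast_succ, ← add_assoc, par_add_one, hk]

section Defect

variable (hq : ∀ i, q i ≠ 0)

/-- The deviation of `homotopy` from a contracting homotopy in positive degrees. -/
def defect (n : ℕ) : R T q (n + 1) →+ R T q (n + 1) :=
  AddMonoidHom.id _ - (d T q (n + 1)).toAddMonoidHom.comp (homotopy T q hq (n + 1))
    - (homotopy T q hq n).comp (d T q n).toAddMonoidHom

variable {n : ℕ} {i : ZMod 4} {j : ℤ} {k : ZMod 2}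

theorem defect_apply (y : R T q (n + 1)) : defect T q hq n y =
    y - d T q (n + 1) (homotopy T q hq (n + 1) y) - homotopy T q hq n (d T q n y) := rfl

theorem defect_act_left (c : K) (a : Alg T q) (r : R T q (n + 1)) :
    defect T q hq n (act T q c a r 1) = act T q c a (defect T q hq n r) 1 := by
  simp only [defect_apply, map_act, homotopy_act_left, act_sub]

theorem defect_mem_of_eq {y A' : R T q (n + 1)} {A : R T q (n + 2)} {B : R T q n}
    (hA : homotopy T q hq (n + 1) y = A)
    (hA' : d T q (n + 1) A - A' ∈ leftFiltration T q (R T q (n + 1)) 1)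
    (hB : d T q n y - B ∈ leftFiltration T q (R T q n) 1)
    (h : y = A' + homotopy T q hq n B) :
    defect T q hq n y ∈ leftFiltration T q (R T q (n + 1)) 1 := by
  have hsum := neg_mem (add_mem hA' (homotopy_mem T q hq hB))
  rw [map_sub] at hsum
  rw [defect_apply, hA]
  convert hsum using 1
  nth_rewrite 1 [h]
  abel

theorem defect_mem_of_homotopy_eq_zero {y : R T q (n + 1)} {B : R T q n}
    (hA : homotopy T q hq (n + 1) y = 0)
    (hB : d T q n y - B ∈ leftFiltration T q (R T q n) 1) (h : y = homotopy T q hq n B) :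
    defect T q hq n y ∈ leftFiltration T q (R T q (n + 1)) 1 :=
  defect_mem_of_eq T q hq hA (A' := 0) (by rw [map_zero, sub_zero]; exact zero_mem _) hB
    (by rw [zero_add, ← h])

theorem defect_one (hk : par (i + n) = k) :
    defect T q hq n (act T q 1 1 (pz T q (n + 1) i j) 1) ∈
      leftFiltration T q (R T q (n + 1)) 1 := by
  refine defect_mem_of_homotopy_eq_zero T q hq (homotopy_one T q hq 1)
    (d_act_pz_sub_mem T q hk (j := j) (a := if 2 * j ≤ n + 1 then 4 * T + 1 else 1)
      (b := if 2 * j < n + 1 then 1 else 4 * T + 1) (by split_ifs <;> omega) 1 1) ?_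
  rw [map_add, mul_one, mul_one, one_mul]
  rcases lt_trichotomy (2 * j) (n + 1) with h | h | h
  · rw [if_pos h.le, if_pos h, homotopy_far_of_lt T q hq hk (by omega) _ le_rfl, zero_add]
    have hnear := homotopy_near T q hq hk (j := j) (by omega) 1 (t := 0) (by omega)
    rw [pow_zero, zero_add] at hnear
    rw [hnear]
  · rw [if_pos h.le, if_neg (by omega), homotopy_far_of_lt T q hq hk (by omega) _ le_rfl, zero_add,
      homotopy_near_of_lt T q hq hk (by omega) 1 le_rfl, if_pos ⟨rfl, h⟩]
  · rw [if_neg (by omega), if_neg (by omega), homotopy_near_of_lt T q hq hk (by omega) 1 le_rfl,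
      if_neg (by omega), add_zero]
    have hfar := homotopy_far T q hq hk (j := j - 1) (by omega)
      (S q ((n : ℤ) + 1 - j).toNat (i + j - 1)) (t := 0) (Or.inl (by omega))
    have hu : (n : ℤ) - (j - 1) = n + 1 - j := by ring
    have hv : i + ((j - 1 : ℤ) : ZMod 4) = i + j - 1 := by push_cast; ring
    rw [hu, hv, pow_zero, zero_add, sub_add_cancel, mul_inv_cancel₀ (S_ne_zero hq _ _)] at hfar
    rw [hfar]

theorem defect_near_left (hk : par (i + n) = k) (hj : 2 * j ≤ n + 1) {t : ℕ}
    (ht : t ≤ 4 * T + 1) :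
    defect T q hq n (act T q 1 1 (pz T q (n + 1) i j) (x T q (k + 1) ^ (t + 1))) ∈
      leftFiltration T q (R T q (n + 1)) 1 := by
  refine defect_mem_of_eq T q hq
    (homotopy_near T q hq (par_add_succ hk) (by push_cast; omega) 1 ht)
    (d_act_pz_sub_mem T q (par_add_succ hk) (j := j) (a := 4 * T + 1) (b := 1)
      (Or.inl ⟨by push_cast; omega, rfl, rfl⟩) 1 _)
    (d_act_pz_sub_mem T q hk (j := j) (a := 4 * T + 1)
      (b := if 2 * j < n + 1 then 1 else 4 * T + 1) (by split_ifs <;> omega) 1 _) ?_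
  rw [x_pow_mul_x_pow T q (add_one_ne k).symm (by split_ifs <;> omega) (Nat.succ_ne_zero t),
    act_zero_right, add_zero, ← pow_add, ← pow_add, add_one_add_one, one_mul, one_mul,
    add_comm 1 t]
  rcases Nat.eq_zero_or_pos t with rfl | ht0
  · rw [pow_zero, mul_one, zero_add, act_pz_socle T q hk,
      homotopy_near T q hq hk (by omega) _ le_rfl]
    rcases lt_or_ge j 1 with h | h
    · rw [pz_of_neg T q (n + 1) i (j := j - 1) (by omega), act_zero, act_zero, zero_add, add_zero]
    · rw [← S_toNat_succ q (u := (n : ℤ) + 1 - j) (u' := ((n + 1 : ℕ) : ℤ) + 1 - j) (by omega)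
        (by push_cast; ring) (i + j - 1) (i + n) (by push_cast; ring), act_neg_scalar]
      abel
  · rw [x_pow_mul_x_pow T q (add_one_ne k).symm (by omega) (by omega), act_zero_right, zero_add,
      x_pow_eq_zero T q hq (k + 1) (show 4 * T + 3 ≤ 4 * T + 1 + (t + 1) by omega),
      act_zero_right, map_zero, add_zero]

theorem defect_far_left (hk : par (i + n) = k) (hj : 2 * j < n + 1) {t : ℕ}
    (ht : t ≤ 4 * T) :
    defect T q hq n (act T q 1 1 (pz T q (n + 1) i j) (x T q k ^ (t + 1))) ∈
      leftFiltration T q (R T q (n + 1)) 1 := by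
  have hs := homotopy_far_of_lt T q hq (par_add_succ hk) (j := j) (by push_cast; omega) 1 ht
  rw [add_one_add_one] at hs
  refine defect_mem_of_homotopy_eq_zero T q hq hs
    (d_act_pz_sub_mem T q hk (j := j) (a := 4 * T + 1) (b := 1) (Or.inl ⟨hj, rfl, rfl⟩) 1 _) ?_
  rw [x_pow_mul_x_pow T q (add_one_ne k) (by omega) (by omega), act_zero_right, zero_add,
    ← pow_add, add_comm 1, homotopy_near T q hq hk (by omega) 1 (by omega)]

theorem defect_far (hk : par (i + n) = k) (hj : n + 1 ≤ 2 * j)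
    {t : ℕ} (ht : t ≤ 4 * T ∨ (t = 4 * T + 1 ∧ n + 1 < 2 * j)) :
    defect T q hq n (act T q 1 1 (pz T q (n + 1) i j) (x T q k ^ (t + 1))) ∈
      leftFiltration T q (R T q (n + 1)) 1 := by
  have hs := homotopy_far T q hq (par_add_succ hk) (j := j) (by push_cast; omega) 1
    (t := t) (by push_cast; omega)
  rw [add_one_add_one, one_mul] at hs
  refine defect_mem_of_eq T q hq hs
    (d_act_pz_sub_mem T q (par_add_succ hk) (j := j + 1) (a := 1) (b := 4 * T + 1)
      (Or.inr (Or.inr ⟨by push_cast; omega, rfl, rfl⟩)) _ _)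
    (d_act_pz_sub_mem T q hk (j := j) (a := if 2 * j = n + 1 then 4 * T + 1 else 1) (b := 4 * T + 1)
      (by split_ifs <;> omega) 1 _) ?_
  have hu : ((n + 1 : ℕ) : ℤ) + 1 - (j + 1) = ((n + 1 : ℕ) : ℤ) - j := by ring
  have hv : i + ((j + 1 : ℤ) : ZMod 4) - 1 = i + j := by push_cast; ring
  rw [x_pow_mul_x_pow T q (add_one_ne k) (by split_ifs <;> omega) (Nat.succ_ne_zero t),
    act_zero_right, zero_add, hu, hv, inv_mul_cancel₀ (S_ne_zero hq _ _), add_one_add_one,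
    add_sub_cancel_right, ← pow_add, ← pow_add, add_comm 1 t]
  rcases Nat.eq_zero_or_pos t with rfl | ht0
  · rw [pow_zero, mul_one, zero_add, act_pz_socle' T q hq hk,
      homotopy_far T q hq hk (by omega) _ (Or.inr ⟨rfl, by omega⟩), one_mul]
    rcases lt_or_ge (n : ℤ) j with h | h
    · rw [pz_of_gt T q (n := n + 1) i (j := j + 1) (by push_cast; omega), act_zero, act_zero,
        add_zero, add_zero]
    · rw [S_toNat_succ q (u := (n : ℤ) - j) (u' := ((n + 1 : ℕ) : ℤ) - j) (by omega)
        (by push_cast; ring) (i + j) (i + n) (by push_cast; ring), neg_mul, act_neg_scalar,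
        mul_inv, mul_comm (q (i + n))⁻¹]
      abel
  · rw [x_pow_mul_x_pow T q (add_one_ne k) (by omega) (by omega), act_zero_right, add_zero,
      x_pow_eq_zero T q hq k (show 4 * T + 3 ≤ 4 * T + 1 + (t + 1) by omega),
      act_zero_right, map_zero, add_zero]

theorem d_near_right_sub_mem (hk : par (i + n) = k) (hj : n + 1 < 2 * j) (t : ℕ) :
    d T q n (act T q 1 1 (pz T q (n + 1) i j) (x T q (k + 1) ^ (t + 1)))
      - act T q (S q (n + 1 - j).toNat (i + j - 1)) 1 (pz T q n i (j - 1))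
        (x T q (k + 1) ^ (t + 1 + 1)) ∈ leftFiltration T q (R T q n) 1 := by
  have hB := d_act_pz_sub_mem T q hk (j := j) (a := 1) (b := 4 * T + 1)
      (Or.inr (Or.inr ⟨hj, rfl, rfl⟩)) 1 (x T q (k + 1) ^ (t + 1))
  rwa [x_pow_mul_x_pow T q (add_one_ne k).symm (by omega) (Nat.succ_ne_zero t), act_zero_right,
    add_zero, ← pow_add, one_mul, add_comm 1] at hB

theorem defect_near_right_middle (hk : par (i + n) = k) (hj : 2 * j = n + 2) :
    defect T q hq n (act T q 1 1 (pz T q (n + 1) i j) (x T q (k + 1) ^ (4 * T + 1))) ∈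
      leftFiltration T q (R T q (n + 1)) 1 := by
  have hs := homotopy_near_of_lt T q hq (par_add_succ hk) (j := j) (by push_cast; omega) 1 le_rfl
  rw [if_pos ⟨rfl, by push_cast; omega⟩] at hs
  refine defect_mem_of_eq T q hq hs
    (d_act_pz_sub_mem T q (par_add_succ hk) (j := j) (a := 4 * T + 1) (b := 4 * T + 1)
      (Or.inr (Or.inl ⟨by push_cast; omega, rfl, rfl⟩)) 1 1)
    (d_near_right_sub_mem T q hk (by omega) _) ?_
  rw [act_pz_socle T q hk, homotopy_near T q hq hk (by omega) _ le_rfl, mul_one,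
    mul_one, one_mul, add_one_add_one,
    ← S_toNat_succ q (u := (n : ℤ) + 1 - j) (u' := ((n + 1 : ℕ) : ℤ) + 1 - j)
      (by omega) (by push_cast; ring) (i + j - 1) (i + n) (by push_cast; ring), act_neg_scalar]
  abel

theorem defect_near_right (hk : par (i + n) = k) (hj : n + 1 < 2 * j) {t : ℕ} (ht : t ≤ 4 * T) :
    defect T q hq n (act T q 1 1 (pz T q (n + 1) i j) (x T q (k + 1) ^ (t + 1))) ∈
      leftFiltration T q (R T q (n + 1)) 1 := by
  by_cases h : t = 4 * T ∧ 2 * j = (n + 1 : ℕ) + 1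
  · obtain ⟨rfl, hmiddle⟩ := h
    exact defect_near_right_middle T q hq hk (by push_cast at hmiddle; omega)
  have hs := homotopy_near_of_lt T q hq (par_add_succ hk) (j := j) (by push_cast; omega) 1 ht
  rw [if_neg h] at hs
  refine defect_mem_of_homotopy_eq_zero T q hq hs (d_near_right_sub_mem T q hk hj t) ?_
  have hu : (n : ℤ) - (j - 1) = n + 1 - j := by ring
  have hv : i + ((j - 1 : ℤ) : ZMod 4) = i + j - 1 := by push_cast; ring
  rw [homotopy_far T q hq hk (by omega) _ (by push_cast at h; omega), hu, hv,
    mul_inv_cancel₀ (S_ne_zero hq _ _), sub_add_cancel]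

theorem defect_act_scalar {c : K} {b : Alg T q}
    (h : defect T q hq n (act T q 1 1 (pz T q (n + 1) i j) b) ∈
      leftFiltration T q (R T q (n + 1)) 1) :
    defect T q hq n (act T q c 1 (pz T q (n + 1) i j) b) ∈
      leftFiltration T q (R T q (n + 1)) 1 := by
  have hc := act_right_mem T q h c 1
  rwa [← defect_act_left, act_act, mul_one, one_mul, mul_one] at hc

theorem defect_act_pz_mem (l : ZMod 2) (t : ℕ) :
    defect T q hq n (act T q 1 1 (pz T q (n + 1) i j) (x T q l ^ t)) ∈
      leftFiltration T q (R T q (n + 1)) 1 := by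
  obtain ⟨k, hk⟩ : ∃ k, par (i + n) = k := ⟨_, rfl⟩
  rcases t with _ | t
  · rw [pow_zero]
    exact defect_one T q hq hk
  rcases lt_or_ge (4 * T + 1) t with ht | ht
  · rw [x_pow_eq_zero T q hq l (by omega), act_zero_right, map_zero]
    exact zero_mem _
  rcases eq_or_eq_add_one k l with rfl | rfl
  · by_cases h : t ≤ 4 * T
    · rcases lt_or_ge (2 * j) (n + 1) with hj | hj
      · exact defect_far_left T q hq hk hj h
      · exact defect_far T q hq hk hj (Or.inl h)
    · obtain rfl : t = 4 * T + 1 := by omega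
      rcases le_or_gt (2 * j) (n + 1) with hj | hj
      · have hsocle := act_pz_socle T q (n := n + 1) (i := i) (j := j) (par_add_succ hk) 1
        rw [add_one_add_one] at hsocle
        rw [hsocle]
        exact defect_act_scalar T q hq (defect_near_left T q hq hk hj le_rfl)
      · exact defect_far T q hq hk hj.le (Or.inr ⟨rfl, hj⟩)
  · rcases le_or_gt (2 * j) (n + 1) with hj | hj
    · exact defect_near_left T q hq hk hj ht
    · by_cases h : t ≤ 4 * T
      · exact defect_near_right T q hq hk hj h
      · obtain rfl : t = 4 * T + 1 := by omega
        have hsocle := act_pz_socle' T q (n := n + 1) (i := i) (j := j) hq (par_add_succ hk) 1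
        rw [add_one_add_one] at hsocle
        rw [hsocle]
        exact defect_act_scalar T q hq (defect_far T q hq hk hj.le (Or.inr ⟨rfl, hj⟩))

end Defect

theorem map_mem_leftFiltration_one {n : ℕ} (D : R T q n →+ R T q n)
    (hD : ∀ a r, D (act T q 1 a r 1) = act T q 1 a (D r) 1)
    (h : ∀ i j l t, j ≤ n →
      D (act T q 1 1 (p T q n i j) (x T q l ^ t)) ∈ leftFiltration T q (R T q n) 1)
    (r : R T q n) : D r ∈ leftFiltration T q (R T q n) 1 := by
  induction r using R.induction with
  | zero => rw [map_zero]; exact zero_mem _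
  | add r s hr hs => rw [map_add]; exact add_mem hr hs
  | gen a b i j hj =>
    have hleft : act T q 1 a (p T q n i j) b = act T q 1 a (act T q 1 1 (p T q n i j) b) 1 := by
      rw [act_act, mul_one, mul_one, mul_one]
    rw [hleft, hD]
    refine act_left_mem_one T q ?_ a
    clear hleft
    induction b using Alg.induction with
    | zero => rw [act_zero_right, map_zero]; exact zero_mem _
    | add b b' hb hb' => rw [act_add_right, map_add]; exact add_mem hb hb'
    | mono c k l t =>
      by_cases hk : i + n = k
      · subst hk
        have hmono : act T q 1 1 (p T q n i j) (c • (e T q (i + n) * x T q l ^ t)) =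
            act T q 1 (c • 1) (act T q 1 1 (p T q n i j) (x T q l ^ t)) 1 := by
          rw [act_smul_right, (fix_p T q n i j).act_e_right, act_act, mul_one, mul_one,
            mul_one, act_smul_left]
        rw [hmono, hD]
        exact act_left_mem_one T q (h i j l t hj) _
      · rw [act_smul_right, (fix_p T q n i j).act_of_ne hk, map_zero]
        exact zero_mem _

theorem map_mem_leftFiltration_succ {n : ℕ} (D : R T q n →+ R T q n)
    (hD : ∀ a r, D (act T q 1 a r 1) = act T q 1 a (D r) 1)
    (h : ∀ i j l t, j ≤ n →
      D (act T q 1 1 (p T q n i j) (x T q l ^ t)) ∈ leftFiltration T q (R T q n) 1)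
    {s : ℕ} {y : R T q n} (hy : y ∈ leftFiltration T q (R T q n) s) :
    D y ∈ leftFiltration T q (R T q n) (s + 1) := by
  induction hy using AddSubgroup.closure_induction with
  | mem z hz =>
    obtain ⟨l, a, r, ha, rfl⟩ := hz
    rw [hD]
    exact leftFiltration_anti T q (Nat.succ_le_succ ha)
      (act_left_mem T q (map_mem_leftFiltration_one T q D hD h r) l a)
  | zero => rw [map_zero]; exact zero_mem _
  | add z w _ _ hz hw => rw [map_add]; exact add_mem hz hw
  | neg z _ hz => rw [map_neg]; exact neg_mem hz

theorem exact_d_succ (hq : ∀ i, q i ≠ 0) (n : ℕ) :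
    Function.Exact (d T q (n + 1)) (d T q n) := by
  refine exact_of_filtered_homotopy (d T q (n + 1)).toAddMonoidHom (d T q n).toAddMonoidHom
    (homotopy T q hq (n + 1)) (homotopy T q hq n) (d_d T q hq n)
    (leftFiltration T q (R T q (n + 1))) (leftFiltration_zero T q _) (4 * T + 3)
    (leftFiltration_eq_bot T _ hq) fun k y hy => ?_
  refine map_mem_leftFiltration_succ T q (defect T q hq n) (defect_act_left T q hq 1)
    (fun i j l t _ => ?_) hy
  rw [← pz_natCast]
  exact defect_act_pz_mem T q hq l t

end PositiveDegrees

/-! ### Exactness in degree zero -/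

section Resolution

variable {K : Type u} [Field K] (T : ℕ) (q : ZMod 4 → K)

/-- The section `v ↦ ∑ v 𝔭^0_k` of the multiplication map. -/
def augSection : Alg T q →+ R T q 0 where
  toFun v := ∑ k, act T q 1 v (p T q 0 k 0) 1
  map_zero' := by simp only [act_zero_left, Finset.sum_const_zero]
  map_add' v w := by simp only [act_add_left, Finset.sum_add_distrib]

theorem augSection_apply (v : Alg T q) :
    augSection T q v = ∑ k, act T q 1 v (p T q 0 k 0) 1 := rfl

theorem augSection_mul (a v : Alg T q) :
    augSection T q (a * v) = act T q 1 a (augSection T q v) 1 := by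
  simp only [augSection_apply, act_sum, act_act, mul_one]

theorem augSection_e (i : ZMod 4) : augSection T q (e T q i) = p T q 0 i 0 := by
  have h (k : ZMod 4) :
      act T q 1 (e T q i) (p T q 0 k 0) 1 = if i = k then p T q 0 k 0 else 0 := by
    rw [← (fix_p T q 0 k 0).act_e_left, e_mul_e]
    split_ifs with hik
    · subst hik
      rw [← one_mul (e T q i), (fix_p T q 0 i 0).act_e_left, act_one]
    · rw [act_zero_left]
  simp only [augSection_apply, h, Finset.sum_ite_eq, Finset.mem_univ, if_true]

theorem aug_p (i : ZMod 4) : aug T q (p T q 0 i 0) = e T q i := by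
  rw [p, dif_pos (by omega), Bim.gen, aug_tmul T q (i, ⟨0, by omega⟩)]
  change e T q i * e T q (i + (0 : ℕ)) = _
  rw [Nat.cast_zero, add_zero, e_mul_self]

theorem act_alg (c : K) (a b v : Alg T q) : act T q c a v b = c • (a * (v * b)) := by
  rw [act_eq_smul_left, act, one_smul, env_smul_def, smul_mul_assoc]

theorem aug_act_p (c : K) (a b : Alg T q) (i : ZMod 4) :
    aug T q (act T q c a (p T q 0 i 0) b) = c • (a * (e T q i * b)) := by
  rw [map_act, aug_p, act_alg]

theorem aug_augSection (v : Alg T q) : aug T q (augSection T q v) = v := by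
  simp only [augSection_apply, map_sum, aug_act_p, one_smul, mul_one, ← Finset.mul_sum, sum_e]

theorem aug_surjective : Function.Surjective (aug T q) := fun v => ⟨_, aug_augSection T q v⟩

theorem aug_d (r : R T q 1) : aug T q (d T q 0 r) = 0 := by
  induction r using R.induction with
  | zero => rw [map_zero, map_zero]
  | add r s hr hs => rw [map_add, map_add, hr, hs, add_zero]
  | gen a b i j hj =>
    have hx (l : ZMod 2) : e T q i * x T q l = x T q l * e T q (i + 1) := by
      simpa using e_mul_x_pow T q i l 1
    have h : aug T q (dGen T q 0 i j) = 0 := by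
      rcases Nat.eq_zero_or_pos j with rfl | hpos
      · simp [dGen, aug_act_p, hx]
      · obtain rfl : j = 1 := by omega
        simp [dGen, aug_act_p, hx]
    rw [map_act, map_act, d_p T q 0 i j hj, h, act_zero]

section DefectZero

variable (hq : ∀ i, q i ≠ 0)

/-- The deviation of `homotopy` and `augSection` from a contracting homotopy in degree zero. -/
def defectZero : R T q 0 →+ R T q 0 :=
  AddMonoidHom.id _ - (d T q 0).toAddMonoidHom.comp (homotopy T q hq 0)
    - (augSection T q).comp (aug T q).toAddMonoidHom

theorem defectZero_apply (y : R T q 0) : defectZero T q hq y =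
    y - d T q 0 (homotopy T q hq 0 y) - augSection T q (aug T q y) := rfl

theorem defectZero_act_left (a : Alg T q) (r : R T q 0) :
    defectZero T q hq (act T q 1 a r 1) = act T q 1 a (defectZero T q hq r) 1 := by
  rw [defectZero_apply, defectZero_apply, homotopy_act_left, map_act, map_act, act_alg, mul_one,
    one_smul, augSection_mul, act_sub, act_sub]

theorem augSection_aug_act_p_mem (i : ZMod 4) (l : ZMod 2) (t : ℕ) :
    augSection T q (aug T q (act T q 1 1 (p T q 0 i 0) (x T q l ^ (t + 1)))) ∈
      leftFiltration T q (R T q 0) 1 := by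
  rw [aug_act_p, one_smul, one_mul, e_mul_x_pow, augSection_mul]
  exact act_mem_leftFiltration T q 1 l (Nat.le_add_left 1 t) _ _

theorem pz_zero_zero (i : ZMod 4) : pz T q 0 i 0 = p T q 0 i 0 := by
  rw [← pz_natCast, Nat.cast_zero]

variable {i : ZMod 4} {k : ZMod 2}

theorem defectZero_near (hk : par (i + (0 : ℕ)) = k) {t : ℕ} (ht : t ≤ 4 * T + 1) :
    defectZero T q hq (act T q 1 1 (p T q 0 i 0) (x T q k ^ (t + 1))) ∈
      leftFiltration T q (R T q 0) 1 := by
  have hd := d_act_pz_sub_mem T q hk (j := 0) (a := 4 * T + 1) (b := 1)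
    (Or.inl ⟨by norm_num, rfl, rfl⟩) 1 (x T q k ^ t)
  rw [pz_of_neg T q 0 i (j := 0 - 1) (by omega), act_zero,
    zero_add (act T q 1 1 (pz T q 0 i 0) _), ← pow_add, add_comm 1 t, pz_zero_zero] at hd
  have hs := homotopy_near T q hq hk (j := 0) (by norm_num) 1 ht
  rw [pz_zero_zero] at hs
  rw [defectZero_apply, hs, ← neg_sub (d T q 0 _)]
  exact sub_mem (neg_mem hd) (augSection_aug_act_p_mem T q i k t)

theorem defectZero_far (hk : par (i + (0 : ℕ)) = k) {t : ℕ} (ht : t ≤ 4 * T) :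
    defectZero T q hq (act T q 1 1 (p T q 0 i 0) (x T q (k + 1) ^ (t + 1))) ∈
      leftFiltration T q (R T q 0) 1 := by
  have hd := d_act_pz_sub_mem T q hk (j := 0 + 1) (a := 1) (b := 4 * T + 1)
    (Or.inr (Or.inr ⟨by norm_num, rfl, rfl⟩)) 1 (x T q (k + 1) ^ t)
  have hd_zero : (((0 : ℕ) : ℤ) + 1 - (0 + 1)).toNat = 0 := rfl
  rw [pz_of_gt T q (n := 0) i (j := 0 + 1) (by norm_num), act_zero, add_zero, ← pow_add,
    add_comm 1 t, hd_zero, S_zero, one_mul, add_sub_cancel_right, pz_zero_zero] at hd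
  have hs := homotopy_far T q hq hk (j := 0) (by norm_num) 1 (Or.inl ht)
  have hs_zero : (((0 : ℕ) : ℤ) - 0).toNat = 0 := rfl
  rw [hs_zero, S_zero, inv_one, one_mul, pz_zero_zero] at hs
  rw [defectZero_apply, hs, ← neg_sub (d T q 0 _)]
  exact sub_mem (neg_mem hd) (augSection_aug_act_p_mem T q i (k + 1) t)

theorem defectZero_act_p_mem (i : ZMod 4) (l : ZMod 2) (t : ℕ) :
    defectZero T q hq (act T q 1 1 (p T q 0 i 0) (x T q l ^ t)) ∈
      leftFiltration T q (R T q 0) 1 := by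
  obtain ⟨k, hk⟩ : ∃ k, par (i + (0 : ℕ)) = k := ⟨_, rfl⟩
  rcases t with _ | t
  · rw [pow_zero, defectZero_apply, ← pz_zero_zero, homotopy_one, pz_zero_zero, map_zero, aug_act_p,
      one_smul, mul_one, one_mul, augSection_e, act_one, sub_zero, sub_self]
    exact zero_mem _
  rcases lt_or_ge (4 * T + 1) t with ht | ht
  · rw [x_pow_eq_zero T q hq l (by omega), act_zero_right, map_zero]
    exact zero_mem _
  rcases eq_or_eq_add_one k l with rfl | rfl
  · exact defectZero_near T q hq hk ht
  by_cases hle : t ≤ 4 * T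
  · exact defectZero_far T q hq hk hle
  obtain rfl : t = 4 * T + 1 := by omega
  have hscalar (c : K) : act T q c 1 (p T q 0 i 0) (x T q k ^ (4 * T + 2)) =
      act T q 1 (c • 1) (act T q 1 1 (p T q 0 i 0) (x T q k ^ (4 * T + 2))) 1 := by
    rw [act_act, act_eq_smul_left c, mul_one, mul_one, mul_one]
  rw [← pz_zero_zero, act_pz_socle T q hk, pz_zero_zero, hscalar, defectZero_act_left]
  exact act_left_mem_one T q (defectZero_near T q hq hk le_rfl) _

end DefectZero

theorem exact_d_aug (hq : ∀ i, q i ≠ 0) : Function.Exact (d T q 0) (aug T q) := by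
  refine exact_of_filtered_homotopy (d T q 0).toAddMonoidHom (aug T q).toAddMonoidHom
    (homotopy T q hq 0) (augSection T q) (aug_d T q)
    (leftFiltration T q (R T q 0)) (leftFiltration_zero T q _) (4 * T + 3)
    (leftFiltration_eq_bot T _ hq) fun k y hy => ?_
  refine map_mem_leftFiltration_succ T q (defectZero T q hq) (defectZero_act_left T q hq)
    (fun i j l t hj => ?_) hy
  obtain rfl : j = 0 := by omega
  exact defectZero_act_p_mem T q hq i l t

/-! ### Projectivity -/

theorem fix_gen (i k : ZMod 4) : Fix T q i k (Bim.gen T q i k) := by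
  rw [Fix, Bim.gen, Bim.smul_tmul]
  congr 1
  · exact Subtype.ext (e_mul_self T q i)
  · exact Subtype.ext (e_mul_self T q k)

theorem incl_smul_gen (i k : ZMod 4) (z : Bim T q i k) :
    Bim.incl T q i k z • Bim.gen T q i k = z := by
  induction z using Bim.induction with
  | zero => rw [map_zero]; exact zero_smul (Env T q) (Bim.gen T q i k)
  | add z w hz hw => rw [map_add, add_smul, hz, hw]
  | gen a b =>
    rw [incl_act_gen, ← one_smul K (_ ⊗ₜ[K] _)]
    exact (fix_gen T q i k).act_e 1 a b

instance (i k : ZMod 4) : Module.Projective (Env T q) (Bim T q i k) :=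
  Module.Projective.of_split (Bim.incl T q i k)
    (LinearMap.toSpanSingleton (Env T q) _ (Bim.gen T q i k))
    (LinearMap.ext (incl_smul_gen T q i k))

/-! ### Minimality -/

section DegreeFiltration

variable (M : Type u) [AddCommGroup M] [Module (Env T q) M]

/-- The filtration of a bimodule by the elements `a z b` with `a` and `b` powers of some `x_l` of
total degree at least `k`; its first step is the radical of the bimodule. -/
def degreeFiltration (k : ℕ) : AddSubgroup M :=
  AddSubgroup.closure {y | ∃ (l l' : ZMod 2) (s t : ℕ) (z : M), k ≤ s + t ∧
    y = act T q 1 (x T q l ^ s) z (x T q l' ^ t)}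

variable {q} in
theorem degreeFiltration_eq_bot (hq : ∀ i, q i ≠ 0) : degreeFiltration T q M (8 * T + 5) = ⊥ := by
  rw [degreeFiltration, AddSubgroup.closure_eq_bot_iff]
  rintro y ⟨l, l', s, t, z, h, rfl⟩
  rcases lt_or_ge s (4 * T + 3) with hs | hs
  · rw [x_pow_eq_zero T q hq l' (t := t) (by omega), act_zero_right]
    rfl
  · rw [x_pow_eq_zero T q hq l hs, act_zero_left]
    rfl

theorem degreeFiltration_anti {k k' : ℕ} (h : k ≤ k') :
    degreeFiltration T q M k' ≤ degreeFiltration T q M k := by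
  refine AddSubgroup.closure_mono ?_
  rintro y ⟨l, l', s, t, z, hk, rfl⟩
  exact ⟨l, l', s, t, z, h.trans hk, rfl⟩

theorem leftFiltration_le_degreeFiltration (k : ℕ) :
    leftFiltration T q M k ≤ degreeFiltration T q M k := by
  refine AddSubgroup.closure_mono ?_
  rintro _ ⟨l, s, z, hs, rfl⟩
  exact ⟨l, 0, s, 0, z, hs, by rw [pow_zero]⟩

variable {M}

theorem act_mem_degreeFiltration (c : K) (l l' : ZMod 2) {k s t : ℕ} (h : k ≤ s + t) (z : M) :
    act T q c (x T q l ^ s) z (x T q l' ^ t) ∈ degreeFiltration T q M k := by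
  refine AddSubgroup.subset_closure ⟨l, l', s, t, act T q c 1 z 1, h, ?_⟩
  rw [act_act, mul_one, one_mul, one_mul]

theorem act_right_mem_degreeFiltration (c : K) (l : ZMod 2) {k t : ℕ} (h : k ≤ t) (z : M) :
    act T q c 1 z (x T q l ^ t) ∈ degreeFiltration T q M k := by
  simpa only [pow_zero, zero_add] using
    act_mem_degreeFiltration T q c 0 l (s := 0) (h.trans (Nat.le_add_left t 0)) z

theorem x_pow_mul_x_pow_eq_zero_or (l l' : ZMod 2) (s t : ℕ) :
    x T q l ^ s * x T q l' ^ t = 0 ∨ ∃ m, x T q l ^ s * x T q l' ^ t = x T q m ^ (s + t) := by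
  by_cases h : l = l'
  · subst h
    exact Or.inr ⟨l, (pow_add _ _ _).symm⟩
  rcases Nat.eq_zero_or_pos s with rfl | hs
  · exact Or.inr ⟨l', by rw [pow_zero, one_mul, zero_add]⟩
  rcases Nat.eq_zero_or_pos t with rfl | ht
  · exact Or.inr ⟨l, by rw [pow_zero, mul_one, add_zero]⟩
  exact Or.inl (x_pow_mul_x_pow T q h hs.ne' ht.ne')

theorem act_x_pow_mem_degreeFiltration {k : ℕ} {y : M} (hy : y ∈ degreeFiltration T q M k)
    (l l' : ZMod 2) (s t : ℕ) :
    act T q 1 (x T q l ^ s) y (x T q l' ^ t) ∈ degreeFiltration T q M (k + (s + t)) := by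
  induction hy using AddSubgroup.closure_induction with
  | mem y hy =>
    obtain ⟨m, m', s', t', z, h, rfl⟩ := hy
    rw [act_act]
    rcases x_pow_mul_x_pow_eq_zero_or T q l m s s' with hleft | ⟨n, hleft⟩
    · rw [hleft, act_zero_left]; exact zero_mem _
    rcases x_pow_mul_x_pow_eq_zero_or T q m' l' t' t with hright | ⟨n', hright⟩
    · rw [hright, act_zero_right]; exact zero_mem _
    rw [hleft, hright]
    exact act_mem_degreeFiltration T q _ _ _ (by omega) _
  | zero => rw [act_zero]; exact zero_mem _
  | add z w _ _ hz hw => rw [act_add]; exact add_mem hz hw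
  | neg z _ hz => rw [act_neg]; exact neg_mem hz

theorem act_e_mem_degreeFiltration {k : ℕ} {y : M} (hy : y ∈ degreeFiltration T q M k) (c : K)
    (m m' : ZMod 4) : act T q c (e T q m) y (e T q m') ∈ degreeFiltration T q M k := by
  induction hy using AddSubgroup.closure_induction with
  | mem y hy =>
    obtain ⟨l, l', s, t, z, h, rfl⟩ := hy
    have he := e_mul_x_pow T q (m' - t) l' t
    rw [sub_add_cancel] at he
    have hmem := act_mem_degreeFiltration T q 1 l l' h
      (act T q c (e T q (m + s)) z (e T q (m' - t)))
    rwa [act_act, one_mul, ← mul_one c, ← e_mul_x_pow, he, ← act_act] at hmem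
  | zero => rw [act_zero]; exact zero_mem _
  | add z w _ _ hz hw => rw [act_add]; exact add_mem hz hw
  | neg z _ hz => rw [act_neg]; exact neg_mem hz

theorem act_monomial_mem_degreeFiltration {k : ℕ} {y : M} (hy : y ∈ degreeFiltration T q M k)
    (c c' : K) (m m' : ZMod 4) (l l' : ZMod 2) (s t : ℕ) :
    act T q 1 (c • (e T q m * x T q l ^ s)) y (c' • (e T q m' * x T q l' ^ t)) ∈
      degreeFiltration T q M k := by
  have hcomm : act T q 1 (c • (e T q m * x T q l ^ s)) y (c' • (e T q m' * x T q l' ^ t)) =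
      act T q 1 (x T q l ^ s) (act T q (c * c') (e T q (m + s)) y (e T q m')) (x T q l' ^ t) := by
    rw [act_act, ← e_mul_x_pow, act_smul_left, act_smul_right, one_mul, one_mul]
  rw [hcomm]
  exact degreeFiltration_anti T q M (Nat.le_add_right k (s + t))
    (act_x_pow_mem_degreeFiltration T q (act_e_mem_degreeFiltration T q hy _ _ _) l l' s t)

theorem act_degreeFiltration {k : ℕ} {y : M} (hy : y ∈ degreeFiltration T q M k) (a b : Alg T q) :
    act T q 1 a y b ∈ degreeFiltration T q M k := by
  induction a using Alg.induction with
  | zero => rw [act_zero_left]; exact zero_mem _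
  | add a a' h h' => rw [act_add_left]; exact add_mem h h'
  | mono c m l s =>
    induction b using Alg.induction with
    | zero => rw [act_zero_right]; exact zero_mem _
    | add b b' h h' => rw [act_add_right]; exact add_mem h h'
    | mono c' m' l' t => exact act_monomial_mem_degreeFiltration T q hy c c' m m' l l' s t

theorem exists_sub_mem_degreeFiltration_succ {L : Submodule (Env T q) M}
    (hL : ∀ z : M, ∃ u ∈ L, z - u ∈ degreeFiltration T q M 1) {k : ℕ} {y : M}
    (hy : y ∈ degreeFiltration T q M k) :
    ∃ u ∈ L, y - u ∈ degreeFiltration T q M (k + 1) := by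
  induction hy using AddSubgroup.closure_induction with
  | mem y hy =>
    obtain ⟨l, l', s, t, z, h, rfl⟩ := hy
    obtain ⟨u, hu, hz⟩ := hL z
    refine ⟨act T q 1 (x T q l ^ s) u (x T q l' ^ t), L.smul_mem _ hu, ?_⟩
    rw [← act_sub]
    exact degreeFiltration_anti T q M (by omega) (act_x_pow_mem_degreeFiltration T q hz l l' s t)
  | zero => exact ⟨0, L.zero_mem, by rw [sub_zero]; exact zero_mem _⟩
  | add y w _ _ hy hw =>
    obtain ⟨u, hu, hu'⟩ := hy
    obtain ⟨v, hv, hv'⟩ := hw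
    exact ⟨u + v, L.add_mem hu hv, by rw [add_sub_add_comm]; exact add_mem hu' hv'⟩
  | neg y _ hy =>
    obtain ⟨u, hu, hu'⟩ := hy
    exact ⟨-u, L.neg_mem hu, by rw [neg_sub_neg, ← neg_sub]; exact neg_mem hu'⟩

variable {q} in
/-- Nakayama's lemma: `M = L + F¹M` is improved to `M = L + FᵏM` for all `k`. -/
theorem isSuperfluous_of_le_degreeFiltration (hq : ∀ i, q i ≠ 0) {N : Submodule (Env T q) M}
    (hN : ∀ y ∈ N, y ∈ degreeFiltration T q M 1) : N.IsSuperfluous := by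
  intro L hL
  have first (y : M) : ∃ u ∈ L, y - u ∈ degreeFiltration T q M 1 := by
    obtain ⟨u, hu, v, hv, rfl⟩ := Submodule.mem_sup.mp (hL ▸ Submodule.mem_top : y ∈ L ⊔ N)
    exact ⟨u, hu, by rw [add_sub_cancel_left]; exact hN v hv⟩
  have all (k : ℕ) (y : M) : ∃ u ∈ L, y - u ∈ degreeFiltration T q M (k + 1) := by
    induction k with
    | zero => exact first y
    | succ k ih =>
      obtain ⟨u, hu, hu'⟩ := ih
      obtain ⟨v, hv, hv'⟩ := exists_sub_mem_degreeFiltration_succ T q first hu'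
      exact ⟨u + v, L.add_mem hu hv, by rwa [← sub_sub]⟩
  refine eq_top_iff.mpr fun y _ => ?_
  obtain ⟨u, hu, hyu⟩ := all (8 * T + 4) y
  rw [degreeFiltration_eq_bot T M hq, AddSubgroup.mem_bot, sub_eq_zero] at hyu
  exact hyu ▸ hu

end DegreeFiltration

theorem d_mem_degreeFiltration (n : ℕ) (r : R T q (n + 1)) :
    d T q n r ∈ degreeFiltration T q (R T q n) 1 := by
  induction r using R.induction with
  | zero => rw [map_zero]; exact zero_mem _
  | add r s hr hs => rw [map_add]; exact add_mem hr hs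
  | gen a b i j _ =>
    rw [map_act, ← pz_natCast]
    refine act_degreeFiltration T q ?_ a b
    obtain ⟨s, t, hst⟩ := exists_isExponentPair T n j
    have hd := leftFiltration_le_degreeFiltration T q _ _ (d_pz_sub_mem T q (i := i) rfl hst)
    rw [← sub_add_cancel (d T q n _)]
    exact add_mem hd (add_mem (act_right_mem_degreeFiltration T q _ _ (by omega) _)
      (act_right_mem_degreeFiltration T q _ _ (by omega) _))

theorem isMinimalProjectiveResolution (hq : ∀ i, q i ≠ 0) :
    IsMinimalProjectiveResolution (S := Env T q) (M := Alg T q) (R T q) (aug T q) (d T q) where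
  projective _ := inferInstance
  surjective := aug_surjective T q
  exact_zero := exact_d_aug T q hq
  exact_succ := exact_d_succ T q hq
  minimal_zero := isSuperfluous_of_le_degreeFiltration T hq fun y hy => by
    obtain ⟨r, rfl⟩ := (exact_d_aug T q hq y).mp hy
    exact d_mem_degreeFiltration T q 0 r
  minimal_succ n := isSuperfluous_of_le_degreeFiltration T hq fun y hy => by
    obtain ⟨r, rfl⟩ := (exact_d_succ T q hq n y).mp hy
    exact d_mem_degreeFiltration T q (n + 1) r

end Resolution

/-! ### The elements `g^n_{i,j}` -/

section Elements

variable {K : Type u} [Field K]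

theorem cons_injective (l : ZMod 2) (a b : ZMod 4) :
    Function.Injective fun r : Quiver.Path a b => r.cons (Arrow.a l b : b ⟶ b + 1) :=
  fun _ _ h => eq_of_heq (Quiver.Path.heq_of_cons_eq_cons h)

/-- The linear map of `KΓ` that removes a final arrow `a_{l,m}` from a path and kills all other
paths. -/
def dropLast (l : ZMod 2) : KΓ K →ₗ[K] KΓ K where
  toFun f := fun a b => Finsupp.lcomapDomain _ (cons_injective l a b) (f a (b + 1))
  map_add' f g := PathAlgebra.ext fun a b =>
    map_add (Finsupp.lcomapDomain _ (cons_injective l a b)) (f a (b + 1)) (g a (b + 1))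
  map_smul' c f := PathAlgebra.ext fun a b =>
    map_smul (Finsupp.lcomapDomain _ (cons_injective l a b)) c (f a (b + 1))

theorem dropLast_apply (l : ZMod 2) (f : KΓ K) {a b : ZMod 4} (r : Quiver.Path a b) :
    dropLast l f a b r = f a (b + 1) (r.cons (Arrow.a l b)) := rfl

theorem dropLast_ofPath_cons (l l' : ZMod 2) {a b : ZMod 4} (r : Quiver.Path a b) :
    dropLast l (PathAlgebra.ofPath (r.cons (Arrow.a l' b)) : KΓ K) =
      if l = l' then PathAlgebra.ofPath r else 0 := by
  classical
  refine PathAlgebra.ext fun a' b' => Finsupp.ext fun s => ?_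
  rw [dropLast_apply]
  rcases ne_or_eq a' a with ha | rfl
  · split_ifs <;> simp [PathAlgebra.ofPath, Pi.single_eq_of_ne ha, PathAlgebra.zero_apply]
  rcases ne_or_eq b' b with hb | rfl
  · have hb' : b' + 1 ≠ b + 1 := fun h => hb (add_right_cancel h)
    split_ifs <;> simp [PathAlgebra.ofPath, Pi.single_eq_of_ne hb, Pi.single_eq_of_ne hb',
      PathAlgebra.zero_apply]
  split_ifs with hl
  · subst hl
    simp only [PathAlgebra.ofPath, Pi.single_eq_same, Finsupp.single_apply]
    exact if_congr (cons_injective l a' b').eq_iff rfl rfl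
  · simp only [PathAlgebra.ofPath, Pi.single_eq_same, PathAlgebra.zero_apply, Finsupp.zero_apply]
    refine Finsupp.single_eq_of_ne fun h => ?_
    have harrow := eq_of_heq (Quiver.Path.hom_heq_of_cons_eq_cons h)
    injection harrow with hl'
    exact hl hl'

theorem dropLast_mul_xPath (l l' : ZMod 2) (f : KΓ K) :
    dropLast l (f * xPath K l') = if l = l' then f else 0 := by
  induction f using PathAlgebra.induction_ofPath with
  | zero => rw [zero_mul, map_zero, ite_self]
  | add f g hf hg =>
    rw [add_mul, map_add, hf, hg]
    split_ifs
    · rfl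
    · exact add_zero 0
  | path c a b r =>
    rw [smul_mul_assoc, map_smul, ofPath_mul_xPath, dropLast_ofPath_cons, smul_ite, smul_zero]

theorem dropLast_mul_pow (l : ZMod 2) (f : KΓ K) (t : ℕ) :
    dropLast l (f * xPath K l ^ (t + 1)) = f * xPath K l ^ t := by
  rw [pow_succ, ← mul_assoc, dropLast_mul_xPath, if_pos rfl]

theorem dropLast_mul_pow_of_ne {l l' : ZMod 2} (h : l ≠ l') (f : KΓ K) {t : ℕ} (ht : t ≠ 0) :
    dropLast l (f * xPath K l' ^ t) = 0 := by
  obtain ⟨t, rfl⟩ := Nat.exists_eq_succ_of_ne_zero ht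
  rw [pow_succ, ← mul_assoc, dropLast_mul_xPath, if_neg h]

theorem mul_xPath_pow_injective (l : ZMod 2) (t : ℕ) :
    Function.Injective fun f : KΓ K => f * xPath K l ^ t := by
  induction t with
  | zero =>
    simp only [pow_zero, mul_one]
    exact Function.injective_id
  | succ t ih =>
    intro f g h
    have hdrop := congrArg (dropLast l) h
    rw [dropLast_mul_pow, dropLast_mul_pow] at hdrop
    exact ih hdrop

theorem mul_xPath_pow_eq_zero {f : KΓ K} {l : ZMod 2} {t : ℕ} : f * xPath K l ^ t = 0 ↔ f = 0 :=
  (mul_xPath_pow_injective l t).eq_iff' (zero_mul _)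

theorem xPath_pow_mul_vertex (i : ZMod 4) (l : ZMod 2) (t : ℕ) :
    xPath K l ^ t * vertex K (i + t) = vertex K i * xPath K l ^ t := by
  induction t generalizing i with
  | zero => rw [pow_zero, one_mul, mul_one, Nat.cast_zero, add_zero]
  | succ t ih =>
    rw [Nat.cast_succ, ← add_assoc, pow_succ, mul_assoc, xPath_mul_vertex, ← vertex_mul_xPath,
      ← mul_assoc, ih, mul_assoc]

theorem vertex_ne_zero (i : ZMod 4) : vertex K i ≠ 0 := by
  intro h
  have hcoeff := congrArg (fun f : KΓ K => f i i Quiver.Path.nil) h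
  simp [vertex, PathAlgebra.ofPath, PathAlgebra.zero_apply] at hcoeff

variable (T : ℕ) (q : ZMod 4 → K)

/-- The elements `g^n_{i,j}` with the convention that they vanish unless `0 ≤ j ≤ n`; this makes
the recursion for them uniform in `j`. -/
def gz (n : ℕ) (i : ZMod 4) (j : ℤ) : KΓ K := if 0 ≤ j ∧ j ≤ n then g T q n i j.toNat else 0

theorem gz_natCast {n j : ℕ} (h : j ≤ n) (i : ZMod 4) : gz T q n i j = g T q n i j := by
  rw [gz, if_pos (by omega), Int.toNat_natCast]

theorem gz_natCast_sub_one {n j : ℕ} (h0 : j ≠ 0) (h : j ≤ n + 1) (i : ZMod 4) :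
    gz T q n i (j - 1) = g T q n i (j - 1) := by
  rw [← gz_natCast T q (by omega), Nat.cast_pred (Nat.pos_of_ne_zero h0)]

theorem gz_eq_zero {n : ℕ} {j : ℤ} (h : j < 0 ∨ n < j) (i : ZMod 4) : gz T q n i j = 0 :=
  if_neg (by omega)

theorem gz_zero (i : ZMod 4) (j : ℤ) : gz T q 0 i j = if j = 0 then vertex K i else 0 := by
  rw [gz, g]
  exact if_congr (by omega) rfl rfl

theorem g_two_mul_add_one {m j : ℕ} (hj : j ≤ 2 * m + 1) (i : ZMod 4) {a b : ℕ}
    (hab : IsExponentPair T (2 * m) j a b) :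
    g T q (2 * m + 1) i j =
      S q (2 * m + 1 - j) (i + j - 1) • (gz T q (2 * m) i (j - 1) * xPath K (par i + 1) ^ a)
        + gz T q (2 * m) i j * xPath K (par i) ^ b := by
  have hm : 2 * m / 2 = m := by omega
  simp only [g, par_add_one, hm, Nat.mul_mod_right, if_true]
  rcases eq_or_ne j 0 with rfl | h0
  · obtain rfl : b = 1 := by omega
    rw [if_pos rfl, gz_eq_zero T q (by omega), gz_natCast T q (by omega), zero_mul, smul_zero,
      zero_add, pow_one]
  rw [if_neg h0, gz_natCast_sub_one T q h0 hj]
  rcases hj.lt_or_eq with hlt | rfl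
  · rw [gz_natCast T q (by omega)]
    split_ifs
    · obtain ⟨rfl, rfl⟩ : a = 4 * T + 1 ∧ b = 1 := by omega
      rw [pow_one]
    · obtain ⟨rfl, rfl⟩ : a = 1 ∧ b = 4 * T + 1 := by omega
      rw [pow_one]
    · omega
  · obtain rfl : a = 1 := by omega
    rw [if_neg (by omega), if_neg (by omega), gz_eq_zero T q (by omega), Nat.sub_self, S_zero,
      one_smul, zero_mul, add_zero, pow_one, Nat.add_sub_cancel]

theorem g_two_mul_add_two {m j : ℕ} (hj : j ≤ 2 * m + 2) (i : ZMod 4) {a b : ℕ}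
    (hab : IsExponentPair T (2 * m + 1) j a b) :
    g T q (2 * m + 2) i j =
      S q (2 * m + 2 - j) (i + j - 1) • (gz T q (2 * m + 1) i (j - 1) * xPath K (par i) ^ a)
        + gz T q (2 * m + 1) i j * xPath K (par i + 1) ^ b := by
  have hm : (2 * m + 1 + 1) / 2 = m + 1 := by omega
  have hmod : ¬ (2 * m + 1) % 2 = 0 := by omega
  rw [show 2 * m + 2 = 2 * m + 1 + 1 from rfl, g]
  simp only [par_add_one, hm, if_neg hmod]
  rcases eq_or_ne j 0 with rfl | h0
  · obtain rfl : b = 1 := by omega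
    rw [if_pos rfl, gz_eq_zero T q (by omega), gz_natCast T q (by omega), zero_mul, smul_zero,
      zero_add, pow_one]
  rw [if_neg h0, gz_natCast_sub_one T q h0 hj]
  rcases hj.lt_or_eq with hlt | rfl
  · rw [gz_natCast T q (by omega)]
    split_ifs with _ hmid
    · obtain ⟨rfl, rfl⟩ : a = 4 * T + 1 ∧ b = 1 := by omega
      rw [pow_one]
      rfl
    · obtain ⟨rfl, rfl⟩ : a = 4 * T + 1 ∧ b = 4 * T + 1 := by omega
      rw [hmid, show 2 * m + 2 - (m + 1) = m + 1 by omega]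
    · obtain ⟨rfl, rfl⟩ : a = 1 ∧ b = 4 * T + 1 := by omega
      rw [pow_one]
      rfl
    · omega
  · obtain rfl : a = 1 := by omega
    rw [if_neg (by omega), if_neg (by omega), if_neg (by omega), gz_eq_zero T q (by omega),
      Nat.sub_self, S_zero, one_smul, zero_mul, add_zero, pow_one]
    rfl

theorem gz_succ {n : ℕ} {i : ZMod 4} {j : ℤ} {a b : ℕ} {k : ZMod 2} (hk : par (i + n) = k)
    (hab : IsExponentPair T n j a b) :
    gz T q (n + 1) i j =
      S q (n + 1 - j).toNat (i + j - 1) • (gz T q n i (j - 1) * xPath K (k + 1) ^ a)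
        + gz T q n i j * xPath K k ^ b := by
  by_cases hj : j < 0 ∨ (n + 1 : ℕ) < j
  · rw [gz_eq_zero T q hj, gz_eq_zero T q (j := j - 1) (by omega),
      gz_eq_zero T q (j := j) (by omega), zero_mul, zero_mul, smul_zero, add_zero]
  obtain ⟨j, rfl⟩ := Int.eq_ofNat_of_zero_le (show 0 ≤ j by omega)
  rw [gz_natCast T q (by omega), Int.cast_natCast,
    show ((n : ℤ) + 1 - j).toNat = n + 1 - j by omega]
  rcases Nat.even_or_odd' n with ⟨m, rfl | rfl⟩
  · rw [g_two_mul_add_one T q (by omega) i hab, ← hk, par_add_even]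
  · rw [g_two_mul_add_two T q (by omega) i hab, ← hk, par_add_odd, add_one_add_one]

theorem vertex_mul_gz (n : ℕ) (i : ZMod 4) (j : ℤ) :
    vertex K i * gz T q n i j = gz T q n i j := by
  induction n generalizing j with
  | zero => rw [gz_zero, mul_ite, mul_zero, vertex_mul_vertex, if_pos rfl]
  | succ n ih =>
    obtain ⟨a, b, hab⟩ := exists_isExponentPair T n j
    rw [gz_succ T q rfl hab, mul_add, mul_smul_comm, ← mul_assoc, ← mul_assoc, ih, ih]

theorem gz_mul_vertex (n : ℕ) (i : ZMod 4) (j : ℤ) :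
    gz T q n i j * vertex K (i + n) = gz T q n i j := by
  induction n generalizing j with
  | zero =>
    rw [gz_zero, ite_mul, zero_mul, vertex_mul_vertex, Nat.cast_zero, add_zero, if_pos rfl]
  | succ n ih =>
    obtain ⟨a, b, hab⟩ := exists_isExponentPair T n j
    have cast_exponent : ∀ t : ℕ, t = 1 ∨ t = 4 * T + 1 → (t : ZMod 4) = 1 := by
      rintro _ (rfl | rfl)
      · exact Nat.cast_one
      · rw [Nat.cast_succ, cast_four_mul, zero_add]
    have absorb : ∀ (l : ZMod 2) (t : ℕ) (j : ℤ), t = 1 ∨ t = 4 * T + 1 →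
        gz T q n i j * xPath K l ^ t * vertex K (i + (n + 1 : ℕ)) =
          gz T q n i j * xPath K l ^ t := fun l t j ht => by
      rw [Nat.cast_succ, ← add_assoc, ← cast_exponent t ht, mul_assoc, xPath_pow_mul_vertex,
        ← mul_assoc, ih]
    rw [gz_succ T q rfl hab, add_mul, smul_mul_assoc, absorb _ _ _ (by omega),
      absorb _ _ _ (by omega)]

theorem dropLast_gz (n : ℕ) (i : ZMod 4) (j : ℤ) :
    dropLast (par (i + n)) (gz T q (n + 1) i j) =
      gz T q n i j * xPath K (par (i + n)) ^ (if 2 * j < n + 1 then 0 else 4 * T) := by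
  obtain ⟨a, b, hab⟩ := exists_isExponentPair T n j
  have hb : b = (if 2 * j < n + 1 then 0 else 4 * T) + 1 := by split_ifs <;> omega
  rw [gz_succ T q rfl hab, map_add, map_smul,
    dropLast_mul_pow_of_ne (add_one_ne _).symm _ (by omega), smul_zero, zero_add, hb,
    dropLast_mul_pow]

variable {q}

theorem gz_ne_zero (hq : ∀ i, q i ≠ 0) {n : ℕ} (i : ZMod 4) {j : ℤ} (h0 : 0 ≤ j) (hj : j ≤ n) :
    gz T q n i j ≠ 0 := by
  induction n generalizing j with
  | zero =>
    rw [gz_zero, if_pos (by omega)]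
    exact vertex_ne_zero i
  | succ n ih =>
    intro hzero
    rcases lt_or_ge (n : ℤ) j with hn | hn
    · obtain ⟨a, b, hab⟩ := exists_isExponentPair T n j
      rw [gz_succ T q rfl hab, gz_eq_zero T q (j := j) (Or.inr hn), zero_mul, add_zero,
        smul_eq_zero_iff_right (S_ne_zero hq _ _), mul_xPath_pow_eq_zero] at hzero
      exact ih (by omega) (by omega) hzero
    · have hdrop := dropLast_gz T q n i j
      rw [hzero, map_zero, eq_comm, mul_xPath_pow_eq_zero] at hdrop
      exact ih h0 hn hdrop

theorem gz_ne_of_lt (hq : ∀ i, q i ≠ 0) {n : ℕ} (i : ZMod 4) {j j' : ℤ} (h0 : 0 ≤ j) (hj : j < j')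
    (hj' : j' ≤ n) : gz T q n i j ≠ gz T q n i j' := by
  induction n generalizing j j' with
  | zero => omega
  | succ n ih =>
    intro h
    have hdrop := congrArg (dropLast (par (i + n))) h
    rw [dropLast_gz, dropLast_gz] at hdrop
    rcases lt_or_ge (n : ℤ) j' with hn | hn
    · rw [gz_eq_zero T q (Or.inr hn), zero_mul, mul_xPath_pow_eq_zero] at hdrop
      exact gz_ne_zero T hq i h0 (by omega) hdrop
    by_cases hexp : T = 0 ∨ (2 * j < n + 1 ↔ 2 * j' < n + 1)
    · have same_exponent : (if 2 * j < (n : ℤ) + 1 then 0 else 4 * T) =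
          if 2 * j' < (n : ℤ) + 1 then 0 else 4 * T := by split_ifs <;> omega
      rw [same_exponent] at hdrop
      exact ih h0 hj hn (mul_xPath_pow_injective _ _ hdrop)
    -- Every path on the right ends in `x_l`, but some path on the left ends in `x_{l+1}`.
    · rw [if_pos (by omega), if_neg (by omega), pow_zero, mul_one] at hdrop
      obtain ⟨n, rfl⟩ := Nat.exists_eq_add_of_lt (show 0 < n by omega)
      rw [zero_add] at hdrop hn
      have hdrop_twice := congrArg (dropLast (par (i + n))) hdrop
      have hne : par (i + n) ≠ par (i + (n + 1 : ℕ)) := by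
        rw [Nat.cast_succ, ← add_assoc, par_add_one]
        exact (add_one_ne _).symm
      rw [dropLast_mul_pow_of_ne hne _ (by omega), dropLast_gz, mul_xPath_pow_eq_zero]
        at hdrop_twice
      exact gz_ne_zero T hq i h0 (by omega) hdrop_twice

theorem g_ne_zero (hq : ∀ i, q i ≠ 0) {n j : ℕ} (hj : j ≤ n) (i : ZMod 4) : g T q n i j ≠ 0 := by
  rw [← gz_natCast T q hj]
  exact gz_ne_zero T hq i (by omega) (by omega)

variable (q)

theorem vertex_mul_g {n j : ℕ} (hj : j ≤ n) (i : ZMod 4) :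
    vertex K i * g T q n i j = g T q n i j := by
  rw [← gz_natCast T q hj, vertex_mul_gz]

theorem g_mul_vertex {n j : ℕ} (hj : j ≤ n) (i : ZMod 4) :
    g T q n i j * vertex K (i + n) = g T q n i j := by
  rw [← gz_natCast T q hj, gz_mul_vertex]

theorem g_injective (hq : ∀ i, q i ≠ 0) (n : ℕ) :
    Function.Injective fun ij : ZMod 4 × Fin (n + 1) => g T q n ij.1 ij.2 := by
  rintro ⟨i, j, hj⟩ ⟨i', j', hj'⟩ h
  rw [Nat.lt_succ_iff] at hj hj'
  change g T q n i j = g T q n i' j' at h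
  obtain rfl : i = i' := by
    by_contra hne
    refine g_ne_zero T hq hj i ?_
    rw [← vertex_mul_g T q hj, h, ← vertex_mul_g T q hj' i', ← mul_assoc, vertex_mul_vertex,
      if_neg hne, zero_mul]
  rw [← gz_natCast T q hj, ← gz_natCast T q hj'] at h
  rcases lt_trichotomy j j' with hlt | rfl | hlt
  · exact absurd h (gz_ne_of_lt T hq i (by omega) (by omega) (by omega))
  · rfl
  · exact absurd h.symm (gz_ne_of_lt T hq i (by omega) (by omega) (by omega))

end Elements

end CyclicAlg

end

theorem theorem2p4_general {K : Type*} [Field K] (T : ℕ) (q : ZMod 4 → K)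
    (hq : ∀ i, q i ≠ 0) :
    (∀ n : ℕ,
      (∀ (i : ZMod 4) (j : Fin (n + 1)), CyclicAlg.g T q n i j ≠ 0 ∧
        CyclicAlg.vertex K i * CyclicAlg.g T q n i j * CyclicAlg.vertex K (i + n) =
          CyclicAlg.g T q n i j) ∧
      Function.Injective fun ij : ZMod 4 × Fin (n + 1) => CyclicAlg.g T q n ij.1 ij.2) ∧
    IsMinimalProjectiveResolution (S := CyclicAlg.Env T q) (M := CyclicAlg.Alg T q)
      (CyclicAlg.R T q) (CyclicAlg.aug T q) (CyclicAlg.d T q) := by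
  refine ⟨fun n => ⟨fun i j => ?_, CyclicAlg.g_injective T q hq n⟩,
    CyclicAlg.isMinimalProjectiveResolution T q hq⟩
  have hj : (j : ℕ) ≤ n := Nat.le_of_lt_succ j.2
  refine ⟨CyclicAlg.g_ne_zero T hq hj i, ?_⟩
  rw [CyclicAlg.vertex_mul_g T q hj, CyclicAlg.g_mul_vertex T q hj]

theorem theorem2p4 {K : Type*} [Field K] [IsAlgClosed K] (T : ℕ) (q : ZMod 4 → K)
    (hq : ∀ i, q i ≠ 0) :
    -- the elements `g^n_{i,j}` are pairwise distinct, nonzero, and uniform with origin `e_i` and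
    -- terminus `e_{i+n}`, so that `R^n` is the direct sum of the `A 𝔬(g) ⊗ 𝔱(g) A`, `g ∈ 𝒢^n`
    (∀ n : ℕ,
      (∀ (i : ZMod 4) (j : Fin (n + 1)), CyclicAlg.g T q n i j ≠ 0 ∧
        CyclicAlg.vertex K i * CyclicAlg.g T q n i j * CyclicAlg.vertex K (i + n) =
          CyclicAlg.g T q n i j) ∧
      Function.Injective fun ij : ZMod 4 × Fin (n + 1) => CyclicAlg.g T q n ij.1 ij.2) ∧
    IsMinimalProjectiveResolution (S := CyclicAlg.Env T q) (M := CyclicAlg.Alg T q)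
      (CyclicAlg.R T q) (CyclicAlg.aug T q) (CyclicAlg.d T q) :=
  theorem2p4_general T q hq
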